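/- Let $\omega,\gamma,\beta,\nu,\theta$ be real numbers with $\theta\neq0$, $\gamma\ne 0$, $\beta>0$, $\beta-\nu^2\neq0$, let $q=\gamma+\frac{\nu(\gamma\nu-1)}{2(\beta-\nu^2)}$, and consider the Zakharov–Rubenchik system $$\begin{cases} i\partial_t B+\omega\partial_x^2B=\gamma\left(\sqrt\beta-\frac{\nu}{2}\right)\psi_1B-\gamma\left(\sqrt\beta+\frac{\nu}{2}\right)\psi_2B+\gamma q|B|^2B,\\ \theta\,\partial_t\psi_1+(\sqrt\beta-\nu)\,\partial_x\psi_1=\frac{\gamma}{2}\left(-1+\frac{\nu}{2\sqrt\beta}\right)\partial_x(|B|^2),\\ \theta\,\partial_t\psi_2-(\nu+\sqrt\beta)\,\partial_x\psi_2=\frac{\gamma}{2}\left(-1-\frac{\nu}{2\sqrt\beta}\right)\partial_x(|B|^2), \end{cases}\qquad x\in\mathbb R,$$ for a complex-valued function $B$ and real-valued functions $\psi_1,\psi_2$ of $(t,x)$. Let $T>0$ and let $k,l,s$ be real numbers such that either $l<-\frac12$ and $\nu\ne2\sqrt\beta$, or $s<-\frac12$ and $\nu\neq-2\sqrt\beta$.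 Let $X=H^k(\mathbb R)\times H^l(\mathbb R)\times H^s(\mathbb R)$, where the first component is complex-valued and the other two are real-valued. Let $S:X\to C([0,T];X)$ be any map such that, for all data in some neighbourhood of the origin of $X$ whose components are Schwartz functions, $S(B_0,\psi_{10},\psi_{20})$ is a smooth solution $(B,\psi_1,\psi_2)$ of the system on $[0,T]$ with these initial data (smooth: $C^\infty$ on $[0,T]\times\mathbb R$ and bounded in $H^n(\mathbb R)$ uniformly in $t\in[0,T]$ for every $n$). Then $S$ is not twice continuously differentiable (in the real Fréchet sense) at the origin $(0,0,0)$. -/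

import Mathlib

open Set Filter Topology MeasureTheory
open scoped SchwartzMap NNReal

noncomputable section

/-! ### The Sobolev spaces `H^s(ℝ)` -/

/-- The tempered distributions `f` on `ℝ` with `(1 + |ξ|²)^{s/2} f̂ ∈ L²`. -/
def sobolevSubmodule (s : ℝ) : Submodule ℂ 𝓢'(ℝ, ℂ) where
  carrier := {f | TemperedDistribution.MemSobolev s 2 f}
  add_mem' := fun hf hg => hf.add hg
  zero_mem' := TemperedDistribution.memSobolev_fun_zero ℝ ℂ s 2
  smul_mem' := fun c _ hf => hf.smul c

/-- The Sobolev space `H^s(ℝ) = H^s(ℝ; ℂ)`, as a type of its own, so that it carries its Hilbert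
norm and not the topology of distributions. -/
def Sobolev (s : ℝ) : Type := ↥(sobolevSubmodule s)

namespace Sobolev

instance (s : ℝ) : AddCommGroup (Sobolev s) :=
  inferInstanceAs (AddCommGroup ↥(sobolevSubmodule s))

instance (s : ℝ) : Module ℂ (Sobolev s) :=
  inferInstanceAs (Module ℂ ↥(sobolevSubmodule s))

/-- The tempered distribution underlying an element of `H^s(ℝ)`. -/
def toDistribution {s : ℝ} : Sobolev s →ₗ[ℂ] 𝓢'(ℝ, ℂ) := (sobolevSubmodule s).subtype

theorem toDistribution_injective {s : ℝ} :
    Function.Injective (toDistribution : Sobolev s → 𝓢'(ℝ, ℂ)) :=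
  Subtype.val_injective

theorem memSobolev {s : ℝ} (f : Sobolev s) :
    TemperedDistribution.MemSobolev s 2 (toDistribution f) :=
  Subtype.property f

theorem lp_toDistribution_injective :
    Function.Injective (Lp.toTemperedDistributionCLM ℂ (volume : Measure ℝ) 2) :=
  LinearMap.ker_eq_bot.mp Lp.ker_toTemperedDistributionCLM_eq_bot

/-- The `L²` function `J^s f`, where `J^s` is the Fourier multiplier with symbol
`(1 + |ξ|²)^{s/2}`. -/
def bessel {s : ℝ} (f : Sobolev s) : Lp ℂ 2 (volume : Measure ℝ) := (memSobolev f).choose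

theorem bessel_spec {s : ℝ} (f : Sobolev s) :
    Lp.toTemperedDistributionCLM ℂ (volume : Measure ℝ) 2 (bessel f) =
      TemperedDistribution.besselPotential ℝ ℂ s (toDistribution f) :=
  (memSobolev f).choose_spec.symm

/-- `J^s : H^s → L²` as a linear map. -/
def besselLM (s : ℝ) : Sobolev s →ₗ[ℂ] Lp ℂ 2 (volume : Measure ℝ) where
  toFun := bessel
  map_add' f g := lp_toDistribution_injective <| by simp only [map_add, bessel_spec]
  map_smul' c f := lp_toDistribution_injective <| by
    simp only [map_smul, bessel_spec, RingHom.id_apply]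

theorem besselLM_injective (s : ℝ) : Function.Injective (besselLM s) := by
  intro f g h
  apply toDistribution_injective
  have h' : TemperedDistribution.besselPotential ℝ ℂ s (toDistribution f) =
      TemperedDistribution.besselPotential ℝ ℂ s (toDistribution g) := by
    rw [← bessel_spec, ← bessel_spec]
    exact congrArg _ h
  have h2 := congrArg (TemperedDistribution.besselPotential ℝ ℂ (-s)) h'
  simpa using h2

/-- The norm of `H^s(ℝ)` is `‖f‖ = ‖J^s f‖_{L²} = (∫ (1 + |ξ|²)^s |f̂(ξ)|² dξ)^{1/2}`. -/
instance (s : ℝ) : NormedAddCommGroup (Sobolev s) :=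
  NormedAddCommGroup.induced (Sobolev s) _ (besselLM s) (besselLM_injective s)

instance (s : ℝ) : NormedSpace ℂ (Sobolev s) :=
  NormedSpace.induced ℂ (Sobolev s) _ (besselLM s)

theorem norm_def {s : ℝ} (f : Sobolev s) : ‖f‖ = ‖bessel f‖ := rfl

end Sobolev

/-- The real-valued elements of `H^s(ℝ)`: the distributions that take real values on real-valued
test functions. -/
def realSobolev (s : ℝ) : Submodule ℝ (Sobolev s) where
  carrier := {f | ∀ φ : 𝓢(ℝ, ℂ), (∀ x, (φ x).im = 0) → (Sobolev.toDistribution f φ).im = 0}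
  add_mem' := by
    intro f g hf hg φ hφ
    have h : Sobolev.toDistribution (f + g) φ =
        Sobolev.toDistribution f φ + Sobolev.toDistribution g φ := by
      rw [map_add]; rfl
    rw [h, Complex.add_im, hf φ hφ, hg φ hφ, add_zero]
  zero_mem' := by
    intro φ _
    have h : Sobolev.toDistribution (0 : Sobolev s) φ = 0 := by
      rw [map_zero]; rfl
    rw [h, Complex.zero_im]
  smul_mem' := by
    intro c f hf φ hφ
    have h : Sobolev.toDistribution (c • f) φ = (c : ℂ) * Sobolev.toDistribution f φ := by
      have h1 : c • f = (c : ℂ) • f := rfl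
      rw [h1, map_smul]; rfl
    rw [h, Complex.im_ofReal_mul, hf φ hφ, mul_zero]

/-- A tempered distribution is given by (integration against) the function `f`. -/
def IsGivenBy (u : 𝓢'(ℝ, ℂ)) (f : ℝ → ℂ) : Prop :=
  ∀ φ : 𝓢(ℝ, ℂ), Integrable (fun x => φ x * f x) ∧ u φ = ∫ x, φ x * f x

/-! ### The Zakharov–Rubenchik system -/

/-- The real constants `ω` (written `omega`), `γ`, `β`, `ν`, `θ` of the system. -/
structure ZRConstants where
  omega : ℝ
  γ : ℝ
  β : ℝ
  ν : ℝ
  θ : ℝ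

/-- The coefficient `q = γ + ν (γ ν - 1) / (2 (β - ν²))` of the cubic term. -/
def ZRConstants.q (c : ZRConstants) : ℝ :=
  c.γ + c.ν * (c.γ * c.ν - 1) / (2 * (c.β - c.ν ^ 2))

/-- `(B, ψ₁, ψ₂)`, as functions of `(t, x)`, is a smooth solution of the Zakharov–Rubenchik system
on `[0, T] × ℝ`: the functions are `C^∞` on `[0, T] × ℝ`, all their `x`-derivatives are bounded in
`L²(ℝ)` uniformly on `[0, T]` (so that they lie in `L^∞(0, T; H^n)`, and by the equations in
`C([0, T]; H^n)`, for every `n`), and the three equations hold at every point. -/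
structure IsSmoothZRSolution (c : ZRConstants) (T : ℝ)
    (B : ℝ → ℝ → ℂ) (ψ₁ ψ₂ : ℝ → ℝ → ℝ) : Prop where
  smooth_B : ContDiffOn ℝ (⊤ : ℕ∞) (fun p : ℝ × ℝ => B p.1 p.2) (Icc 0 T ×ˢ univ)
  smooth_ψ₁ : ContDiffOn ℝ (⊤ : ℕ∞) (fun p : ℝ × ℝ => ψ₁ p.1 p.2) (Icc 0 T ×ˢ univ)
  smooth_ψ₂ : ContDiffOn ℝ (⊤ : ℕ∞) (fun p : ℝ × ℝ => ψ₂ p.1 p.2) (Icc 0 T ×ˢ univ)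
  sobolev_B : ∀ n : ℕ, ∃ M : ℝ≥0, ∀ t ∈ Icc 0 T,
    eLpNorm (iteratedDeriv n (B t)) 2 volume ≤ M
  sobolev_ψ₁ : ∀ n : ℕ, ∃ M : ℝ≥0, ∀ t ∈ Icc 0 T,
    eLpNorm (iteratedDeriv n (ψ₁ t)) 2 volume ≤ M
  sobolev_ψ₂ : ∀ n : ℕ, ∃ M : ℝ≥0, ∀ t ∈ Icc 0 T,
    eLpNorm (iteratedDeriv n (ψ₂ t)) 2 volume ≤ M
  eq_B : ∀ t ∈ Icc 0 T, ∀ x : ℝ,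
    Complex.I * derivWithin (fun τ => B τ x) (Icc 0 T) t + c.omega * iteratedDeriv 2 (B t) x =
      (c.γ * (√c.β - c.ν / 2) * ψ₁ t x : ℝ) * B t x
        - (c.γ * (√c.β + c.ν / 2) * ψ₂ t x : ℝ) * B t x
        + (c.γ * c.q * ‖B t x‖ ^ 2 : ℝ) * B t x
  eq_ψ₁ : ∀ t ∈ Icc 0 T, ∀ x : ℝ,
    c.θ * derivWithin (fun τ => ψ₁ τ x) (Icc 0 T) t + (√c.β - c.ν) * deriv (ψ₁ t) x =
      c.γ / 2 * (-1 + c.ν / (2 * √c.β)) * deriv (fun y => ‖B t y‖ ^ 2) x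
  eq_ψ₂ : ∀ t ∈ Icc 0 T, ∀ x : ℝ,
    c.θ * derivWithin (fun τ => ψ₂ τ x) (Icc 0 T) t - (c.ν + √c.β) * deriv (ψ₂ t) x =
      c.γ / 2 * (-1 - c.ν / (2 * √c.β)) * deriv (fun y => ‖B t y‖ ^ 2) x

/-! ### The data-to-solution map -/

/-- The phase space `H^k(ℝ) × H^l(ℝ) × H^s(ℝ)`; the first component is complex-valued, the other
two are real-valued. -/
abbrev ZRSpace (k l s : ℝ) : Type := Sobolev k × realSobolev l × realSobolev s

/-- The element `u` of the phase space is given by the functions `B`, `ψ₁`, `ψ₂`. -/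
def ZRSpace.IsGivenBy {k l s : ℝ} (u : ZRSpace k l s) (B : ℝ → ℂ) (ψ₁ ψ₂ : ℝ → ℝ) : Prop :=
  _root_.IsGivenBy (Sobolev.toDistribution u.1) B ∧
  _root_.IsGivenBy (Sobolev.toDistribution (u.2.1 : Sobolev l)) (fun x => (ψ₁ x : ℂ)) ∧
  _root_.IsGivenBy (Sobolev.toDistribution (u.2.2 : Sobolev s)) (fun x => (ψ₂ x : ℂ))

/-- `S` is a data-to-solution map of the Zakharov–Rubenchik system from (a neighbourhood of the
origin in) `H^k × H^l × H^s` to `C([0, T]; H^k × H^l × H^s)`: for all sufficiently small data `u₀`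
that are given by Schwartz functions, `S u₀` is the smooth solution on `[0, T]` with these data.
For rough data the nonlinear terms need not make sense, and there any value is permitted; so every
extension of the smooth solution map to rough data is a data-to-solution map. -/
def IsZRDataToSolutionMap (c : ZRConstants) {k l s T : ℝ}
    (S : ZRSpace k l s → C(Icc (0 : ℝ) T, ZRSpace k l s)) : Prop :=
  ∀ᶠ u₀ in 𝓝 (0 : ZRSpace k l s), ∀ (B₀ : 𝓢(ℝ, ℂ)) (ψ₁₀ ψ₂₀ : 𝓢(ℝ, ℝ)),
    u₀.IsGivenBy B₀ ψ₁₀ ψ₂₀ →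
    ∃ (B : ℝ → ℝ → ℂ) (ψ₁ ψ₂ : ℝ → ℝ → ℝ), IsSmoothZRSolution c T B ψ₁ ψ₂ ∧
      B 0 = B₀ ∧ ψ₁ 0 = ψ₁₀ ∧ ψ₂ 0 = ψ₂₀ ∧
      ∀ t : Icc (0 : ℝ) T, (S u₀ t).IsGivenBy (B t) (ψ₁ t) (ψ₂ t)

end

/-!
The obstruction to twice differentiability is a resonant interaction of high frequencies which the
second derivative of the solution map at the origin would have to control.

For small data `ε (φ, ψ, 0)` the `B`-component of the solution is `ε` times a free Schrödinger
wave plus `ε²` times a Duhamel integral of the product of the free Schrödinger wave with data `φ`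
and the free transported wave with data `ψ`, plus an error of order `ε³`
(`IsSolution.exists_expansion`). The expansion is tested against a third, smooth free wave `X` with
compactly supported frequencies, that is, it is an expansion of the numbers `∫ B X`; so only
integrations by parts are needed and no well-posedness theory. The solution itself has to be bounded
by `O(ε)` on the given interval `[0, T]`: `B` in `L² ∩ L^∞`, `ψ₁` and `ψ₂` in `L²`, besides `O(ε²)`
for `∂_x |B|²` in `L²`. This is where the structure of the system enters: mass and energy are
conserved, and together with the transport equations they close a bootstrap for small `ε`
(`IsSolution.exists_a_priori_bound`). For `ω = 0` the energy does not control `∂_x B`, but then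
`|B|²` does not depend on time.

If the solution map `S` is `C²` at the origin, then Taylor's formula
`S (ε u) = S 0 + ε S' u + O(ε² ‖u‖²)` and the expansion bound the quadratic term by
`C ‖u‖² ‖X‖_{H^{-k}}`, with a constant independent of the data and of `X`
(`exists_interaction_bound`).

Take now `ψ` with frequencies near `± N` and `φ` with frequencies near `-N/2`, so that their product
has frequencies near `N/2`. The phase of the interaction is
`(ζ - η) (2 π ω (ζ + η) + v)`, with `η` the frequency of `φ` and `ζ` the output frequency. For
`ω ≠ 0` a bounded shift of the centres makes it vanish there, and it stays bounded over the whole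
time interval on windows of width `μ ~ 1/N`; for `ω = 0` it stays bounded up to times `t ~ 1/N` on
windows of width `~ N` (`exists_resonant_frequencies`). In both cases `t √μ ≳ N^{-1/2}`. There is no
cancellation in the Duhamel integral (`le_norm_integral_pairing`), whose size for normalized data is
therefore `t √μ N^{-ℓ}`, up to constants, where `ℓ` is the regularity of `ψ`: the weights in `k`
cancel, since `φ` and the output have comparable frequencies. Boundedness would give
`N^{-1/2} ≲ N^ℓ` as `N → ∞`, which is false for `ℓ < -1/2` (`IsSolutionMap.not_contDiffAt`).

The two alternatives of the hypothesis exchange the roles of `ψ₁` and `ψ₂`; the inequality on `ν`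
says that the coupling constant of the transported component in the equation for `B` is not zero.
-/

noncomputable section

namespace ZakharovRubenchik

/-! ### Calculus of smooth functions on a space-time strip -/

/-- The spatial derivative of a function of `(t, x)`. -/
def dx (f : ℝ → ℝ → ℂ) : ℝ → ℝ → ℂ := fun t x => deriv (f t) x

/-- The functions of `(t, x)` that are smooth on the strip `[0, T] × ℝ` and bounded in every
`H^n(ℝ)`, uniformly in time. -/
structure SobolevSmooth (T : ℝ) (f : ℝ → ℝ → ℂ) : Prop where
  smooth : ContDiffOn ℝ (⊤ : ℕ∞) (fun p : ℝ × ℝ => f p.1 p.2) (Icc 0 T ×ˢ univ)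
  bound : ∀ n : ℕ, ∃ M : ℝ≥0, ∀ t ∈ Icc 0 T, eLpNorm (iteratedDeriv n (f t)) 2 volume ≤ M

/-- `f'` is the time derivative of `f` in the interior of the strip. -/
def HasTimeDeriv (T : ℝ) (f f' : ℝ → ℝ → ℂ) : Prop :=
  ∀ t ∈ Ioo 0 T, ∀ x, HasDerivAt (fun τ => f τ x) (f' t x) t

/-- The squared `L²` norm at time `t`. -/
def normSq (f : ℝ → ℝ → ℂ) (t : ℝ) : ℝ := ∫ x, ‖f t x‖ ^ 2

/-- The bilinear (not sesquilinear) `L²` pairing at time `t`. -/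
def pairing (f g : ℝ → ℝ → ℂ) (t : ℝ) : ℂ := ∫ x, f t x * g t x

theorem normSq_nonneg (f : ℝ → ℝ → ℂ) (t : ℝ) : 0 ≤ normSq f t :=
  integral_nonneg fun _ => by positivity

theorem contDiff_slice {T : ℝ} {f : ℝ → ℝ → ℂ}
    (hf : ContDiffOn ℝ (⊤ : ℕ∞) (fun p : ℝ × ℝ => f p.1 p.2) (Icc 0 T ×ˢ univ))
    {t : ℝ} (ht : t ∈ Icc 0 T) : ContDiff ℝ (⊤ : ℕ∞) (f t) := by
  rw [← contDiffOn_univ]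
  exact hf.comp (f := fun x : ℝ => (t, x)) (by fun_prop) fun x _ => ⟨ht, mem_univ x⟩

theorem uniqueDiffOn_strip {T : ℝ} (hT : 0 < T) :
    UniqueDiffOn ℝ (Icc 0 T ×ˢ (univ : Set ℝ)) :=
  (uniqueDiffOn_Icc hT).prod uniqueDiffOn_univ

theorem dx_eq_fderivWithin {T : ℝ} {f : ℝ → ℝ → ℂ}
    (hf : ContDiffOn ℝ (⊤ : ℕ∞) (fun p : ℝ × ℝ => f p.1 p.2) (Icc 0 T ×ˢ univ))
    {t : ℝ} (ht : t ∈ Icc 0 T) (x : ℝ) :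
    dx f t x = fderivWithin ℝ (fun p : ℝ × ℝ => f p.1 p.2) (Icc 0 T ×ˢ univ) (t, x) (0, 1) := by
  have h1 : HasFDerivWithinAt (fun p : ℝ × ℝ => f p.1 p.2)
      (fderivWithin ℝ (fun p : ℝ × ℝ => f p.1 p.2) (Icc 0 T ×ˢ univ) (t, x))
      (Icc 0 T ×ˢ univ) (t, x) :=
    ((hf.differentiableOn (by simp)) (t, x) ⟨ht, mem_univ x⟩).hasFDerivWithinAt
  have h2 : HasDerivWithinAt (fun y : ℝ => (t, y)) ((0 : ℝ), (1 : ℝ)) univ x :=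
    ((hasDerivAt_const x t).prodMk (hasDerivAt_id x)).hasDerivWithinAt
  have h3 := h1.comp_hasDerivWithinAt x h2 (fun y _ => ⟨ht, mem_univ y⟩)
  exact (hasDerivWithinAt_univ.mp h3).deriv

theorem contDiffOn_dx {T : ℝ} (hT : 0 < T) {f : ℝ → ℝ → ℂ}
    (hf : ContDiffOn ℝ (⊤ : ℕ∞) (fun p : ℝ × ℝ => f p.1 p.2) (Icc 0 T ×ˢ univ)) :
    ContDiffOn ℝ (⊤ : ℕ∞) (fun p : ℝ × ℝ => dx f p.1 p.2) (Icc 0 T ×ˢ univ) := by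
  have h : ContDiffOn ℝ (⊤ : ℕ∞) (fun p : ℝ × ℝ =>
      fderivWithin ℝ (fun p : ℝ × ℝ => f p.1 p.2) (Icc 0 T ×ˢ univ) p (0, 1))
      (Icc 0 T ×ˢ univ) :=
    (hf.fderivWithin (uniqueDiffOn_strip hT) (by simp)).clm_apply contDiffOn_const
  exact h.congr fun p hp => dx_eq_fderivWithin hf hp.1 p.2

/-! ### Square integrability -/

theorem integral_norm_sq_eq {f : ℝ → ℂ} (hf : MemLp f 2 volume) :
    ∫ x, ‖f x‖ ^ 2 = (eLpNorm f 2 volume).toReal ^ 2 := by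
  have h := hf.eLpNorm_eq_integral_rpow_norm (by norm_num) (by norm_num)
  rw [h, ENNReal.toReal_ofReal (by positivity)]
  have h0 : 0 ≤ ∫ x, ‖f x‖ ^ 2 := integral_nonneg fun _ => by positivity
  simp only [ENNReal.toReal_ofNat, Real.rpow_ofNat]
  rw [← one_div, ← Real.sqrt_eq_rpow, Real.sq_sqrt h0]

theorem integrable_norm_sq {f : ℝ → ℂ} (hf : MemLp f 2 volume) :
    Integrable (fun x => ‖f x‖ ^ 2) :=
  hf.integrable_norm_pow (by norm_num)

theorem integrable_mul_of_memLp {f g : ℝ → ℂ} (hf : MemLp f 2 volume) (hg : MemLp g 2 volume) :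
    Integrable (fun x => f x * g x) :=
  hf.integrable_mul hg

theorem integral_norm_mul_le {f g : ℝ → ℂ} (hf : MemLp f 2 volume) (hg : MemLp g 2 volume) :
    ∫ x, ‖f x * g x‖ ≤ √(∫ x, ‖f x‖ ^ 2) * √(∫ x, ‖g x‖ ^ 2) := by
  have h := integral_mul_norm_le_Lp_mul_Lq (μ := volume) (f := f) (g := g)
    (p := 2) (q := 2) (by constructor <;> norm_num) (by simpa using hf) (by simpa using hg)
  simp only [Real.rpow_ofNat] at h
  simpa only [norm_mul, Real.sqrt_eq_rpow] using h

theorem norm_integral_mul_le {f g : ℝ → ℂ} (hf : MemLp f 2 volume) (hg : MemLp g 2 volume) :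
    ‖∫ x, f x * g x‖ ≤ √(∫ x, ‖f x‖ ^ 2) * √(∫ x, ‖g x‖ ^ 2) :=
  (norm_integral_le_integral_norm _).trans (integral_norm_mul_le hf hg)

/-- The Sobolev inequality `‖f‖_∞² ≤ ‖f‖_{H¹}²` on the line. -/
theorem norm_sq_le_integral {f : ℝ → ℂ} (hf : ContDiff ℝ 1 f) (h0 : MemLp f 2 volume)
    (h1 : MemLp (deriv f) 2 volume) (x : ℝ) :
    ‖f x‖ ^ 2 ≤ (∫ y, ‖f y‖ ^ 2) + ∫ y, ‖deriv f y‖ ^ 2 := by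
  have hd : ∀ y, HasDerivAt f (deriv f y) y :=
    fun y => (hf.differentiable (by simp) y).hasDerivAt
  have hstar : MemLp (fun y => (starRingEnd ℂ) (f y)) 2 volume := h0.star
  have hstar1 : MemLp (fun y => (starRingEnd ℂ) (deriv f y)) 2 volume := h1.star
  have hd2 : ∀ y, HasDerivAt (fun y => f y * (starRingEnd ℂ) (f y))
      (deriv f y * (starRingEnd ℂ) (f y) + f y * (starRingEnd ℂ) (deriv f y)) y := by
    intro y
    exact (hd y).mul (hd y).star
  have hi0 := integrable_mul_of_memLp h0 hstar
  have hi1 : Integrable (fun y => deriv f y * (starRingEnd ℂ) (f y) +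
      f y * (starRingEnd ℂ) (deriv f y)) :=
    (integrable_mul_of_memLp h1 hstar).add (integrable_mul_of_memLp h0 hstar1)
  have hlim := tendsto_zero_of_hasDerivAt_of_integrableOn_Iic (a := x) (fun y _ => hd2 y)
    hi1.integrableOn hi0.integrableOn
  have hint := integral_Iic_of_hasDerivAt_of_tendsto (a := x)
    (hd2 x).continuousAt.continuousWithinAt (fun y _ => hd2 y) hi1.integrableOn hlim
  have heq : ‖f x‖ ^ 2 = ‖f x * (starRingEnd ℂ) (f x)‖ := by
    rw [norm_mul, RCLike.norm_conj, sq]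
  rw [heq, ← sub_zero (f x * (starRingEnd ℂ) (f x)), ← hint]
  calc ‖∫ y in Iic x, (deriv f y * (starRingEnd ℂ) (f y) + f y * (starRingEnd ℂ) (deriv f y))‖
      ≤ ∫ y in Iic x, ‖deriv f y * (starRingEnd ℂ) (f y) +
          f y * (starRingEnd ℂ) (deriv f y)‖ := norm_integral_le_integral_norm _
    _ ≤ ∫ y, ‖deriv f y * (starRingEnd ℂ) (f y) + f y * (starRingEnd ℂ) (deriv f y)‖ :=
        setIntegral_le_integral hi1.norm (Eventually.of_forall fun _ => norm_nonneg _)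
    _ ≤ ∫ y, (‖f y‖ ^ 2 + ‖deriv f y‖ ^ 2) := by
        apply integral_mono hi1.norm ((integrable_norm_sq h0).add (integrable_norm_sq h1))
        intro y
        refine (norm_add_le _ _).trans ?_
        simp only [norm_mul, RCLike.norm_conj, Pi.add_apply]
        nlinarith [sq_nonneg (‖f y‖ - ‖deriv f y‖)]
    _ = _ := integral_add (integrable_norm_sq h0) (integrable_norm_sq h1)

namespace SobolevSmooth

variable {T : ℝ} {f g : ℝ → ℝ → ℂ}

theorem contDiff (hf : SobolevSmooth T f) {t : ℝ} (ht : t ∈ Icc 0 T) :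
    ContDiff ℝ (⊤ : ℕ∞) (f t) := contDiff_slice hf.smooth ht

theorem memLp_iteratedDeriv (hf : SobolevSmooth T f) {t : ℝ} (ht : t ∈ Icc 0 T) (n : ℕ) :
    MemLp (iteratedDeriv n (f t)) 2 volume := by
  obtain ⟨M, hM⟩ := hf.bound n
  exact ⟨((hf.contDiff ht).continuous_iteratedDeriv n
    (by exact_mod_cast le_top)).aestronglyMeasurable,
    (hM t ht).trans_lt ENNReal.coe_lt_top⟩

theorem memLp (hf : SobolevSmooth T f) {t : ℝ} (ht : t ∈ Icc 0 T) : MemLp (f t) 2 volume := by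
  simpa using hf.memLp_iteratedDeriv ht 0

theorem exists_normSq_le (hf : SobolevSmooth T f) :
    ∃ M : ℝ, 0 ≤ M ∧ ∀ t ∈ Icc 0 T, normSq f t ≤ M := by
  obtain ⟨M, hM⟩ := hf.bound 0
  refine ⟨M ^ 2, by positivity, fun t ht => ?_⟩
  rw [normSq, integral_norm_sq_eq (hf.memLp ht)]
  have := hM t ht
  rw [iteratedDeriv_zero] at this
  have h2 := ENNReal.toReal_mono ENNReal.coe_ne_top this
  rw [ENNReal.coe_toReal] at h2
  gcongr

theorem dx (hT : 0 < T) (hf : SobolevSmooth T f) : SobolevSmooth T (dx f) where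
  smooth := contDiffOn_dx hT hf.smooth
  bound n := by
    obtain ⟨M, hM⟩ := hf.bound (n + 1)
    refine ⟨M, fun t ht => ?_⟩
    have := hM t ht
    rwa [iteratedDeriv_succ'] at this

theorem hasDerivAt (hf : SobolevSmooth T f) {t : ℝ} (ht : t ∈ Icc 0 T) (x : ℝ) :
    HasDerivAt (f t) (ZakharovRubenchik.dx f t x) x :=
  ((hf.contDiff ht).differentiable (by simp) x).hasDerivAt

theorem norm_sq_le (hT : 0 < T) (hf : SobolevSmooth T f) {t : ℝ} (ht : t ∈ Icc 0 T) (x : ℝ) :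
    ‖f t x‖ ^ 2 ≤ normSq f t + normSq (ZakharovRubenchik.dx f) t :=
  norm_sq_le_integral ((hf.contDiff ht).of_le (by exact_mod_cast le_top)) (hf.memLp ht)
    ((hf.dx hT).memLp ht) x

theorem exists_norm_le (hT : 0 < T) (hf : SobolevSmooth T f) :
    ∃ M : ℝ≥0, ∀ t ∈ Icc 0 T, ∀ x, ‖f t x‖ ≤ M := by
  obtain ⟨M, hM0, hM⟩ := hf.exists_normSq_le
  obtain ⟨M', hM0', hM'⟩ := (hf.dx hT).exists_normSq_le
  refine ⟨⟨√(M + M'), by positivity⟩, fun t ht x => ?_⟩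
  apply Real.le_sqrt_of_sq_le
  linarith [hf.norm_sq_le hT ht x, hM t ht, hM' t ht]

theorem congr (hf : SobolevSmooth T f) (h : ∀ t ∈ Icc 0 T, ∀ x, g t x = f t x) :
    SobolevSmooth T g where
  smooth := hf.smooth.congr fun p hp => h p.1 hp.1 p.2
  bound n := by
    obtain ⟨M, hM⟩ := hf.bound n
    refine ⟨M, fun t ht => ?_⟩
    rw [show g t = f t from funext (h t ht)]
    exact hM t ht

theorem add (hf : SobolevSmooth T f) (hg : SobolevSmooth T g) :
    SobolevSmooth T (fun t x => f t x + g t x) where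
  smooth := hf.smooth.add hg.smooth
  bound n := by
    obtain ⟨M, hM⟩ := hf.bound n
    obtain ⟨M', hM'⟩ := hg.bound n
    refine ⟨M + M', fun t ht => ?_⟩
    have h : iteratedDeriv n (fun x => f t x + g t x) =
        iteratedDeriv n (f t) + iteratedDeriv n (g t) := by
      ext x
      exact iteratedDeriv_fun_add ((hf.contDiff ht).of_le (by exact_mod_cast le_top)).contDiffAt
        ((hg.contDiff ht).of_le (by exact_mod_cast le_top)).contDiffAt
    rw [h]
    refine (eLpNorm_add_le (hf.memLp_iteratedDeriv ht n).1 (hg.memLp_iteratedDeriv ht n).1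
      (by norm_num)).trans ?_
    push_cast
    exact add_le_add (hM t ht) (hM' t ht)

theorem dx_mul (hf : SobolevSmooth T f) (hg : SobolevSmooth T g) {t : ℝ} (ht : t ∈ Icc 0 T) :
    ZakharovRubenchik.dx (fun t x => f t x * g t x) t = fun x =>
      ZakharovRubenchik.dx f t x * g t x + f t x * ZakharovRubenchik.dx g t x :=
  funext fun x => ((hf.hasDerivAt ht x).mul (hg.hasDerivAt ht x)).deriv

theorem mul (hT : 0 < T) (hf : SobolevSmooth T f) (hg : SobolevSmooth T g) :
    SobolevSmooth T (fun t x => f t x * g t x) where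
  smooth := hf.smooth.mul hg.smooth
  bound n := by
    -- Leibniz' rule, one derivative at a time
    induction n generalizing f g with
    | zero =>
      obtain ⟨M, hM⟩ := hf.exists_norm_le hT
      obtain ⟨M', hM'⟩ := hg.bound 0
      refine ⟨M * M', fun t ht => ?_⟩
      have h := eLpNorm_le_nnreal_smul_eLpNorm_of_ae_le_mul (p := 2) (μ := volume)
        (f := fun x => f t x * g t x) (g := g t) (c := M)
        (Eventually.of_forall fun x => by
          rw [nnnorm_mul]
          gcongr
          exact hM t ht x)
      rw [iteratedDeriv_zero]
      refine h.trans ?_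
      have h2 := hM' t ht
      rw [iteratedDeriv_zero] at h2
      push_cast
      exact mul_le_mul_right h2 _
    | succ n ih =>
      obtain ⟨M, hM⟩ := ih (hf.dx hT) hg
      obtain ⟨M', hM'⟩ := ih hf (hg.dx hT)
      refine ⟨M + M', fun t ht => ?_⟩
      have e : deriv (fun x => f t x * g t x) = fun x =>
          ZakharovRubenchik.dx f t x * g t x + f t x * ZakharovRubenchik.dx g t x :=
        dx_mul hf hg ht
      have c1 : ContDiff ℝ (⊤ : ℕ∞) (fun x => ZakharovRubenchik.dx f t x * g t x) :=
        ((hf.dx hT).contDiff ht).mul (hg.contDiff ht)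
      have c2 : ContDiff ℝ (⊤ : ℕ∞) (fun x => f t x * ZakharovRubenchik.dx g t x) :=
        (hf.contDiff ht).mul ((hg.dx hT).contDiff ht)
      have h : iteratedDeriv (n + 1) (fun x => f t x * g t x) =
          iteratedDeriv n (fun x => ZakharovRubenchik.dx f t x * g t x) +
          iteratedDeriv n (fun x => f t x * ZakharovRubenchik.dx g t x) := by
        rw [iteratedDeriv_succ', e]
        ext x
        exact iteratedDeriv_fun_add (c1.of_le (by exact_mod_cast le_top)).contDiffAt
          (c2.of_le (by exact_mod_cast le_top)).contDiffAt
      rw [h]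
      refine (eLpNorm_add_le
        (c1.continuous_iteratedDeriv n (by exact_mod_cast le_top)).aestronglyMeasurable
        (c2.continuous_iteratedDeriv n (by exact_mod_cast le_top)).aestronglyMeasurable
        (by norm_num)).trans ?_
      push_cast
      exact add_le_add (hM t ht) (hM' t ht)

theorem const_mul (c : ℂ) (hf : SobolevSmooth T f) : SobolevSmooth T (fun t x => c * f t x) where
  smooth := contDiffOn_const.mul hf.smooth
  bound n := by
    obtain ⟨M, hM⟩ := hf.bound n
    refine ⟨‖c‖₊ * M, fun t ht => ?_⟩
    have h : iteratedDeriv n (fun x => c * f t x) = c • iteratedDeriv n (f t) := by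
      ext x
      exact iteratedDeriv_const_smul_field c (f t)
    rw [h, eLpNorm_const_smul]
    push_cast
    gcongr
    · exact le_of_eq rfl
    · exact hM t ht

theorem conj (hf : SobolevSmooth T f) :
    SobolevSmooth T (fun t x => (starRingEnd ℂ) (f t x)) where
  smooth := Complex.conjCLE.contDiff.comp_contDiffOn hf.smooth
  bound n := by
    obtain ⟨M, hM⟩ := hf.bound n
    refine ⟨M, fun t ht => ?_⟩
    have h : ∀ x, ‖iteratedDeriv n (fun x => (starRingEnd ℂ) (f t x)) x‖ =
        ‖iteratedDeriv n (f t) x‖ := by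
      intro x
      have := Complex.conjLIE.norm_iteratedFDeriv_comp_left (f t) x n
      rw [norm_iteratedFDeriv_eq_norm_iteratedDeriv,
        norm_iteratedFDeriv_eq_norm_iteratedDeriv] at this
      exact this
    rw [eLpNorm_congr_norm_ae (Eventually.of_forall h)]
    exact hM t ht

theorem dx_conj {t : ℝ} (f : ℝ → ℝ → ℂ) (x : ℝ) :
    ZakharovRubenchik.dx (fun t x => (starRingEnd ℂ) (f t x)) t x =
      (starRingEnd ℂ) (ZakharovRubenchik.dx f t x) := by
  simp only [ZakharovRubenchik.dx]
  exact deriv.star ..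

theorem sub (hf : SobolevSmooth T f) (hg : SobolevSmooth T g) :
    SobolevSmooth T (fun t x => f t x - g t x) :=
  (hf.add (hg.const_mul (-1))).congr fun t _ x => by ring

theorem integrable_mul (hf : SobolevSmooth T f) (hg : SobolevSmooth T g) {t : ℝ}
    (ht : t ∈ Icc 0 T) : Integrable (fun x => f t x * g t x) :=
  integrable_mul_of_memLp (hf.memLp ht) (hg.memLp ht)

theorem norm_pairing_le (hf : SobolevSmooth T f) (hg : SobolevSmooth T g) {t : ℝ}
    (ht : t ∈ Icc 0 T) : ‖pairing f g t‖ ≤ √(normSq f t) * √(normSq g t) :=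
  norm_integral_mul_le (hf.memLp ht) (hg.memLp ht)

/-- Integration by parts. -/
theorem pairing_dx (hT : 0 < T) (hf : SobolevSmooth T f) (hg : SobolevSmooth T g) {t : ℝ}
    (ht : t ∈ Icc 0 T) :
    pairing (ZakharovRubenchik.dx f) g t = - pairing f (ZakharovRubenchik.dx g) t := by
  have h := integral_mul_deriv_eq_deriv_mul_of_integrable (u := f t) (v := g t)
    (fun x _ => hf.hasDerivAt ht x) (fun x _ => hg.hasDerivAt ht x)
    (hf.integrable_mul (hg.dx hT) ht) ((hf.dx hT).integrable_mul hg ht) (hf.integrable_mul hg ht)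
  rw [pairing, pairing, h, neg_neg]

end SobolevSmooth

/-! ### Differentiating pairings in time -/

namespace HasTimeDeriv

variable {T : ℝ} {f f' g g' : ℝ → ℝ → ℂ}

theorem mul (hf : HasTimeDeriv T f f') (hg : HasTimeDeriv T g g') :
    HasTimeDeriv T (fun t x => f t x * g t x) (fun t x => f' t x * g t x + f t x * g' t x) :=
  fun t ht x => (hf t ht x).mul (hg t ht x)

theorem sub (hf : HasTimeDeriv T f f') (hg : HasTimeDeriv T g g') :
    HasTimeDeriv T (fun t x => f t x - g t x) (fun t x => f' t x - g' t x) :=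
  fun t ht x => (hf t ht x).sub (hg t ht x)

theorem add (hf : HasTimeDeriv T f f') (hg : HasTimeDeriv T g g') :
    HasTimeDeriv T (fun t x => f t x + g t x) (fun t x => f' t x + g' t x) :=
  fun t ht x => (hf t ht x).add (hg t ht x)

theorem const_mul (c : ℂ) (hf : HasTimeDeriv T f f') :
    HasTimeDeriv T (fun t x => c * f t x) (fun t x => c * f' t x) :=
  fun t ht x => (hf t ht x).const_mul c

theorem conj (hf : HasTimeDeriv T f f') :
    HasTimeDeriv T (fun t x => (starRingEnd ℂ) (f t x)) (fun t x => (starRingEnd ℂ) (f' t x)) :=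
  fun t ht x => (hf t ht x).star

theorem congr {h : ℝ → ℝ → ℂ} (hf : HasTimeDeriv T f f')
    (hh : ∀ t ∈ Icc 0 T, ∀ x, h t x = f' t x) : HasTimeDeriv T f h :=
  fun t ht x => by rw [hh t (Ioo_subset_Icc_self ht)]; exact hf t ht x

theorem _root_.HasFDerivAt.hasDerivAt_comp_apply {G : ℝ × ℝ → (ℝ × ℝ →L[ℝ] ℂ)}
    {G' : ℝ × ℝ →L[ℝ] (ℝ × ℝ →L[ℝ] ℂ)} {p : ℝ → ℝ × ℝ} {w : ℝ × ℝ} {t : ℝ}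
    (hG : HasFDerivAt G G' (p t)) (hp : HasDerivAt p w t) (v : ℝ × ℝ) :
    HasDerivAt (fun s => G (p s) v) (G' w v) t :=
  (ContinuousLinearMap.apply ℝ ℂ v).hasFDerivAt.comp_hasDerivAt t (hG.comp_hasDerivAt t hp)

/-- Mixed partial derivatives commute. -/
theorem dx (hf : HasTimeDeriv T f f') (hs : SobolevSmooth T f) :
    HasTimeDeriv T (dx f) (dx f') := by
  intro t ht x
  set F : ℝ × ℝ → ℂ := fun p => f p.1 p.2 with hF
  have hat : ∀ τ ∈ Ioo 0 T, ∀ y, ContDiffAt ℝ (⊤ : ℕ∞) F (τ, y) := fun τ hτ y =>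
    hs.smooth.contDiffAt (prod_mem_nhds (Icc_mem_nhds hτ.1 hτ.2) univ_mem)
  have hfd : ∀ τ ∈ Ioo 0 T, ∀ y, HasFDerivAt F (fderiv ℝ F (τ, y)) (τ, y) := fun τ hτ y =>
    ((hat τ hτ y).differentiableAt (by simp)).hasFDerivAt
  have hx : ∀ τ ∈ Ioo 0 T, ∀ y, ZakharovRubenchik.dx f τ y = fderiv ℝ F (τ, y) (0, 1) := by
    intro τ hτ y
    have h2 : HasDerivAt (fun y : ℝ => (τ, y)) ((0 : ℝ), (1 : ℝ)) y :=
      (hasDerivAt_const y τ).prodMk (hasDerivAt_id y)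
    exact ((hfd τ hτ y).comp_hasDerivAt y h2).deriv
  have ht' : ∀ y, f' t y = fderiv ℝ F (t, y) (1, 0) := by
    intro y
    have h2 : HasDerivAt (fun τ : ℝ => (τ, y)) ((1 : ℝ), (0 : ℝ)) t :=
      (hasDerivAt_id t).prodMk (hasDerivAt_const t y)
    have h3 : HasDerivAt (fun τ => f τ y) (fderiv ℝ F (t, y) (1, 0)) t :=
      HasFDerivAt.comp_hasDerivAt (l := F) (f := fun τ : ℝ => (τ, y)) t (hfd t ht y) h2
    exact (hf t ht y).unique h3
  have hdd : HasFDerivAt (fderiv ℝ F) (fderiv ℝ (fderiv ℝ F) (t, x)) (t, x) :=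
    (((hat t ht x).fderiv_right (m := (⊤ : ℕ∞)) (by simp)).differentiableAt
      (by simp)).hasFDerivAt
  have h1 : HasDerivAt (fun τ : ℝ => fderiv ℝ F (τ, x) (0, 1))
      (fderiv ℝ (fderiv ℝ F) (t, x) (1, 0) (0, 1)) t := by
    have h2 : HasDerivAt (fun τ : ℝ => (τ, x)) ((1 : ℝ), (0 : ℝ)) t :=
      (hasDerivAt_id t).prodMk (hasDerivAt_const t x)
    exact HasFDerivAt.hasDerivAt_comp_apply (p := fun τ : ℝ => (τ, x)) hdd h2 _
  have h3 : HasDerivAt (f' t) (fderiv ℝ (fderiv ℝ F) (t, x) (0, 1) (1, 0)) x := by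
    have h2 : HasDerivAt (fun y : ℝ => (t, y)) ((0 : ℝ), (1 : ℝ)) x :=
      (hasDerivAt_const x t).prodMk (hasDerivAt_id x)
    rw [show f' t = fun y => fderiv ℝ F (t, y) (1, 0) from funext ht']
    exact HasFDerivAt.hasDerivAt_comp_apply (p := fun y : ℝ => (t, y)) hdd h2 _
  have hsymm : fderiv ℝ (fderiv ℝ F) (t, x) (1, 0) (0, 1) =
      fderiv ℝ (fderiv ℝ F) (t, x) (0, 1) (1, 0) :=
    (hat t ht x).isSymmSndFDerivAt (by
      rw [minSmoothness_of_isRCLikeNormedField]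
      exact WithTop.coe_le_coe.2 (le_top (a := (2 : ℕ∞)))) _ _
  have h4 : ZakharovRubenchik.dx f' t x = fderiv ℝ (fderiv ℝ F) (t, x) (1, 0) (0, 1) := by
    rw [hsymm]
    exact h3.deriv
  rw [h4]
  refine h1.congr_of_eventuallyEq ?_
  filter_upwards [Ioo_mem_nhds ht.1 ht.2] with τ hτ
  exact hx τ hτ x

end HasTimeDeriv

namespace SobolevSmooth

variable {T : ℝ} {f f' g g' : ℝ → ℝ → ℂ}

theorem integral_norm_mul_le (hf : SobolevSmooth T f) (hg : SobolevSmooth T g) :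
    ∃ M : ℝ, ∀ t ∈ Icc 0 T, ∫ x, ‖f t x * g t x‖ ≤ M := by
  obtain ⟨M, hM0, hM⟩ := hf.exists_normSq_le
  obtain ⟨M', hM0', hM'⟩ := hg.exists_normSq_le
  refine ⟨√M * √M', fun t ht => ?_⟩
  refine (ZakharovRubenchik.integral_norm_mul_le (hf.memLp ht) (hg.memLp ht)).trans ?_
  gcongr
  · exact hM t ht
  · exact hM' t ht

theorem integrable_prod_mul (hf : SobolevSmooth T f) (hg : SobolevSmooth T g) {t : ℝ}
    (ht : t ∈ Icc 0 T) :
    Integrable (Function.uncurry fun τ x => f τ x * g τ x)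
      ((volume.restrict (Ioc 0 t)).prod volume) := by
  have hsub : Ioc 0 t ⊆ Icc 0 T := fun τ hτ => ⟨hτ.1.le, hτ.2.trans ht.2⟩
  have hmeas : AEStronglyMeasurable (Function.uncurry fun τ x => f τ x * g τ x)
      ((volume.restrict (Ioc 0 t)).prod volume) := by
    have h : ((volume.restrict (Ioc 0 t)).prod (volume : Measure ℝ)) =
        (volume.prod volume).restrict (Ioc 0 t ×ˢ univ) := by
      rw [← Measure.prod_restrict, Measure.restrict_univ]
    rw [h]
    have hc : ContinuousOn (fun p : ℝ × ℝ => f p.1 p.2 * g p.1 p.2) (Icc 0 T ×ˢ univ) :=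
      hf.smooth.continuousOn.mul hg.smooth.continuousOn
    exact (hc.mono (prod_mono_left hsub)).aestronglyMeasurable
      (measurableSet_Ioc.prod MeasurableSet.univ)
  obtain ⟨M, hM⟩ := hf.integral_norm_mul_le hg
  rw [integrable_prod_iff hmeas]
  constructor
  · filter_upwards [ae_restrict_mem measurableSet_Ioc] with τ hτ
    exact hf.integrable_mul hg (hsub hτ)
  · refine Integrable.of_bound (C := M) hmeas.norm.integral_prod_right' ?_
    filter_upwards [ae_restrict_mem measurableSet_Ioc] with τ hτ
    rw [Real.norm_of_nonneg (integral_nonneg fun _ => norm_nonneg _)]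
    exact hM τ (hsub hτ)

theorem intervalIntegrable_pairing (hf : SobolevSmooth T f) (hg : SobolevSmooth T g) {t : ℝ}
    (ht : t ∈ Icc 0 T) : IntervalIntegrable (pairing f g) volume 0 t := by
  rw [intervalIntegrable_iff_integrableOn_Ioc_of_le ht.1]
  exact (hf.integrable_prod_mul hg ht).integral_prod_left

/-- The fundamental theorem of calculus in time for the `L²` pairing. -/
theorem pairing_sub_pairing_zero (hf : SobolevSmooth T f) (hf' : SobolevSmooth T f')
    (hg : SobolevSmooth T g) (hg' : SobolevSmooth T g') (hff' : HasTimeDeriv T f f')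
    (hgg' : HasTimeDeriv T g g') {t : ℝ} (ht : t ∈ Icc 0 T) :
    pairing f g t - pairing f g 0 = ∫ τ in 0..t, (pairing f' g τ + pairing f g' τ) := by
  have h0 : (0 : ℝ) ∈ Icc 0 T := ⟨le_rfl, ht.1.trans ht.2⟩
  have hsub : Icc 0 t ⊆ Icc 0 T := Icc_subset_Icc le_rfl ht.2
  have hint := (hf'.integrable_prod_mul hg ht).add (hf.integrable_prod_mul hg' ht)
  have hcont : ∀ {h : ℝ → ℝ → ℂ}, SobolevSmooth T h → ∀ x,
      ContinuousOn (fun τ => h τ x) (Icc 0 t) := fun hh x =>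
    hh.smooth.continuousOn.comp (f := fun τ : ℝ => (τ, x)) (by fun_prop)
      fun τ hτ => ⟨hsub hτ, mem_univ x⟩
  have hftc : ∀ x, ∫ τ in 0..t, (f' τ x * g τ x + f τ x * g' τ x) =
      f t x * g t x - f 0 x * g 0 x := by
    intro x
    refine intervalIntegral.integral_eq_sub_of_hasDerivAt_of_le ht.1
      (f := fun τ => f τ x * g τ x) ((hcont hf x).mul (hcont hg x)) ?_ ?_
    · intro τ hτ
      exact (hff'.mul hgg') τ ⟨hτ.1, hτ.2.trans_le ht.2⟩ x
    · apply ContinuousOn.intervalIntegrable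
      rw [uIcc_of_le ht.1]
      exact ((hcont hf' x).mul (hcont hg x)).add ((hcont hf x).mul (hcont hg' x))
  calc pairing f g t - pairing f g 0 = ∫ x, (f t x * g t x - f 0 x * g 0 x) :=
        (integral_sub (hf.integrable_mul hg ht) (hf.integrable_mul hg h0)).symm
    _ = ∫ x, ∫ τ in Ioc 0 t, (f' τ x * g τ x + f τ x * g' τ x) := by
        congr 1
        ext x
        rw [← hftc x, intervalIntegral.integral_of_le ht.1]
    _ = ∫ τ in Ioc 0 t, ∫ x, (f' τ x * g τ x + f τ x * g' τ x) :=
        (integral_integral_swap hint).symm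
    _ = ∫ τ in Ioc 0 t, (pairing f' g τ + pairing f g' τ) := by
        apply setIntegral_congr_fun measurableSet_Ioc
        intro τ hτ
        have hτ' : τ ∈ Icc 0 T := hsub ⟨hτ.1.le, hτ.2⟩
        exact integral_add (hf'.integrable_mul hg hτ') (hf.integrable_mul hg' hτ')
    _ = _ := by rw [intervalIntegral.integral_of_le ht.1]

end SobolevSmooth

/-! ### Bilinearity of the pairing and energy identities -/

/-- Pointwise complex conjugation. -/
abbrev conjFn (f : ℝ → ℝ → ℂ) : ℝ → ℝ → ℂ := fun t x => (starRingEnd ℂ) (f t x)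

theorem pairing_comm (f g : ℝ → ℝ → ℂ) (t : ℝ) : pairing f g t = pairing g f t := by
  simp only [pairing, mul_comm]

theorem conj_pairing (f g : ℝ → ℝ → ℂ) (t : ℝ) :
    (starRingEnd ℂ) (pairing f g t) = pairing (conjFn f) (conjFn g) t := by
  simp only [pairing, ← integral_conj, map_mul]

theorem conjFn_conjFn (f : ℝ → ℝ → ℂ) : conjFn (conjFn f) = f := by
  ext t x
  exact Complex.conj_conj _

theorem pairing_conj_self (f : ℝ → ℝ → ℂ) (t : ℝ) :
    pairing f (conjFn f) t = (normSq f t : ℂ) := by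
  rw [normSq, ← integral_complex_ofReal]
  simp only [pairing, Complex.mul_conj, Complex.normSq_eq_norm_sq]

theorem normSq_conjFn (f : ℝ → ℝ → ℂ) (t : ℝ) : normSq (conjFn f) t = normSq f t := by
  simp only [normSq, RCLike.norm_conj]

theorem normSq_const_mul (c : ℂ) (f : ℝ → ℝ → ℂ) (t : ℝ) :
    normSq (fun t x => c * f t x) t = ‖c‖ ^ 2 * normSq f t := by
  simp only [normSq, norm_mul, mul_pow, integral_const_mul]

theorem pairing_congr {f₁ f₂ g₁ g₂ : ℝ → ℝ → ℂ} {t : ℝ} (hf : ∀ x, f₁ t x = f₂ t x)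
    (hg : ∀ x, g₁ t x = g₂ t x) : pairing f₁ g₁ t = pairing f₂ g₂ t := by
  simp only [pairing, hf, hg]

theorem normSq_congr {f g : ℝ → ℝ → ℂ} {t : ℝ} (h : ∀ x, f t x = g t x) :
    normSq f t = normSq g t := by
  simp only [normSq, h]

theorem dx_conjFn (f : ℝ → ℝ → ℂ) : dx (conjFn f) = conjFn (dx f) := by
  ext t x
  exact SobolevSmooth.dx_conj f x

theorem pairing_const_mul_left (c : ℂ) (f g : ℝ → ℝ → ℂ) (t : ℝ) :
    pairing (fun t x => c * f t x) g t = c * pairing f g t := by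
  simp only [pairing, mul_assoc, integral_const_mul]

namespace SobolevSmooth

variable {T : ℝ} {f f' g h : ℝ → ℝ → ℂ} {t : ℝ}

theorem pairing_add_left (hf : SobolevSmooth T f) (hg : SobolevSmooth T g)
    (hh : SobolevSmooth T h) (ht : t ∈ Icc 0 T) :
    pairing (fun t x => f t x + g t x) h t = pairing f h t + pairing g h t := by
  simp only [pairing, add_mul]
  exact integral_add (hf.integrable_mul hh ht) (hg.integrable_mul hh ht)

/-- The transport operator is skew-adjoint. -/
theorem re_pairing_dx_conj (hT : 0 < T) (hf : SobolevSmooth T f) (ht : t ∈ Icc 0 T) :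
    (pairing (ZakharovRubenchik.dx f) (conjFn f) t).re = 0 := by
  have h1 := hf.pairing_dx hT hf.conj ht
  rw [show ZakharovRubenchik.dx (fun t x => (starRingEnd ℂ) (f t x)) =
    conjFn (ZakharovRubenchik.dx f) from dx_conjFn f] at h1
  have h2 := conj_pairing (ZakharovRubenchik.dx f) (conjFn f) t
  rw [conjFn_conjFn] at h2
  rw [pairing_comm f, ← h2] at h1
  have h3 := congrArg Complex.re h1
  rw [Complex.neg_re, Complex.conj_re] at h3
  linarith

/-- The Laplacian is self-adjoint. -/
theorem im_pairing_dx_dx_conj (hT : 0 < T) (hf : SobolevSmooth T f) (ht : t ∈ Icc 0 T) :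
    (pairing (ZakharovRubenchik.dx (ZakharovRubenchik.dx f)) (conjFn f) t).im = 0 := by
  have h1 := (hf.dx hT).pairing_dx hT hf.conj ht
  rw [show ZakharovRubenchik.dx (fun t x => (starRingEnd ℂ) (f t x)) =
    conjFn (ZakharovRubenchik.dx f) from dx_conjFn f, pairing_conj_self] at h1
  rw [h1, ← Complex.ofReal_neg, Complex.ofReal_im]

/-- The energy identity `d/dt ‖f‖² = 2 Re ∫ f' conj f`. -/
theorem normSq_eq (hf : SobolevSmooth T f) (hf' : SobolevSmooth T f')
    (hff' : HasTimeDeriv T f f') (ht : t ∈ Icc 0 T) :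
    normSq f t = normSq f 0 + ∫ τ in 0..t, 2 * (pairing f' (conjFn f) τ).re := by
  have h1 := hf.pairing_sub_pairing_zero hf' hf.conj hf'.conj hff' hff'.conj ht
  rw [show (fun t x => (starRingEnd ℂ) (f t x)) = conjFn f from rfl, pairing_conj_self,
    pairing_conj_self] at h1
  have h2 : ∀ τ, pairing f' (conjFn f) τ + pairing f (conjFn f') τ =
      ((2 * (pairing f' (conjFn f) τ).re : ℝ) : ℂ) := by
    intro τ
    have h3 := conj_pairing f' (conjFn f) τ
    rw [conjFn_conjFn] at h3
    rw [pairing_comm f, ← h3, Complex.add_conj]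
  simp only [show (fun t x => (starRingEnd ℂ) (f' t x)) = conjFn f' from rfl, h2] at h1
  rw [intervalIntegral.integral_ofReal] at h1
  have h4 : normSq f t - normSq f 0 = ∫ τ in 0..t, 2 * (pairing f' (conjFn f) τ).re := by
    exact_mod_cast h1
  linarith

theorem continuousOn_normSq (hT : 0 < T) (hf : SobolevSmooth T f) (hf' : SobolevSmooth T f')
    (hff' : HasTimeDeriv T f f') : ContinuousOn (normSq f) (Icc 0 T) := by
  have hi : IntervalIntegrable (fun τ => 2 * (pairing f' (conjFn f) τ).re) volume 0 T := by
    have h1 := hf'.intervalIntegrable_pairing hf.conj (t := T) ⟨hT.le, le_rfl⟩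
    rw [intervalIntegrable_iff] at h1 ⊢
    exact h1.re.const_mul 2
  have h := intervalIntegral.continuousOn_primitive_interval' hi left_mem_uIcc
  rw [uIcc_of_le hT.le] at h
  exact (continuousOn_const.add h).congr fun t ht => hf.normSq_eq hf' hff' ht

theorem re_pairing_le_of_transport (hT : 0 < T) (hf : SobolevSmooth T f)
    (hg : SobolevSmooth T g) (v : ℝ)
    (h : ∀ t ∈ Icc 0 T, ∀ x, f' t x = -v * ZakharovRubenchik.dx f t x + g t x)
    (ht : t ∈ Icc 0 T) :
    |(pairing f' (conjFn f) t).re| ≤ √(normSq g t) * √(normSq f t) := by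
  have e : pairing f' (conjFn f) t =
      ((-v : ℝ) : ℂ) * pairing (ZakharovRubenchik.dx f) (conjFn f) t + pairing g (conjFn f) t := by
    rw [← pairing_const_mul_left,
      ← ((hf.dx hT).const_mul _).pairing_add_left hg hf.conj ht]
    exact pairing_congr (fun x => by rw [h t ht]; push_cast; rfl) fun _ => rfl
  rw [e, Complex.add_re, Complex.re_ofReal_mul, hf.re_pairing_dx_conj hT ht, mul_zero, zero_add,
    ← normSq_conjFn f]
  exact (Complex.abs_re_le_norm _).trans (hg.norm_pairing_le hf.conj ht)

theorem re_pairing_le_of_schroedinger (hT : 0 < T) (hf : SobolevSmooth T f)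
    (hg : SobolevSmooth T g) (ω : ℝ)
    (h : ∀ t ∈ Icc 0 T, ∀ x, f' t x = Complex.I * (ω *
      ZakharovRubenchik.dx (ZakharovRubenchik.dx f) t x) + g t x)
    (ht : t ∈ Icc 0 T) :
    |(pairing f' (conjFn f) t).re| ≤ √(normSq g t) * √(normSq f t) := by
  have e : pairing f' (conjFn f) t =
      (Complex.I * ω) * pairing (ZakharovRubenchik.dx (ZakharovRubenchik.dx f)) (conjFn f) t +
        pairing g (conjFn f) t := by
    rw [← pairing_const_mul_left,
      ← (((hf.dx hT).dx hT).const_mul _).pairing_add_left hg hf.conj ht]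
    exact pairing_congr (fun x => by rw [h t ht]; ring) fun _ => rfl
  have e2 : ((Complex.I * ω) *
      pairing (ZakharovRubenchik.dx (ZakharovRubenchik.dx f)) (conjFn f) t).re = 0 := by
    have := hf.im_pairing_dx_dx_conj hT ht
    rw [mul_assoc, Complex.I_mul_re, Complex.im_ofReal_mul, this]
    simp
  rw [e, Complex.add_re, e2, zero_add, ← normSq_conjFn f]
  exact (Complex.abs_re_le_norm _).trans (hg.norm_pairing_le hf.conj ht)

/-- If `f` vanishes at time zero and is driven by a forcing of size `a` in `L²`, then
`‖f‖ ≤ 2 a T` in `L²`. -/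
theorem normSq_le_of_forcing (hT : 0 < T) (hf : SobolevSmooth T f) (hf' : SobolevSmooth T f')
    (hff' : HasTimeDeriv T f f') (h0 : normSq f 0 = 0) {a : ℝ} (ha : 0 ≤ a)
    (h : ∀ τ ∈ Icc 0 T, |(pairing f' (conjFn f) τ).re| ≤ a * √(normSq f τ))
    (ht : t ∈ Icc 0 T) : normSq f t ≤ (2 * a * T) ^ 2 := by
  obtain ⟨s, hs, hmax⟩ := isCompact_Icc.exists_isMaxOn (nonempty_Icc.2 hT.le)
    (hf.continuousOn_normSq hT hf' hff')
  have hbd : normSq f s ≤ (2 * a * √(normSq f s)) * T := by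
    have h1 := hf.normSq_eq hf' hff' hs
    have h2 : ‖∫ τ in 0..s, 2 * (pairing f' (conjFn f) τ).re‖ ≤
        (2 * a * √(normSq f s)) * |s - 0| := by
      apply intervalIntegral.norm_integral_le_of_norm_le_const
      intro τ hτ
      rw [uIoc_of_le hs.1] at hτ
      have hτ' : τ ∈ Icc 0 T := ⟨hτ.1.le, hτ.2.trans hs.2⟩
      rw [norm_mul, Real.norm_eq_abs, Real.norm_eq_abs, abs_two]
      have h3 : √(normSq f τ) ≤ √(normSq f s) := Real.sqrt_le_sqrt (hmax hτ')
      have h4 := h τ hτ'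
      have h5 : a * √(normSq f τ) ≤ a * √(normSq f s) := by gcongr
      linarith
    rw [h0, zero_add] at h1
    calc normSq f s = ∫ τ in 0..s, 2 * (pairing f' (conjFn f) τ).re := h1
      _ ≤ (2 * a * √(normSq f s)) * |s - 0| := (le_abs_self _).trans h2
      _ ≤ _ := by
        rw [sub_zero, abs_of_nonneg hs.1]
        gcongr
        exact hs.2
  have h6 : √(normSq f s) ≤ 2 * a * T := by
    have h7 := Real.mul_self_sqrt (normSq_nonneg f s)
    by_contra hcon
    push Not at hcon
    have h8 : 0 ≤ 2 * a * T := by positivity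
    nlinarith
  calc normSq f t ≤ normSq f s := hmax ht
    _ = √(normSq f s) ^ 2 := (Real.sq_sqrt (normSq_nonneg f s)).symm
    _ ≤ _ := by gcongr

end SobolevSmooth

/-- Continuous induction: a continuous function cannot cross a barrier that it fails to reach as
long as it stays below it. -/
theorem le_of_bootstrap {T A : ℝ} {z : ℝ → ℝ} (hz : ContinuousOn z (Icc 0 T)) (h0 : z 0 < A)
    (h : ∀ t ∈ Icc 0 T, (∀ s ∈ Icc 0 t, z s ≤ A) → z t < A) {t : ℝ} (ht : t ∈ Icc 0 T) :
    z t ≤ A := by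
  by_contra! hcon
  have hcross : ∀ s ∈ Icc 0 T, A < z s → ∃ r ∈ Icc 0 s, z r = A := fun s hs hA =>
    intermediate_value_Icc hs.1 (hz.mono (Icc_subset_Icc le_rfl hs.2)) ⟨h0.le, hA.le⟩
  have hcomp : IsCompact {s ∈ Icc 0 T | z s = A} := by
    apply isCompact_Icc.of_isClosed_subset _ (fun s hs => hs.1)
    exact hz.preimage_isClosed_of_isClosed isClosed_Icc (isClosed_singleton (x := A))
  obtain ⟨r, hr, hrA⟩ := hcross t ht hcon
  obtain ⟨s, hs, hmin⟩ := hcomp.exists_isLeast ⟨r, ⟨hr.1, hr.2.trans ht.2⟩, hrA⟩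
  have := h s hs.1 fun q hq => by
    by_contra! hq'
    obtain ⟨p, hp, hpA⟩ := hcross q ⟨hq.1, hq.2.trans hs.1.2⟩ hq'
    have hps : s ≤ p := hmin ⟨⟨hp.1, hp.2.trans (hq.2.trans hs.1.2)⟩, hpA⟩
    have : q = s := le_antisymm hq.2 (hps.trans hp.2)
    rw [this, hs.2] at hq'
    exact lt_irrefl _ hq'
  exact this.ne hs.2

/-! ### The system and its conservation laws -/

/-- Coefficients of the system
`i B_t + ω B_xx = (r₁ μ₁ ψ₁ + r₂ μ₂ ψ₂ + λ |B|²) B`, `∂_t ψ_j + v_j ∂_x ψ_j = μ_j ∂_x |B|²`.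
The coupling constant of `ψ_j` in the first equation is a multiple `r_j μ_j` of the one of `|B|²`
in the equation for `ψ_j`; this is what makes the system Hamiltonian. -/
structure Coeffs where
  ω : ℝ
  lam : ℝ
  r₁ : ℝ
  v₁ : ℝ
  μ₁ : ℝ
  r₂ : ℝ
  v₂ : ℝ
  μ₂ : ℝ

/-- The density `|B|²`, as a complex-valued function. -/
def density (B : ℝ → ℝ → ℂ) : ℝ → ℝ → ℂ := fun t x => B t x * (starRingEnd ℂ) (B t x)

/-- The potential `r₁ μ₁ ψ₁ + r₂ μ₂ ψ₂`. -/
def potential (c : Coeffs) (ψ₁ ψ₂ : ℝ → ℝ → ℂ) : ℝ → ℝ → ℂ := fun t x =>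
  ((c.r₁ * c.μ₁ : ℝ) : ℂ) * ψ₁ t x + ((c.r₂ * c.μ₂ : ℝ) : ℂ) * ψ₂ t x

/-- The full potential `r₁ μ₁ ψ₁ + r₂ μ₂ ψ₂ + λ |B|²`. -/
def fullPotential (c : Coeffs) (B ψ₁ ψ₂ : ℝ → ℝ → ℂ) : ℝ → ℝ → ℂ := fun t x =>
  potential c ψ₁ ψ₂ t x + (c.lam : ℂ) * density B t x

/-- The nonlinearity of the Schrödinger equation. -/
def nonlinearity (c : Coeffs) (B ψ₁ ψ₂ : ℝ → ℝ → ℂ) : ℝ → ℝ → ℂ := fun t x =>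
  fullPotential c B ψ₁ ψ₂ t x * B t x

/-- The value of `B_t` prescribed by the Schrödinger equation. -/
def schroedingerRHS (c : Coeffs) (B ψ₁ ψ₂ : ℝ → ℝ → ℂ) : ℝ → ℝ → ℂ := fun t x =>
  Complex.I * (c.ω * dx (dx B) t x) + (-Complex.I) * nonlinearity c B ψ₁ ψ₂ t x

/-- The value of `ψ_t` prescribed by the transport equation. -/
def transportRHS (v μ : ℝ) (B ψ : ℝ → ℝ → ℂ) : ℝ → ℝ → ℂ := fun t x =>
  -(v : ℂ) * dx ψ t x + (μ : ℂ) * dx (density B) t x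

/-- Smooth solutions on `[0, T] × ℝ`, with the real functions `ψ_j` regarded as complex-valued. -/
structure IsSolution (c : Coeffs) (T : ℝ) (B ψ₁ ψ₂ : ℝ → ℝ → ℂ) : Prop where
  smooth_B : SobolevSmooth T B
  smooth₁ : SobolevSmooth T ψ₁
  smooth₂ : SobolevSmooth T ψ₂
  real₁ : ∀ t ∈ Icc 0 T, ∀ x, (starRingEnd ℂ) (ψ₁ t x) = ψ₁ t x
  real₂ : ∀ t ∈ Icc 0 T, ∀ x, (starRingEnd ℂ) (ψ₂ t x) = ψ₂ t x
  eq_B : HasTimeDeriv T B (schroedingerRHS c B ψ₁ ψ₂)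
  eq₁ : HasTimeDeriv T ψ₁ (transportRHS c.v₁ c.μ₁ B ψ₁)
  eq₂ : HasTimeDeriv T ψ₂ (transportRHS c.v₂ c.μ₂ B ψ₂)

theorem norm_density (B : ℝ → ℝ → ℂ) (t x : ℝ) : ‖density B t x‖ = ‖B t x‖ ^ 2 := by
  rw [density, norm_mul, RCLike.norm_conj, sq]

theorem conj_density (B : ℝ → ℝ → ℂ) (t x : ℝ) :
    (starRingEnd ℂ) (density B t x) = density B t x := by
  rw [density, map_mul, Complex.conj_conj, mul_comm]

theorem SobolevSmooth.density {T : ℝ} (hT : 0 < T) {B : ℝ → ℝ → ℂ} (hB : SobolevSmooth T B) :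
    SobolevSmooth T (density B) := hB.mul hT hB.conj

theorem SobolevSmooth.transportRHS {T : ℝ} (hT : 0 < T) (v μ : ℝ) {B ψ : ℝ → ℝ → ℂ}
    (hB : SobolevSmooth T B) (hψ : SobolevSmooth T ψ) :
    SobolevSmooth T (transportRHS v μ B ψ) :=
  ((hψ.dx hT).const_mul _).add (((hB.density hT).dx hT).const_mul _)

theorem SobolevSmooth.normSq_density_le {T : ℝ} (hT : 0 < T) {B : ℝ → ℝ → ℂ}
    (hB : SobolevSmooth T B) {t : ℝ} (ht : t ∈ Icc 0 T) :
    normSq (ZakharovRubenchik.density B) t ≤ (normSq B t + normSq (ZakharovRubenchik.dx B) t) *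
      normSq B t := by
  refine le_of_le_of_eq (integral_mono (integrable_norm_sq ((hB.density hT).memLp ht))
    ((integrable_norm_sq (hB.memLp ht)).const_mul
      (normSq B t + normSq (ZakharovRubenchik.dx B) t)) ?_) (integral_const_mul _ _)
  intro x
  simp only [norm_density]
  rw [sq (‖B t x‖ ^ 2)]
  gcongr
  exact hB.norm_sq_le hT ht x

theorem SobolevSmooth.normSq_dx_density_le {T : ℝ} (hT : 0 < T) {B : ℝ → ℝ → ℂ}
    (hB : SobolevSmooth T B) {t : ℝ} (ht : t ∈ Icc 0 T) :
    normSq (ZakharovRubenchik.dx (ZakharovRubenchik.density B)) t ≤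
      4 * (normSq B t + normSq (ZakharovRubenchik.dx B) t) *
        normSq (ZakharovRubenchik.dx B) t := by
  refine le_of_le_of_eq (integral_mono (integrable_norm_sq (((hB.density hT).dx hT).memLp ht))
    ((integrable_norm_sq ((hB.dx hT).memLp ht)).const_mul
      (4 * (normSq B t + normSq (ZakharovRubenchik.dx B) t))) ?_) (integral_const_mul _ _)
  intro x
  have e : ZakharovRubenchik.dx (ZakharovRubenchik.density B) t x =
      ZakharovRubenchik.dx B t x * (starRingEnd ℂ) (B t x) +
        B t x * (starRingEnd ℂ) (ZakharovRubenchik.dx B t x) := by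
    have := congrFun (hB.dx_mul hB.conj ht) x
    rw [SobolevSmooth.dx_conj] at this
    exact this
  have h1 : ‖ZakharovRubenchik.dx (ZakharovRubenchik.density B) t x‖ ≤
      2 * (‖B t x‖ * ‖ZakharovRubenchik.dx B t x‖) := by
    rw [e]
    refine (norm_add_le _ _).trans (le_of_eq ?_)
    simp only [norm_mul, RCLike.norm_conj]
    ring
  calc ‖ZakharovRubenchik.dx (ZakharovRubenchik.density B) t x‖ ^ 2
      ≤ (2 * (‖B t x‖ * ‖ZakharovRubenchik.dx B t x‖)) ^ 2 := by gcongr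
    _ = 4 * ‖B t x‖ ^ 2 * ‖ZakharovRubenchik.dx B t x‖ ^ 2 := by ring
    _ ≤ _ := mul_le_mul_of_nonneg_right
        (mul_le_mul_of_nonneg_left (hB.norm_sq_le hT ht x) (by norm_num)) (by positivity)

theorem re_pairing_transportRHS_le {T : ℝ} (hT : 0 < T) (v μ : ℝ) {B ψ : ℝ → ℝ → ℂ}
    (hB : SobolevSmooth T B) (hψ : SobolevSmooth T ψ) {t : ℝ} (ht : t ∈ Icc 0 T) :
    |(pairing (transportRHS v μ B ψ) (conjFn ψ) t).re| ≤
      |μ| * √(normSq (dx (density B)) t) * √(normSq ψ t) := by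
  refine (hψ.re_pairing_le_of_transport hT (((hB.density hT).dx hT).const_mul μ) v
    (fun t _ x => rfl) ht).trans (le_of_eq ?_)
  rw [normSq_const_mul, Real.sqrt_mul (by positivity), Real.sqrt_sq (norm_nonneg _),
    Complex.norm_real, Real.norm_eq_abs]

namespace IsSolution

variable {c : Coeffs} {T : ℝ} {B ψ₁ ψ₂ : ℝ → ℝ → ℂ} {t : ℝ}

theorem smooth_fullPotential (hT : 0 < T) (h : IsSolution c T B ψ₁ ψ₂) :
    SobolevSmooth T (fullPotential c B ψ₁ ψ₂) :=
  ((h.smooth₁.const_mul _).add (h.smooth₂.const_mul _)).add ((h.smooth_B.density hT).const_mul _)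

theorem smooth_nonlinearity (hT : 0 < T) (h : IsSolution c T B ψ₁ ψ₂) :
    SobolevSmooth T (nonlinearity c B ψ₁ ψ₂) :=
  (h.smooth_fullPotential hT).mul hT h.smooth_B

theorem smooth_schroedingerRHS (hT : 0 < T) (h : IsSolution c T B ψ₁ ψ₂) :
    SobolevSmooth T (schroedingerRHS c B ψ₁ ψ₂) :=
  ((((h.smooth_B.dx hT).dx hT).const_mul _).const_mul _).add
    ((h.smooth_nonlinearity hT).const_mul _)

theorem conj_fullPotential (h : IsSolution c T B ψ₁ ψ₂) (ht : t ∈ Icc 0 T) (x : ℝ) :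
    (starRingEnd ℂ) (fullPotential c B ψ₁ ψ₂ t x) = fullPotential c B ψ₁ ψ₂ t x := by
  simp only [fullPotential, potential, map_add, map_mul, Complex.conj_ofReal, h.real₁ t ht,
    h.real₂ t ht, conj_density]

/-- Conservation of mass. -/
theorem normSq_B (hT : 0 < T) (h : IsSolution c T B ψ₁ ψ₂) (ht : t ∈ Icc 0 T) :
    normSq B t = normSq B 0 := by
  rw [h.smooth_B.normSq_eq (h.smooth_schroedingerRHS hT) h.eq_B ht]
  have h1 : ∫ τ in 0..t, 2 * (pairing (schroedingerRHS c B ψ₁ ψ₂) (conjFn B) τ).re =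
      ∫ τ in 0..t, (0 : ℝ) := by
    apply intervalIntegral.integral_congr
    intro τ hτ
    rw [uIcc_of_le ht.1] at hτ
    have hτ' : τ ∈ Icc 0 T := ⟨hτ.1, hτ.2.trans ht.2⟩
    have e : pairing (schroedingerRHS c B ψ₁ ψ₂) (conjFn B) τ =
        (Complex.I * c.ω) * pairing (dx (dx B)) (conjFn B) τ +
          (-Complex.I) * pairing (nonlinearity c B ψ₁ ψ₂) (conjFn B) τ := by
      rw [← pairing_const_mul_left, ← pairing_const_mul_left,
        ← (((h.smooth_B.dx hT).dx hT).const_mul _).pairing_add_left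
          ((h.smooth_nonlinearity hT).const_mul _) h.smooth_B.conj hτ']
      exact pairing_congr (fun x => by rw [schroedingerRHS]; ring) fun _ => rfl
    have e1 : (pairing (nonlinearity c B ψ₁ ψ₂) (conjFn B) τ).im = 0 := by
      rw [← Complex.conj_eq_iff_im, conj_pairing]
      simp only [pairing]
      congr 1
      ext x
      simp only [conjFn, nonlinearity, map_mul, h.conj_fullPotential hτ', Complex.conj_conj]
      ring
    have e2 := h.smooth_B.im_pairing_dx_dx_conj hT hτ'
    simp only [e, Complex.add_re]
    rw [mul_assoc, Complex.I_mul_re, Complex.im_ofReal_mul, e2, neg_mul, Complex.neg_re,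
      Complex.I_mul_re, e1]
    simp
  rw [h1]
  simp

/-- The conserved energy
`ω ∫ |B_x|² + ∫ V |B|² + (λ/2) ∫ |B|⁴ - ∑ (r_j v_j / 2) ∫ ψ_j²`. It has no definite sign. -/
def energy (c : Coeffs) (B ψ₁ ψ₂ : ℝ → ℝ → ℂ) (t : ℝ) : ℂ :=
  (c.ω : ℂ) * pairing (dx B) (conjFn (dx B)) t + pairing (potential c ψ₁ ψ₂) (density B) t +
    (c.lam / 2 : ℂ) * pairing (density B) (density B) t -
    (c.r₁ * c.v₁ / 2 : ℂ) * pairing ψ₁ ψ₁ t - (c.r₂ * c.v₂ / 2 : ℂ) * pairing ψ₂ ψ₂ t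

/-- `F` is the primitive of `p` on `[0, T]`. -/
def IsPrimitive (T : ℝ) (F p : ℝ → ℂ) : Prop :=
  ∀ t ∈ Icc 0 T, IntervalIntegrable p volume 0 t ∧ F t - F 0 = ∫ τ in 0..t, p τ

theorem IsPrimitive.add {F G p q : ℝ → ℂ} (hF : IsPrimitive T F p) (hG : IsPrimitive T G q) :
    IsPrimitive T (fun t => F t + G t) (fun t => p t + q t) := fun t ht =>
  ⟨(hF t ht).1.add (hG t ht).1, by
    rw [intervalIntegral.integral_add (hF t ht).1 (hG t ht).1, ← (hF t ht).2, ← (hG t ht).2]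
    ring⟩

theorem IsPrimitive.const_mul {F p : ℝ → ℂ} (a : ℂ) (hF : IsPrimitive T F p) :
    IsPrimitive T (fun t => a * F t) (fun t => a * p t) := fun t ht =>
  ⟨(hF t ht).1.const_mul a, by
    rw [intervalIntegral.integral_const_mul, ← (hF t ht).2]
    ring⟩

theorem isPrimitive_pairing {f f' g g' : ℝ → ℝ → ℂ} (hf : SobolevSmooth T f)
    (hf' : SobolevSmooth T f') (hg : SobolevSmooth T g) (hg' : SobolevSmooth T g')
    (hff' : HasTimeDeriv T f f') (hgg' : HasTimeDeriv T g g') :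
    IsPrimitive T (pairing f g) (fun t => pairing f' g t + pairing f g' t) := fun _ ht =>
  ⟨(hf'.intervalIntegrable_pairing hg ht).add (hf.intervalIntegrable_pairing hg' ht),
    hf.pairing_sub_pairing_zero hf' hg hg' hff' hgg' ht⟩

theorem integral_linear_combination {u₁ u₂ u₃ u₄ : ℝ → ℂ} (h₁ : Integrable u₁)
    (h₂ : Integrable u₂) (h₃ : Integrable u₃) (h₄ : Integrable u₄) (a b : ℂ) :
    ∫ x, (a * (-u₁ x + -u₂ x) + u₃ x + b * u₄ x) =
      a * (-(∫ x, u₁ x) + -(∫ x, u₂ x)) + (∫ x, u₃ x) + b * ∫ x, u₄ x := by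
  have h12 : Integrable (fun x => -u₁ x + -u₂ x) := h₁.neg.add h₂.neg
  have h12' : Integrable (fun x => a * (-u₁ x + -u₂ x)) := h12.const_mul a
  have h123 : Integrable (fun x => a * (-u₁ x + -u₂ x) + u₃ x) := h12'.add h₃
  rw [integral_add h123 (h₄.const_mul b), integral_add h12' h₃, integral_const_mul,
    integral_const_mul]
  have h : ∫ x, (-u₁ x + -u₂ x) = -(∫ x, u₁ x) + -∫ x, u₂ x := by
    rw [← integral_neg, ← integral_neg]
    exact integral_add h₁.neg h₂.neg
  rw [h]

/-- The time derivatives of `ω ∫ |B_x|²` and of the potential terms with `V` frozen cancel. -/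
theorem energy_density_identity (hT : 0 < T) (h : IsSolution c T B ψ₁ ψ₂) (ht : t ∈ Icc 0 T)
    {R N' : ℝ → ℝ → ℂ} (hR : R = schroedingerRHS c B ψ₁ ψ₂)
    (hN' : N' = fun t x => R t x * (starRingEnd ℂ) (B t x) + B t x * (starRingEnd ℂ) (R t x)) :
    (c.ω : ℂ) * (pairing (dx R) (conjFn (dx B)) t + pairing (dx B) (conjFn (dx R)) t) +
      pairing (potential c ψ₁ ψ₂) N' t + (c.lam : ℂ) * pairing (density B) N' t = 0 := by
  have sR : SobolevSmooth T R := hR ▸ h.smooth_schroedingerRHS hT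
  have sB := h.smooth_B
  have sN' : SobolevSmooth T N' := by
    rw [hN']
    exact (sR.mul hT sB.conj).add (sB.mul hT sR.conj)
  have sV : SobolevSmooth T (potential c ψ₁ ψ₂) :=
    (h.smooth₁.const_mul _).add (h.smooth₂.const_mul _)
  have sBxx := (sB.dx hT).dx hT
  have e1 : pairing (dx R) (conjFn (dx B)) t = -pairing R (conjFn (dx (dx B))) t := by
    rw [sR.pairing_dx hT (sB.dx hT).conj ht]
    rw [show dx (fun t x => (starRingEnd ℂ) (dx B t x)) = conjFn (dx (dx B)) from dx_conjFn _]
  have e2 : pairing (dx B) (conjFn (dx R)) t = -pairing (dx (dx B)) (conjFn R) t := by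
    rw [← dx_conjFn, pairing_comm, sR.conj.pairing_dx hT (sB.dx hT) ht, pairing_comm]
  rw [e1, e2]
  have i1 := sR.integrable_mul sBxx.conj ht
  have i2 := sBxx.integrable_mul sR.conj ht
  have i3 := sV.integrable_mul sN' ht
  have i4 := (sB.density hT).integrable_mul sN' ht
  have key := integral_linear_combination i1 i2 i3 i4 c.ω c.lam
  refine Eq.trans (Eq.symm key) ?_
  rw [← integral_zero ℝ ℂ]
  congr 1
  ext x
  have hreal := h.conj_fullPotential ht x
  have hRx : R t x = Complex.I * (c.ω * dx (dx B) t x) +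
      (-Complex.I) * (fullPotential c B ψ₁ ψ₂ t x * B t x) := by rw [hR]; rfl
  have hRc : (starRingEnd ℂ) (R t x) = -Complex.I * (c.ω * (starRingEnd ℂ) (dx (dx B) t x)) +
      Complex.I * (fullPotential c B ψ₁ ψ₂ t x * (starRingEnd ℂ) (B t x)) := by
    rw [hRx]
    simp only [map_add, map_mul, map_neg, Complex.conj_I, Complex.conj_ofReal, hreal]
    ring
  have hW : potential c ψ₁ ψ₂ t x =
      fullPotential c B ψ₁ ψ₂ t x - c.lam * density B t x := by
    rw [fullPotential]
    ring
  simp only [hN', hW, hRc]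
  rw [hRx]
  ring

/-- The terms of the energy that involve `∂_t ψ` cancel. -/
theorem energy_wave_identity (hT : 0 < T) (v μ : ℝ) {ψ : ℝ → ℝ → ℂ} (hB : SobolevSmooth T B)
    (hψ : SobolevSmooth T ψ) (ht : t ∈ Icc 0 T) :
    (μ : ℂ) * pairing (transportRHS v μ B ψ) (density B) t -
      (v : ℂ) * pairing (transportRHS v μ B ψ) ψ t = 0 := by
  have sN := hB.density hT
  have hself : ∀ {f : ℝ → ℝ → ℂ}, SobolevSmooth T f → pairing (dx f) f t = 0 := by
    intro f hf
    have h1 := hf.pairing_dx hT hf ht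
    rw [pairing_comm f] at h1
    linear_combination (1 / 2 : ℂ) * h1
  have e : ∀ {g : ℝ → ℝ → ℂ}, SobolevSmooth T g → pairing (transportRHS v μ B ψ) g t =
      -(v : ℂ) * pairing (dx ψ) g t + (μ : ℂ) * pairing (dx (density B)) g t := by
    intro g hg
    rw [← pairing_const_mul_left, ← pairing_const_mul_left,
      ← ((hψ.dx hT).const_mul _).pairing_add_left ((sN.dx hT).const_mul _) hg ht]
    rfl
  rw [e sN, e hψ, hself sN, hself hψ, sN.pairing_dx hT hψ ht, pairing_comm (density B)]
  ring

/-- Conservation of energy. -/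
theorem energy_eq (hT : 0 < T) (h : IsSolution c T B ψ₁ ψ₂) (ht : t ∈ Icc 0 T) :
    energy c B ψ₁ ψ₂ t = energy c B ψ₁ ψ₂ 0 := by
  set R := schroedingerRHS c B ψ₁ ψ₂ with hR
  have sR : SobolevSmooth T R := h.smooth_schroedingerRHS hT
  have sB := h.smooth_B
  have sN := sB.density hT
  set N' : ℝ → ℝ → ℂ := fun t x => R t x * (starRingEnd ℂ) (B t x) +
    B t x * (starRingEnd ℂ) (R t x) with hN'
  have sN' : SobolevSmooth T N' := (sR.mul hT sB.conj).add (sB.mul hT sR.conj)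
  have dN : HasTimeDeriv T (density B) N' := h.eq_B.mul h.eq_B.conj
  set P₁ := transportRHS c.v₁ c.μ₁ B ψ₁
  set P₂ := transportRHS c.v₂ c.μ₂ B ψ₂
  have s1 : SobolevSmooth T P₁ := sB.transportRHS hT _ _ h.smooth₁
  have s2 : SobolevSmooth T P₂ := sB.transportRHS hT _ _ h.smooth₂
  have sV : SobolevSmooth T (potential c ψ₁ ψ₂) :=
    (h.smooth₁.const_mul _).add (h.smooth₂.const_mul _)
  have sV' : SobolevSmooth T (potential c P₁ P₂) := (s1.const_mul _).add (s2.const_mul _)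
  have dV : HasTimeDeriv T (potential c ψ₁ ψ₂) (potential c P₁ P₂) :=
    (h.eq₁.const_mul _).add (h.eq₂.const_mul _)
  have dBx : HasTimeDeriv T (dx B) (dx R) := h.eq_B.dx sB
  have hprim := (((((isPrimitive_pairing (sB.dx hT) (sR.dx hT) (sB.dx hT).conj (sR.dx hT).conj
      dBx dBx.conj).const_mul c.ω).add (isPrimitive_pairing sV sV' sN sN' dV dN)).add
      ((isPrimitive_pairing sN sN' sN sN' dN dN).const_mul (c.lam / 2))).add
      ((isPrimitive_pairing h.smooth₁ s1 h.smooth₁ s1 h.eq₁ h.eq₁).const_mul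
        (-(c.r₁ * c.v₁ / 2)))).add
      ((isPrimitive_pairing h.smooth₂ s2 h.smooth₂ s2 h.eq₂ h.eq₂).const_mul
        (-(c.r₂ * c.v₂ / 2)))
  have hfin := (hprim t ht).2
  have hzero : ∀ τ ∈ Icc 0 T, (c.ω : ℂ) * (pairing (dx R) (conjFn (dx B)) τ +
      pairing (dx B) (conjFn (dx R)) τ) +
      (pairing (potential c P₁ P₂) (density B) τ + pairing (potential c ψ₁ ψ₂) N' τ) +
      (c.lam / 2 : ℂ) * (pairing N' (density B) τ + pairing (density B) N' τ) +
      -(c.r₁ * c.v₁ / 2 : ℂ) * (pairing P₁ ψ₁ τ + pairing ψ₁ P₁ τ) +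
      -(c.r₂ * c.v₂ / 2 : ℂ) * (pairing P₂ ψ₂ τ + pairing ψ₂ P₂ τ) = 0 := by
    intro τ hτ
    have k1 := h.energy_density_identity hT hτ hR hN'
    have k2 := energy_wave_identity hT c.v₁ c.μ₁ sB h.smooth₁ hτ
    have k3 := energy_wave_identity hT c.v₂ c.μ₂ sB h.smooth₂ hτ
    have k4 : pairing (potential c P₁ P₂) (density B) τ =
        (c.r₁ * c.μ₁ : ℂ) * pairing P₁ (density B) τ +
          (c.r₂ * c.μ₂ : ℂ) * pairing P₂ (density B) τ := by
      rw [← pairing_const_mul_left, ← pairing_const_mul_left,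
        ← (s1.const_mul _).pairing_add_left (s2.const_mul _) sN hτ]
      exact pairing_congr (fun x => by rw [potential]; push_cast; rfl) fun _ => rfl
    rw [pairing_comm N' (density B), pairing_comm ψ₁ P₁, pairing_comm ψ₂ P₂, k4]
    linear_combination k1 + c.r₁ * k2 + c.r₂ * k3
  have hint : (∫ τ in 0..t, ((c.ω : ℂ) * (pairing (dx R) (conjFn (dx B)) τ +
      pairing (dx B) (conjFn (dx R)) τ) +
      (pairing (potential c P₁ P₂) (density B) τ + pairing (potential c ψ₁ ψ₂) N' τ) +
      (c.lam / 2 : ℂ) * (pairing N' (density B) τ + pairing (density B) N' τ) +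
      -(c.r₁ * c.v₁ / 2 : ℂ) * (pairing P₁ ψ₁ τ + pairing ψ₁ P₁ τ) +
      -(c.r₂ * c.v₂ / 2 : ℂ) * (pairing P₂ ψ₂ τ + pairing ψ₂ P₂ τ))) = ∫ τ in 0..t, (0 : ℂ) := by
    apply intervalIntegral.integral_congr
    intro τ hτ
    rw [uIcc_of_le ht.1] at hτ
    exact hzero τ ⟨hτ.1, hτ.2.trans ht.2⟩
  rw [intervalIntegral.integral_zero] at hint
  have hfin2 := hfin.trans hint
  simp only [energy]
  linear_combination hfin2

end IsSolution

/-! ### A priori bounds for small data -/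

namespace IsSolution

variable {c : Coeffs} {T : ℝ} {B ψ₁ ψ₂ : ℝ → ℝ → ℂ} {t : ℝ}

/-- A constant that controls the lower-order part of the energy. -/
def couplingSize (c : Coeffs) : ℝ :=
  |c.r₁ * c.μ₁| + |c.r₂ * c.μ₂| + |c.lam| + |c.r₁ * c.v₁| + |c.r₂ * c.v₂|

theorem couplingSize_nonneg (c : Coeffs) : 0 ≤ couplingSize c := by
  unfold couplingSize
  positivity

/-- Apart from `ω ∫ |B_x|²`, the energy is controlled by the size of `ψ_j` and by the mass. -/
theorem norm_energy_sub_le (hT : 0 < T) (h : IsSolution c T B ψ₁ ψ₂) (ht : t ∈ Icc 0 T) :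
    ‖energy c B ψ₁ ψ₂ t - ((c.ω * normSq (dx B) t : ℝ) : ℂ)‖ ≤
      couplingSize c * (normSq ψ₁ t + normSq ψ₂ t +
        (normSq B t + normSq (dx B) t) * normSq B t) := by
  have sN := h.smooth_B.density hT
  set n := normSq (density B) t with hn
  have hnle : n ≤ (normSq B t + normSq (dx B) t) * normSq B t :=
    h.smooth_B.normSq_density_le hT ht
  have hn0 : 0 ≤ n := normSq_nonneg _ _
  have hz1 : 0 ≤ normSq ψ₁ t := normSq_nonneg _ _
  have hz2 : 0 ≤ normSq ψ₂ t := normSq_nonneg _ _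
  have cs : ∀ {f g : ℝ → ℝ → ℂ}, SobolevSmooth T f → SobolevSmooth T g →
      ‖pairing f g t‖ ≤ normSq f t + normSq g t := by
    intro f g hf hg
    have h1 := hf.norm_pairing_le hg ht
    have h2 := Real.sq_sqrt (normSq_nonneg f t)
    have h3 := Real.sq_sqrt (normSq_nonneg g t)
    nlinarith [sq_nonneg (√(normSq f t) - √(normSq g t)), normSq_nonneg f t, normSq_nonneg g t]
  have csq : ∀ {f : ℝ → ℝ → ℂ}, SobolevSmooth T f → ‖pairing f f t‖ ≤ normSq f t := by
    intro f hf
    have h1 := hf.norm_pairing_le hf ht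
    rwa [Real.mul_self_sqrt (normSq_nonneg f t)] at h1
  have hV : pairing (potential c ψ₁ ψ₂) (density B) t =
      ((c.r₁ * c.μ₁ : ℝ) : ℂ) * pairing ψ₁ (density B) t +
        ((c.r₂ * c.μ₂ : ℝ) : ℂ) * pairing ψ₂ (density B) t := by
    rw [← pairing_const_mul_left, ← pairing_const_mul_left,
      ← (h.smooth₁.const_mul _).pairing_add_left (h.smooth₂.const_mul _) sN ht]
    rfl
  have e : energy c B ψ₁ ψ₂ t - ((c.ω * normSq (dx B) t : ℝ) : ℂ) =
      ((c.r₁ * c.μ₁ : ℝ) : ℂ) * pairing ψ₁ (density B) t +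
      ((c.r₂ * c.μ₂ : ℝ) : ℂ) * pairing ψ₂ (density B) t +
      ((c.lam / 2 : ℝ) : ℂ) * pairing (density B) (density B) t -
      ((c.r₁ * c.v₁ / 2 : ℝ) : ℂ) * pairing ψ₁ ψ₁ t -
      ((c.r₂ * c.v₂ / 2 : ℝ) : ℂ) * pairing ψ₂ ψ₂ t := by
    rw [energy, hV, pairing_conj_self]
    push_cast
    ring
  rw [e]
  refine (norm_sub_le _ _).trans ?_
  refine (add_le_add_left (norm_sub_le _ _) _).trans ?_
  refine (add_le_add_left (add_le_add_left (norm_add₃_le) _) _).trans ?_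
  simp only [norm_mul, Complex.norm_real, Real.norm_eq_abs, abs_div, abs_two]
  have b1 := mul_le_mul_of_nonneg_left (cs h.smooth₁ sN) (abs_nonneg (c.r₁ * c.μ₁))
  have b2 := mul_le_mul_of_nonneg_left (cs h.smooth₂ sN) (abs_nonneg (c.r₂ * c.μ₂))
  have b3 := mul_le_mul_of_nonneg_left (csq sN) (abs_nonneg c.lam)
  have b4 := mul_le_mul_of_nonneg_left (csq h.smooth₁) (abs_nonneg (c.r₁ * c.v₁))
  have b5 := mul_le_mul_of_nonneg_left (csq h.smooth₂) (abs_nonneg (c.r₂ * c.v₂))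
  rw [← hn] at b1 b2 b3
  have hbig : couplingSize c * (normSq ψ₁ t + normSq ψ₂ t + n) ≤ couplingSize c *
      (normSq ψ₁ t + normSq ψ₂ t + (normSq B t + normSq (dx B) t) * normSq B t) := by
    have := couplingSize_nonneg c
    gcongr
  refine le_trans ?_ hbig
  simp only [abs_mul] at b1 b2 b4 b5 ⊢
  have p1 : 0 ≤ |c.r₁| * |c.μ₁| := by positivity
  have p2 : 0 ≤ |c.r₂| * |c.μ₂| := by positivity
  have p3 : 0 ≤ |c.lam| := by positivity
  have p4 : 0 ≤ |c.r₁| * |c.v₁| := by positivity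
  have p5 : 0 ≤ |c.r₂| * |c.v₂| := by positivity
  simp only [couplingSize, abs_mul]
  generalize |c.r₁| * |c.μ₁| = a1 at *
  generalize |c.r₂| * |c.μ₂| = a2 at *
  generalize |c.lam| = a3 at *
  generalize |c.r₁| * |c.v₁| = a4 at *
  generalize |c.r₂| * |c.v₂| = a5 at *
  generalize normSq ψ₁ t = z1 at *
  generalize normSq ψ₂ t = z2 at *
  have q4 : 0 ≤ a4 * z1 := by positivity
  have q5 : 0 ≤ a5 * z2 := by positivity
  have q3 : 0 ≤ a3 * n := by positivity
  have e1 : 0 ≤ a1 * z2 := by positivity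
  have e2 : 0 ≤ a2 * z1 := by positivity
  have e3 : 0 ≤ a3 * z1 := by positivity
  have e4 : 0 ≤ a3 * z2 := by positivity
  have e5 : 0 ≤ a4 * z2 := by positivity
  have e6 : 0 ≤ a5 * z1 := by positivity
  have e7 : 0 ≤ a4 * n := by positivity
  have e8 : 0 ≤ a5 * n := by positivity
  linarith

/-- If `ω = 0` then `|B|²` does not depend on time. -/
theorem density_eq_of_omega_eq_zero (hT : 0 < T) (hω : c.ω = 0) (h : IsSolution c T B ψ₁ ψ₂)
    (ht : t ∈ Icc 0 T) (x : ℝ) : density B t x = density B 0 x := by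
  have hcont : ContinuousOn (fun τ => density B τ x) (Icc 0 t) :=
    (h.smooth_B.density hT).smooth.continuousOn.comp (f := fun τ : ℝ => (τ, x)) (by fun_prop)
      fun τ hτ => ⟨⟨hτ.1, hτ.2.trans ht.2⟩, mem_univ x⟩
  have hderiv : ∀ τ ∈ Ioo 0 t, HasDerivAt (fun τ => density B τ x) 0 τ := by
    intro τ hτ
    have hτ' : τ ∈ Ioo 0 T := ⟨hτ.1, hτ.2.trans_le ht.2⟩
    refine ((h.eq_B.mul h.eq_B.conj) τ hτ' x).congr_deriv ?_
    simp only [schroedingerRHS, hω, nonlinearity, map_add, map_mul, map_neg, Complex.conj_I,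
      h.conj_fullPotential (Ioo_subset_Icc_self hτ') x]
    simp
    ring
  have := intervalIntegral.integral_eq_sub_of_hasDerivAt_of_le ht.1 hcont hderiv
    intervalIntegrable_const
  rw [intervalIntegral.integral_zero] at this
  exact (sub_eq_zero.1 this.symm)

/-- `|B|²` is controlled in `L^∞` and in `Ḣ¹` by the size `ε` of the data and the size of `ψ_j`:
for `ω ≠ 0` by conservation of energy, for `ω = 0` because `|B|²` is constant in time. -/
theorem exists_density_bound (c : Coeffs) (hT : 0 < T) {M Y Z : ℝ} (hM : 0 ≤ M) (hY : 0 ≤ Y)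
    (hZ : 0 ≤ Z) : ∃ K : ℝ, 0 ≤ K ∧ ∃ ε₁ : ℝ, 0 < ε₁ ∧ ε₁ ≤ 1 ∧
    ∀ ε, 0 < ε → ε ≤ ε₁ → ∀ B ψ₁ ψ₂, IsSolution c T B ψ₁ ψ₂ → normSq B 0 = ε ^ 2 * M →
      normSq (dx B) 0 = ε ^ 2 * Y → normSq ψ₁ 0 = ε ^ 2 * Z → normSq ψ₂ 0 = 0 →
      ∀ t ∈ Icc 0 T, (∀ x, ‖B t x‖ ^ 2 ≤ K * (ε ^ 2 + (normSq ψ₁ t + normSq ψ₂ t))) ∧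
        normSq (dx (density B)) t ≤ (K * (ε ^ 2 + (normSq ψ₁ t + normSq ψ₂ t))) ^ 2 := by
  have h0T : (0 : ℝ) ∈ Icc 0 T := ⟨le_rfl, hT.le⟩
  by_cases hω : c.ω = 0
  · refine ⟨2 * (M + Y), by positivity, 1, one_pos, le_rfl, ?_⟩
    intro ε hε _ B ψ₁ ψ₂ h hB hBx h1 h2 t ht
    have hz1 := normSq_nonneg ψ₁ t
    have hz2 := normSq_nonneg ψ₂ t
    have hle : ε ^ 2 ≤ ε ^ 2 + (normSq ψ₁ t + normSq ψ₂ t) := by linarith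
    constructor
    · intro x
      rw [← norm_density, h.density_eq_of_omega_eq_zero hT hω ht, norm_density]
      calc ‖B 0 x‖ ^ 2 ≤ normSq B 0 + normSq (dx B) 0 := h.smooth_B.norm_sq_le hT h0T x
        _ = (M + Y) * ε ^ 2 := by rw [hB, hBx]; ring
        _ ≤ (2 * (M + Y)) * ε ^ 2 := by gcongr; linarith
        _ ≤ _ := by gcongr
    · have e : normSq (dx (density B)) t = normSq (dx (density B)) 0 := by
        have : density B t = density B 0 :=
          funext fun x => h.density_eq_of_omega_eq_zero hT hω ht x
        simp only [normSq, dx, this]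
      rw [e]
      calc normSq (dx (density B)) 0
          ≤ 4 * (normSq B 0 + normSq (dx B) 0) * normSq (dx B) 0 :=
            h.smooth_B.normSq_dx_density_le hT h0T
        _ = 4 * (M + Y) * Y * (ε ^ 2) ^ 2 := by rw [hB, hBx]; ring
        _ ≤ 4 * (M + Y) * (M + Y) * (ε ^ 2) ^ 2 := by gcongr; linarith
        _ = (2 * (M + Y) * ε ^ 2) ^ 2 := by ring
        _ ≤ _ := by gcongr
  · set C := couplingSize c with hC
    have hC0 : 0 ≤ C := couplingSize_nonneg c
    have hω' : 0 < |c.ω| := abs_pos.2 hω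
    set K₁ := 2 / |c.ω| * (|c.ω| * Y + C * (Z + (M + Y) * M + M ^ 2 + 1)) with hK₁
    have hK₁0 : 0 ≤ K₁ := by positivity
    refine ⟨2 * (M + K₁), by positivity, min 1 (|c.ω| / (2 * (C * M + 1))),
      lt_min one_pos (by positivity), min_le_left _ _, ?_⟩
    intro ε hε hε1 B ψ₁ ψ₂ h hB hBx h1 h2 t ht
    have hε2 : ε ≤ 1 := hε1.trans (min_le_left _ _)
    have hsmall : C * (ε ^ 2 * M) ≤ |c.ω| / 2 := by
      have h3 : ε * (2 * (C * M + 1)) ≤ |c.ω| :=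
        (le_div_iff₀ (by positivity)).1 (hε1.trans (min_le_right _ _))
      have h4 : 0 ≤ C * M := by positivity
      nlinarith [mul_nonneg hε.le h4, mul_le_mul_of_nonneg_left hε2 (mul_nonneg hε.le h4)]
    have hm := h.normSq_B hT ht
    have ht' := h.norm_energy_sub_le hT ht
    have h0' := h.norm_energy_sub_le hT h0T
    rw [h.energy_eq hT ht, hm] at ht'
    rw [h1, h2] at h0'
    rw [hB] at ht' h0' hm
    rw [hBx] at h0'
    set z := normSq ψ₁ t + normSq ψ₂ t with hz
    have hz0 : 0 ≤ z := add_nonneg (normSq_nonneg _ _) (normSq_nonneg _ _)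
    set y := normSq (dx B) t with hy
    have hy0 : 0 ≤ y := normSq_nonneg _ _
    have hωy : |c.ω| * y ≤ |c.ω| * (ε ^ 2 * Y) +
        C * (ε ^ 2 * Z + 0 + (ε ^ 2 * M + ε ^ 2 * Y) * (ε ^ 2 * M)) +
        C * (z + (ε ^ 2 * M + y) * (ε ^ 2 * M)) := by
      have k := norm_sub_le ((energy c B ψ₁ ψ₂ 0) - ((c.ω * (ε ^ 2 * Y) : ℝ) : ℂ))
        ((energy c B ψ₁ ψ₂ 0) - ((c.ω * y : ℝ) : ℂ))
      have k2 := norm_add_le ((energy c B ψ₁ ψ₂ 0 - ((c.ω * (ε ^ 2 * Y) : ℝ) : ℂ)) -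
        (energy c B ψ₁ ψ₂ 0 - ((c.ω * y : ℝ) : ℂ))) ((c.ω * (ε ^ 2 * Y) : ℝ) : ℂ)
      rw [show energy c B ψ₁ ψ₂ 0 - ((c.ω * (ε ^ 2 * Y) : ℝ) : ℂ) -
        (energy c B ψ₁ ψ₂ 0 - ((c.ω * y : ℝ) : ℂ)) + ((c.ω * (ε ^ 2 * Y) : ℝ) : ℂ) =
        ((c.ω * y : ℝ) : ℂ) by ring, Complex.norm_real, Complex.norm_real, Real.norm_eq_abs,
        Real.norm_eq_abs, abs_mul, abs_mul, abs_of_nonneg hy0,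
        abs_of_nonneg (show 0 ≤ ε ^ 2 * Y by positivity)] at k2
      linarith
    have hyle : y ≤ K₁ * (ε ^ 2 + z) := by
      have h5 : C * (ε ^ 2 * M) * y ≤ |c.ω| / 2 * y := by gcongr
      have hε4 : ε ^ 2 * ε ^ 2 ≤ ε ^ 2 := by
        have : ε ^ 2 ≤ 1 := pow_le_one₀ hε.le hε2
        nlinarith [sq_nonneg ε]
      have h6 : |c.ω| / 2 * y ≤ |c.ω| * (ε ^ 2 * Y) + C * (ε ^ 2 * Z + ε ^ 2 * ((M + Y) * M)) +
          C * (z + ε ^ 2 * M ^ 2) := by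
        have h7 : C * ((M + Y) * M) * (ε ^ 2 * ε ^ 2) ≤ C * ((M + Y) * M) * ε ^ 2 := by gcongr
        have h8 : C * M ^ 2 * (ε ^ 2 * ε ^ 2) ≤ C * M ^ 2 * ε ^ 2 := by gcongr
        linarith
      have h9 : |c.ω| / 2 * y ≤ (|c.ω| * Y + C * (Z + (M + Y) * M + M ^ 2 + 1)) * (ε ^ 2 + z) := by
        have q1 : 0 ≤ |c.ω| * Y * z := by positivity
        have q2 : 0 ≤ C * (Z + (M + Y) * M + M ^ 2) * z := by positivity
        have q3 : 0 ≤ C * ε ^ 2 := by positivity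
        linarith
      have h10 : y = 2 / |c.ω| * (|c.ω| / 2 * y) := by field_simp
      rw [h10, hK₁, mul_assoc]
      gcongr
    have hsum : ε ^ 2 * M + y ≤ (M + K₁) * (ε ^ 2 + z) := by
      have : 0 ≤ M * z := by positivity
      linarith
    have hs0 : 0 ≤ ε ^ 2 + z := by positivity
    constructor
    · intro x
      have k := h.smooth_B.norm_sq_le hT ht x
      rw [hm] at k
      have : 0 ≤ (M + K₁) * (ε ^ 2 + z) := by positivity
      linarith
    · have k := h.smooth_B.normSq_dx_density_le hT ht
      rw [hm, ← hy] at k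
      calc normSq (dx (density B)) t ≤ 4 * (ε ^ 2 * M + y) * y := k
        _ ≤ 4 * ((M + K₁) * (ε ^ 2 + z)) * ((M + K₁) * (ε ^ 2 + z)) := by
          gcongr
          refine hyle.trans ?_
          gcongr
          linarith
        _ = _ := by ring

/-- For data of size `ε → 0`, the solutions are of size `O(ε)` on the whole of `[0, T]`, and
`∂_x |B|²` is of size `O(ε²)`. -/
theorem exists_a_priori_bound (c : Coeffs) (hT : 0 < T) {M Y Z : ℝ} (hM : 0 ≤ M) (hY : 0 ≤ Y)
    (hZ : 0 ≤ Z) : ∃ K : ℝ, 0 ≤ K ∧ ∃ ε₁ : ℝ, 0 < ε₁ ∧ ε₁ ≤ 1 ∧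
    ∀ ε, 0 < ε → ε ≤ ε₁ → ∀ B ψ₁ ψ₂, IsSolution c T B ψ₁ ψ₂ → normSq B 0 = ε ^ 2 * M →
      normSq (dx B) 0 = ε ^ 2 * Y → normSq ψ₁ 0 = ε ^ 2 * Z → normSq ψ₂ 0 = 0 →
      ∀ t ∈ Icc 0 T, normSq B t ≤ K ^ 2 * ε ^ 2 ∧ (∀ x, ‖B t x‖ ≤ K * ε) ∧
        normSq ψ₁ t ≤ K ^ 2 * ε ^ 2 ∧ normSq ψ₂ t ≤ K ^ 2 * ε ^ 2 ∧
        √(normSq (dx (density B)) t) ≤ K * ε ^ 2 := by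
  obtain ⟨K, hK, ε₁, hε₁, hε₁', H⟩ := exists_density_bound c hT hM hY hZ
  set D := T * (2 * (|c.μ₁| + |c.μ₂|) * (K * (Z + 2)) * √(Z + 1)) with hD
  have hD0 : 0 ≤ D := by positivity
  refine ⟨1 + M + (Z + 1) + K * (Z + 2), by positivity, min ε₁ (1 / (D + 1)),
    lt_min hε₁ (by positivity), (min_le_left _ _).trans hε₁', ?_⟩
  intro ε hε hε2 B ψ₁ ψ₂ h hB hBx h1 h2
  have H' := H ε hε (hε2.trans (min_le_left _ _)) B ψ₁ ψ₂ h hB hBx h1 h2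
  have hDε : D * ε < 1 := by
    have := (le_div_iff₀ (by positivity)).1 (hε2.trans (min_le_right _ _))
    linarith
  have s1 := h.smooth_B.transportRHS hT c.v₁ c.μ₁ h.smooth₁
  have s2 := h.smooth_B.transportRHS hT c.v₂ c.μ₂ h.smooth₂
  have hε20 : 0 < ε ^ 2 := by positivity
  have hzle : ∀ t ∈ Icc 0 T, normSq ψ₁ t + normSq ψ₂ t ≤ (Z + 1) * ε ^ 2 := by
    intro t ht
    refine le_of_bootstrap (z := fun t => normSq ψ₁ t + normSq ψ₂ t)
      ((h.smooth₁.continuousOn_normSq hT s1 h.eq₁).add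
        (h.smooth₂.continuousOn_normSq hT s2 h.eq₂)) ?_ ?_ ht
    · simp only [h1, h2]
      linarith
    intro t ht hbd
    have e1 := h.smooth₁.normSq_eq s1 h.eq₁ ht
    have e2 := h.smooth₂.normSq_eq s2 h.eq₂ ht
    have hforce : ∀ τ ∈ Icc 0 t, ∀ v μ : ℝ, ∀ ψ, SobolevSmooth T ψ →
        normSq ψ τ ≤ (Z + 1) * ε ^ 2 →
        ‖2 * (pairing (transportRHS v μ B ψ) (conjFn ψ) τ).re‖ ≤
          2 * |μ| * (K * (Z + 2)) * √(Z + 1) * ε ^ 3 := by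
      intro τ hτ v μ ψ hψ hψle
      have hτ' : τ ∈ Icc 0 T := ⟨hτ.1, hτ.2.trans ht.2⟩
      have k1 := re_pairing_transportRHS_le hT v μ h.smooth_B hψ hτ'
      have k2 : √(normSq (dx (density B)) τ) ≤ K * (Z + 2) * ε ^ 2 := by
        apply Real.sqrt_le_iff.2 ⟨by positivity, ((H' τ hτ').2).trans ?_⟩
        have k3 := hbd τ hτ
        have k4 := normSq_nonneg ψ₁ τ
        have k5 := normSq_nonneg ψ₂ τ
        rw [mul_assoc K]
        gcongr
        linarith
      have k3 : √(normSq ψ τ) ≤ √(Z + 1) * ε := by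
        rw [← Real.sqrt_sq hε.le, ← Real.sqrt_mul (by positivity)]
        exact Real.sqrt_le_sqrt hψle
      rw [norm_mul, Real.norm_eq_abs, Real.norm_eq_abs, abs_two]
      calc 2 * |(pairing (transportRHS v μ B ψ) (conjFn ψ) τ).re|
          ≤ 2 * (|μ| * √(normSq (dx (density B)) τ) * √(normSq ψ τ)) := by gcongr
        _ ≤ 2 * (|μ| * (K * (Z + 2) * ε ^ 2) * (√(Z + 1) * ε)) := by gcongr
        _ = _ := by ring
    have hint : ∀ v μ : ℝ, ∀ ψ, SobolevSmooth T ψ →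
        (∀ τ ∈ Icc 0 t, normSq ψ τ ≤ (Z + 1) * ε ^ 2) →
        (∫ τ in 0..t, 2 * (pairing (transportRHS v μ B ψ) (conjFn ψ) τ).re) ≤
          T * (2 * |μ| * (K * (Z + 2)) * √(Z + 1) * ε ^ 3) := by
      intro v μ ψ hψ hψle
      have k := intervalIntegral.norm_integral_le_of_norm_le_const (a := 0) (b := t)
        (f := fun τ => 2 * (pairing (transportRHS v μ B ψ) (conjFn ψ) τ).re)
        (C := 2 * |μ| * (K * (Z + 2)) * √(Z + 1) * ε ^ 3) (by
          intro τ hτ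
          rw [uIoc_of_le ht.1] at hτ
          exact hforce τ ⟨hτ.1.le, hτ.2⟩ v μ ψ hψ (hψle τ ⟨hτ.1.le, hτ.2⟩))
      refine (le_abs_self _).trans (k.trans ?_)
      rw [sub_zero, abs_of_nonneg ht.1, mul_comm]
      gcongr
      exact ht.2
    have i1 := hint c.v₁ c.μ₁ ψ₁ h.smooth₁ fun τ hτ => by
      have := hbd τ hτ
      have := normSq_nonneg ψ₂ τ
      linarith
    have i2 := hint c.v₂ c.μ₂ ψ₂ h.smooth₂ fun τ hτ => by
      have := hbd τ hτ
      have := normSq_nonneg ψ₁ τ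
      linarith
    have hlt : D * ε ^ 3 < ε ^ 2 := by
      calc D * ε ^ 3 = (D * ε) * ε ^ 2 := by ring
        _ < 1 * ε ^ 2 := by gcongr
        _ = ε ^ 2 := one_mul _
    have hDe : D * ε ^ 3 = T * (2 * |c.μ₁| * (K * (Z + 2)) * √(Z + 1) * ε ^ 3) +
        T * (2 * |c.μ₂| * (K * (Z + 2)) * √(Z + 1) * ε ^ 3) := by
      rw [hD]
      ring
    rw [e1, e2, h1, h2]
    linarith
  intro t ht
  have hz := hzle t ht
  have hz1 := normSq_nonneg ψ₁ t
  have hz2 := normSq_nonneg ψ₂ t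
  set K' := 1 + M + (Z + 1) + K * (Z + 2) with hK'
  have hKZ : 0 ≤ K * (Z + 2) := by positivity
  have hK1 : 1 ≤ K' := by linarith
  have hself : K' ≤ K' ^ 2 := by nlinarith
  have hKle : K * (ε ^ 2 + (normSq ψ₁ t + normSq ψ₂ t)) ≤ K * (Z + 2) * ε ^ 2 := by
    rw [mul_assoc]
    gcongr
    linarith
  refine ⟨?_, fun x => ?_, ?_, ?_, ?_⟩
  · rw [h.normSq_B hT ht, hB, mul_comm]
    gcongr
    linarith
  · apply le_of_sq_le_sq _ (by positivity)
    rw [mul_pow]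
    refine ((H' t ht).1 x).trans (hKle.trans ?_)
    gcongr
    linarith
  · have : (Z + 1) * ε ^ 2 ≤ K' ^ 2 * ε ^ 2 := by
      gcongr
      linarith
    linarith
  · have : (Z + 1) * ε ^ 2 ≤ K' ^ 2 * ε ^ 2 := by
      gcongr
      linarith
    linarith
  · apply Real.sqrt_le_iff.2 ⟨by positivity, ((H' t ht).2).trans ?_⟩
    have h0 : 0 ≤ K * (ε ^ 2 + (normSq ψ₁ t + normSq ψ₂ t)) := by positivity
    have : K * (Z + 2) * ε ^ 2 ≤ K' * ε ^ 2 := by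
      gcongr
      linarith
    exact pow_le_pow_left₀ h0 (hKle.trans this) 2

end IsSolution

/-! ### Second-order expansion of the solution in the size of the data -/

namespace SobolevSmooth

variable {T : ℝ} {f g X : ℝ → ℝ → ℂ} {t : ℝ}

theorem normSq_mul_le (hT : 0 < T) (hf : SobolevSmooth T f) (hg : SobolevSmooth T g)
    (ht : t ∈ Icc 0 T) {b : ℝ} (hb : ∀ x, ‖g t x‖ ≤ b) :
    normSq (fun t x => f t x * g t x) t ≤ b ^ 2 * normSq f t := by
  refine le_of_le_of_eq (integral_mono (integrable_norm_sq ((hf.mul hT hg).memLp ht))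
    ((integrable_norm_sq (hf.memLp ht)).const_mul (b ^ 2)) ?_) (integral_const_mul _ _)
  intro x
  simp only [norm_mul, mul_pow]
  rw [mul_comm]
  gcongr
  exact hb x

theorem norm_pairing_mul_le (hT : 0 < T) (hf : SobolevSmooth T f) (hg : SobolevSmooth T g)
    (hX : SobolevSmooth T X) (ht : t ∈ Icc 0 T) {b : ℝ} (hb0 : 0 ≤ b)
    (hb : ∀ x, ‖X t x‖ ≤ b) :
    ‖pairing (fun t x => f t x * g t x) X t‖ ≤ b * √(normSq f t) * √(normSq g t) := by
  have e : pairing (fun t x => f t x * g t x) X t = pairing f (fun t x => g t x * X t x) t := by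
    simp only [pairing, mul_assoc]
  rw [e]
  refine (hf.norm_pairing_le (hg.mul hT hX) ht).trans ?_
  have h1 : √(normSq (fun t x => g t x * X t x) t) ≤ b * √(normSq g t) := by
    rw [← Real.sqrt_sq hb0, ← Real.sqrt_mul (by positivity)]
    exact Real.sqrt_le_sqrt (hg.normSq_mul_le hT hX ht hb)
  calc _ ≤ √(normSq f t) * (b * √(normSq g t)) := by gcongr
    _ = _ := by ring

end SobolevSmooth

namespace IsSolution

variable {c : Coeffs} {T : ℝ} {B ψ₁ ψ₂ : ℝ → ℝ → ℂ} {t : ℝ}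

theorem normSq_nonlinearity_le (hT : 0 < T) (h : IsSolution c T B ψ₁ ψ₂) (ht : t ∈ Icc 0 T)
    {K ε : ℝ} (hK : 0 ≤ K) (hε : 0 < ε) (hε1 : ε ≤ 1) (hm : normSq B t ≤ K ^ 2 * ε ^ 2)
    (hB : ∀ x, ‖B t x‖ ≤ K * ε) (h1 : normSq ψ₁ t ≤ K ^ 2 * ε ^ 2)
    (h2 : normSq ψ₂ t ≤ K ^ 2 * ε ^ 2) :
    √(normSq (nonlinearity c B ψ₁ ψ₂) t) ≤
      2 * (|c.r₁ * c.μ₁| + |c.r₂ * c.μ₂| + |c.lam| * K) * K ^ 2 * ε ^ 2 := by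
  have i1 := integrable_norm_sq (h.smooth₁.memLp ht)
  have i2 := integrable_norm_sq (h.smooth₂.memLp ht)
  have i3 := integrable_norm_sq (h.smooth_B.memLp ht)
  set a₁ := |c.r₁ * c.μ₁|
  set a₂ := |c.r₂ * c.μ₂|
  set a₃ := |c.lam| * K
  have ha₁ : 0 ≤ a₁ := abs_nonneg _
  have ha₂ : 0 ≤ a₂ := abs_nonneg _
  have ha₃ : 0 ≤ a₃ := by positivity
  have hpt : ∀ x, ‖nonlinearity c B ψ₁ ψ₂ t x‖ ^ 2 ≤ 3 * (K * ε) ^ 2 *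
      (a₁ ^ 2 * ‖ψ₁ t x‖ ^ 2 + a₂ ^ 2 * ‖ψ₂ t x‖ ^ 2 + a₃ ^ 2 * ‖B t x‖ ^ 2) := by
    intro x
    have hVn : ‖fullPotential c B ψ₁ ψ₂ t x‖ ≤
        a₁ * ‖ψ₁ t x‖ + a₂ * ‖ψ₂ t x‖ + a₃ * ‖B t x‖ := by
      rw [fullPotential, potential]
      refine norm_add₃_le.trans ?_
      simp only [norm_mul, Complex.norm_real, Real.norm_eq_abs, norm_density]
      have : |c.lam| * ‖B t x‖ ^ 2 ≤ a₃ * ‖B t x‖ := by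
        have hB' : ‖B t x‖ ≤ K := (hB x).trans (mul_le_of_le_one_right hK hε1)
        rw [sq, ← mul_assoc]
        gcongr
        exact mul_le_mul_of_nonneg_left hB' (abs_nonneg _)
      simp only [a₁, a₂, abs_mul] at *
      linarith
    have hsq : ‖fullPotential c B ψ₁ ψ₂ t x‖ ^ 2 ≤ 3 * ((a₁ * ‖ψ₁ t x‖) ^ 2 +
        (a₂ * ‖ψ₂ t x‖) ^ 2 + (a₃ * ‖B t x‖) ^ 2) := by
      refine (pow_le_pow_left₀ (norm_nonneg _) hVn 2).trans ?_
      nlinarith [sq_nonneg (a₁ * ‖ψ₁ t x‖ - a₂ * ‖ψ₂ t x‖),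
        sq_nonneg (a₁ * ‖ψ₁ t x‖ - a₃ * ‖B t x‖), sq_nonneg (a₂ * ‖ψ₂ t x‖ - a₃ * ‖B t x‖)]
    rw [nonlinearity, norm_mul, mul_pow]
    calc _ ≤ (3 * ((a₁ * ‖ψ₁ t x‖) ^ 2 + (a₂ * ‖ψ₂ t x‖) ^ 2 + (a₃ * ‖B t x‖) ^ 2)) *
          (K * ε) ^ 2 := by
          gcongr
          exact hB x
      _ = _ := by ring
  have hint : normSq (nonlinearity c B ψ₁ ψ₂) t ≤ 3 * (K * ε) ^ 2 *
      (a₁ ^ 2 * normSq ψ₁ t + a₂ ^ 2 * normSq ψ₂ t + a₃ ^ 2 * normSq B t) := by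
    have i12 : Integrable (fun x => a₁ ^ 2 * ‖ψ₁ t x‖ ^ 2 + a₂ ^ 2 * ‖ψ₂ t x‖ ^ 2) :=
      (i1.const_mul _).add (i2.const_mul _)
    have i123 : Integrable (fun x => a₁ ^ 2 * ‖ψ₁ t x‖ ^ 2 + a₂ ^ 2 * ‖ψ₂ t x‖ ^ 2 +
        a₃ ^ 2 * ‖B t x‖ ^ 2) := i12.add (i3.const_mul _)
    refine (integral_mono (integrable_norm_sq ((h.smooth_nonlinearity hT).memLp ht))
      (i123.const_mul _) hpt).trans (le_of_eq ?_)
    rw [integral_const_mul, integral_add i12 (i3.const_mul _),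
      integral_add (i1.const_mul _) (i2.const_mul _), integral_const_mul, integral_const_mul,
      integral_const_mul]
    rfl
  apply Real.sqrt_le_iff.2 ⟨by positivity, hint.trans ?_⟩
  calc _ ≤ 3 * (K * ε) ^ 2 * (a₁ ^ 2 * (K ^ 2 * ε ^ 2) + a₂ ^ 2 * (K ^ 2 * ε ^ 2) +
        a₃ ^ 2 * (K ^ 2 * ε ^ 2)) := by gcongr
    _ = (3 * (a₁ ^ 2 + a₂ ^ 2 + a₃ ^ 2)) * (K ^ 2 * ε ^ 2) ^ 2 := by ring
    _ ≤ (2 * (a₁ + a₂ + a₃)) ^ 2 * (K ^ 2 * ε ^ 2) ^ 2 := by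
        gcongr
        nlinarith [mul_nonneg ha₁ ha₂, mul_nonneg ha₁ ha₃, mul_nonneg ha₂ ha₃, sq_nonneg a₁,
          sq_nonneg a₂, sq_nonneg a₃]
    _ = _ := by ring

/-- Testing the Schrödinger equation against a solution `X` of the adjoint free equation leaves
only the nonlinearity. -/
theorem pairing_B_eq (hT : 0 < T) (h : IsSolution c T B ψ₁ ψ₂) {X : ℝ → ℝ → ℂ}
    (hX : SobolevSmooth T X)
    (hX' : HasTimeDeriv T X (fun t x => -(Complex.I * c.ω) * dx (dx X) t x)) (ht : t ∈ Icc 0 T) :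
    pairing B X t = pairing B X 0 +
      ∫ τ in 0..t, -Complex.I * pairing (nonlinearity c B ψ₁ ψ₂) X τ := by
  have sXxx := (hX.dx hT).dx hT
  have k := h.smooth_B.pairing_sub_pairing_zero (h.smooth_schroedingerRHS hT) hX
    (sXxx.const_mul _) h.eq_B hX' ht
  rw [← sub_eq_iff_eq_add', k]
  apply intervalIntegral.integral_congr
  intro τ hτ
  rw [uIcc_of_le ht.1] at hτ
  have hτ' : τ ∈ Icc 0 T := ⟨hτ.1, hτ.2.trans ht.2⟩
  have e1 : pairing (schroedingerRHS c B ψ₁ ψ₂) X τ =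
      (Complex.I * c.ω) * pairing (dx (dx B)) X τ +
        (-Complex.I) * pairing (nonlinearity c B ψ₁ ψ₂) X τ := by
    rw [← pairing_const_mul_left, ← pairing_const_mul_left,
      ← (((h.smooth_B.dx hT).dx hT).const_mul _).pairing_add_left
        ((h.smooth_nonlinearity hT).const_mul _) hX hτ']
    exact pairing_congr (fun x => by rw [schroedingerRHS]; ring) fun _ => rfl
  have e2 : pairing B (fun t x => -(Complex.I * c.ω) * dx (dx X) t x) τ =
      -(Complex.I * c.ω) * pairing (dx (dx B)) X τ := by
    rw [pairing_comm, pairing_const_mul_left, (hX.dx hT).pairing_dx hT h.smooth_B hτ',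
      pairing_comm (dx X), (h.smooth_B.dx hT).pairing_dx hT hX hτ']
  simp only [e1, e2]
  ring

/-- The expansion of `∫ B X` to second order in the size `ε` of the data `(ε U, ε Ψ, 0)`. The
quadratic term is the interaction of the free evolutions `U` and `Ψ`. -/
theorem exists_expansion (c : Coeffs) (hT : 0 < T) {U Ψ X : ℝ → ℝ → ℂ}
    (hU : SobolevSmooth T U) (hΨ : SobolevSmooth T Ψ) (hX : SobolevSmooth T X)
    (hU' : HasTimeDeriv T U (fun t x => Complex.I * c.ω * dx (dx U) t x))
    (hΨ' : HasTimeDeriv T Ψ (fun t x => -(c.v₁ : ℂ) * dx Ψ t x))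
    (hX' : HasTimeDeriv T X (fun t x => -(Complex.I * c.ω) * dx (dx X) t x)) :
    ∃ K : ℝ, 0 ≤ K ∧ ∃ ε₁ : ℝ, 0 < ε₁ ∧ ∀ ε, 0 < ε → ε ≤ ε₁ → ∀ B ψ₁ ψ₂,
      IsSolution c T B ψ₁ ψ₂ → (∀ x, B 0 x = ε * U 0 x) → (∀ x, ψ₁ 0 x = ε * Ψ 0 x) →
      (∀ x, ψ₂ 0 x = 0) → ∀ t ∈ Icc 0 T,
      ‖pairing B X t - (ε * pairing U X 0 + ε ^ 2 * (-Complex.I * (c.r₁ * c.μ₁) *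
        ∫ τ in 0..t, pairing (fun t x => Ψ t x * U t x) X τ))‖ ≤ K * ε ^ 3 := by
  have h0T : (0 : ℝ) ∈ Icc 0 T := ⟨le_rfl, hT.le⟩
  obtain ⟨K, hK, ε₁, hε₁, hε₁', H⟩ := exists_a_priori_bound c hT (normSq_nonneg U 0)
    (normSq_nonneg (dx U) 0) (normSq_nonneg Ψ 0)
  obtain ⟨b, hb⟩ := hX.exists_norm_le hT
  obtain ⟨P, hP0, hP⟩ := hΨ.exists_normSq_le
  set a₁ := |c.r₁ * c.μ₁| with ha₁
  set a₂ := |c.r₂ * c.μ₂| with ha₂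
  set F := 2 * (a₁ + a₂ + |c.lam| * K) * K ^ 2 with hF
  have hF0 : 0 ≤ F := by positivity
  set K' := a₁ * (b * (2 * (|c.μ₁| * K) * T) * K) + a₁ * (b * √P * (2 * F * T)) +
    a₂ * (b * (2 * (|c.μ₂| * K) * T) * K) + |c.lam| * (b * (K * K) * K) with hK'
  have hK'0 : 0 ≤ K' := by positivity
  refine ⟨K' * T, by positivity, ε₁, hε₁, ?_⟩
  intro ε hε hε1 B ψ₁ ψ₂ h hB0 h10 h20 t ht
  have hεn : ‖(ε : ℂ)‖ = ε := by rw [Complex.norm_real, Real.norm_of_nonneg hε.le]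
  have hdata : ∀ {f g : ℝ → ℝ → ℂ}, (∀ x, f 0 x = ε * g 0 x) → normSq f 0 = ε ^ 2 * normSq g 0 := by
    intro f g hfg
    rw [← hεn, ← normSq_const_mul]
    exact normSq_congr hfg
  have hBx0 : ∀ x, dx B 0 x = ε * dx U 0 x := by
    intro x
    have : B 0 = fun x => (ε : ℂ) * U 0 x := funext hB0
    rw [dx, this, deriv_const_mul_field]
    rfl
  have hap := H ε hε hε1 B ψ₁ ψ₂ h (hdata hB0) (hdata hBx0) (hdata h10) (by
    simp [normSq, h20])
  have sF := h.smooth_nonlinearity hT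
  have sN := h.smooth_B.density hT
  have hFle : ∀ τ ∈ Icc 0 T, √(normSq (nonlinearity c B ψ₁ ψ₂) τ) ≤ F * ε ^ 2 := fun τ hτ =>
    h.normSq_nonlinearity_le hT hτ hK hε (hε1.trans hε₁') (hap τ hτ).1 (hap τ hτ).2.1
      (hap τ hτ).2.2.1 (hap τ hτ).2.2.2.1
  -- the first-order errors in `B`, `ψ₁` and `ψ₂` are `O(ε²)` in `L²`
  have sw : SobolevSmooth T (fun t x => B t x - ε * U t x) := h.smooth_B.sub (hU.const_mul _)
  have hw : ∀ τ ∈ Icc 0 T, √(normSq (fun t x => B t x - ε * U t x) τ) ≤ 2 * F * T * ε ^ 2 := by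
    intro τ hτ
    have sUxx := (hU.dx hT).dx hT
    have e : ∀ t ∈ Icc 0 T, ∀ x, schroedingerRHS c B ψ₁ ψ₂ t x -
        ε * (Complex.I * c.ω * dx (dx U) t x) = Complex.I *
        (c.ω * dx (dx (fun t x => B t x - ε * U t x)) t x) +
        (-Complex.I) * nonlinearity c B ψ₁ ψ₂ t x := by
      intro t ht x
      have d1 : ∀ y, dx (fun t x => B t x - ε * U t x) t y = dx B t y - ε * dx U t y := fun y =>
        ((h.smooth_B.hasDerivAt ht y).sub ((hU.hasDerivAt ht y).const_mul _)).deriv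
      have d2 : dx (dx (fun t x => B t x - ε * U t x)) t x =
          dx (dx B) t x - ε * dx (dx U) t x := by
        rw [dx, funext d1]
        exact (((h.smooth_B.dx hT).hasDerivAt ht x).sub
          (((hU.dx hT).hasDerivAt ht x).const_mul _)).deriv
      rw [d2, schroedingerRHS]
      ring
    have k := sw.normSq_le_of_forcing hT
      ((h.smooth_schroedingerRHS hT).sub ((sUxx.const_mul _).const_mul _))
      (h.eq_B.sub (hU'.const_mul _)) (a := F * ε ^ 2) (by simp [normSq, hB0]) (by positivity)
      (fun τ hτ => (sw.re_pairing_le_of_schroedinger hT (sF.const_mul _) c.ω e hτ).trans (by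
        rw [normSq_const_mul, norm_neg, Complex.norm_I, one_pow, one_mul]
        gcongr
        exact hFle τ hτ)) hτ
    exact Real.sqrt_le_iff.2 ⟨by positivity, k.trans (le_of_eq (by ring))⟩
  have sη : SobolevSmooth T (fun t x => ψ₁ t x - ε * Ψ t x) := h.smooth₁.sub (hΨ.const_mul _)
  have hη : ∀ τ ∈ Icc 0 T,
      √(normSq (fun t x => ψ₁ t x - ε * Ψ t x) τ) ≤ 2 * (|c.μ₁| * K) * T * ε ^ 2 := by
    intro τ hτ
    have e : ∀ t ∈ Icc 0 T, ∀ x, transportRHS c.v₁ c.μ₁ B ψ₁ t x -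
        ε * (-(c.v₁ : ℂ) * dx Ψ t x) = -c.v₁ * dx (fun t x => ψ₁ t x - ε * Ψ t x) t x +
        (c.μ₁ : ℂ) * dx (density B) t x := by
      intro t ht x
      have d1 : dx (fun t x => ψ₁ t x - ε * Ψ t x) t x = dx ψ₁ t x - ε * dx Ψ t x :=
        ((h.smooth₁.hasDerivAt ht x).sub ((hΨ.hasDerivAt ht x).const_mul _)).deriv
      rw [d1, transportRHS]
      ring
    have k := sη.normSq_le_of_forcing hT
      ((h.smooth_B.transportRHS hT _ _ h.smooth₁).sub (((hΨ.dx hT).const_mul _).const_mul _))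
      (h.eq₁.sub (hΨ'.const_mul _)) (a := |c.μ₁| * K * ε ^ 2) (by simp [normSq, h10])
      (by positivity)
      (fun τ hτ => (sη.re_pairing_le_of_transport hT ((sN.dx hT).const_mul _) c.v₁ e hτ).trans
        (by
          rw [normSq_const_mul, Real.sqrt_mul (by positivity), Real.sqrt_sq (norm_nonneg _),
            Complex.norm_real, Real.norm_eq_abs, mul_assoc |c.μ₁| K]
          gcongr
          exact (hap τ hτ).2.2.2.2)) hτ
    exact Real.sqrt_le_iff.2 ⟨by positivity, k.trans (le_of_eq (by ring))⟩
  have hψ₂ : ∀ τ ∈ Icc 0 T, √(normSq ψ₂ τ) ≤ 2 * (|c.μ₂| * K) * T * ε ^ 2 := by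
    intro τ hτ
    have k := h.smooth₂.normSq_le_of_forcing hT (h.smooth_B.transportRHS hT _ _ h.smooth₂)
      h.eq₂ (a := |c.μ₂| * K * ε ^ 2) (by simp [normSq, h20]) (by positivity)
      (fun τ hτ => (re_pairing_transportRHS_le hT _ _ h.smooth_B h.smooth₂ hτ).trans
        (by
          rw [mul_assoc |c.μ₂| K]
          gcongr
          exact (hap τ hτ).2.2.2.2)) hτ
    exact Real.sqrt_le_iff.2 ⟨by positivity, k.trans (le_of_eq (by ring))⟩
  have hBn : ∀ τ ∈ Icc 0 T, √(normSq B τ) ≤ K * ε := fun τ hτ =>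
    Real.sqrt_le_iff.2 ⟨by positivity, (hap τ hτ).1.trans (le_of_eq (by ring))⟩
  -- hence the nonlinearity is `ε² r₁ μ₁ Ψ U + O(ε³)` when tested against `X`
  have hkey : ∀ τ ∈ Icc 0 T, ‖-Complex.I * pairing (nonlinearity c B ψ₁ ψ₂) X τ -
      (ε ^ 2 * (-Complex.I * (c.r₁ * c.μ₁))) * pairing (fun t x => Ψ t x * U t x) X τ‖ ≤
      K' * ε ^ 3 := by
    intro τ hτ
    have sηB := sη.mul hT h.smooth_B
    have sΨw := hΨ.mul hT sw
    have sψB := h.smooth₂.mul hT h.smooth_B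
    have sNB := sN.mul hT h.smooth_B
    have e : pairing (nonlinearity c B ψ₁ ψ₂) X τ =
        ((c.r₁ * c.μ₁ : ℝ) : ℂ) *
          pairing (fun t x => (ψ₁ t x - ε * Ψ t x) * B t x) X τ +
        (((c.r₁ * c.μ₁ : ℝ) : ℂ) * ε) *
          pairing (fun t x => Ψ t x * (B t x - ε * U t x)) X τ +
        ((c.r₂ * c.μ₂ : ℝ) : ℂ) * pairing (fun t x => ψ₂ t x * B t x) X τ +
        (c.lam : ℂ) * pairing (fun t x => density B t x * B t x) X τ +
        (ε ^ 2 * (c.r₁ * c.μ₁)) * pairing (fun t x => Ψ t x * U t x) X τ := by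
      simp only [← pairing_const_mul_left]
      have q1 := sηB.const_mul ((c.r₁ * c.μ₁ : ℝ) : ℂ)
      have q2 := sΨw.const_mul (((c.r₁ * c.μ₁ : ℝ) : ℂ) * ε)
      have q3 := sψB.const_mul ((c.r₂ * c.μ₂ : ℝ) : ℂ)
      have q4 := sNB.const_mul (c.lam : ℂ)
      rw [← q1.pairing_add_left q2 hX hτ, ← (q1.add q2).pairing_add_left q3 hX hτ,
        ← ((q1.add q2).add q3).pairing_add_left q4 hX hτ,
        ← (((q1.add q2).add q3).add q4).pairing_add_left ((hΨ.mul hT hU).const_mul _) hX hτ]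
      refine pairing_congr (fun x => ?_) fun _ => rfl
      simp only [nonlinearity, fullPotential, potential]
      push_cast
      ring
    have n1 := sη.norm_pairing_mul_le hT h.smooth_B hX hτ b.2 (hb τ hτ)
    have n2 := hΨ.norm_pairing_mul_le hT sw hX hτ b.2 (hb τ hτ)
    have n3 := h.smooth₂.norm_pairing_mul_le hT h.smooth_B hX hτ b.2 (hb τ hτ)
    have n4 := sN.norm_pairing_mul_le hT h.smooth_B hX hτ b.2 (hb τ hτ)
    have hN : √(normSq (density B) τ) ≤ (K * ε) * (K * ε) := by
      have k1 := h.smooth_B.normSq_mul_le hT h.smooth_B.conj hτ (b := K * ε)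
        (fun x => by rw [RCLike.norm_conj]; exact (hap τ hτ).2.1 x)
      apply Real.sqrt_le_iff.2 ⟨by positivity, k1.trans ?_⟩
      calc _ ≤ (K * ε) ^ 2 * (K ^ 2 * ε ^ 2) := by gcongr; exact (hap τ hτ).1
        _ = _ := by ring
    have hsub : -Complex.I * pairing (nonlinearity c B ψ₁ ψ₂) X τ -
        (ε ^ 2 * (-Complex.I * (c.r₁ * c.μ₁))) * pairing (fun t x => Ψ t x * U t x) X τ =
        -Complex.I * (((c.r₁ * c.μ₁ : ℝ) : ℂ) *
          pairing (fun t x => (ψ₁ t x - ε * Ψ t x) * B t x) X τ +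
        (((c.r₁ * c.μ₁ : ℝ) : ℂ) * ε) *
          pairing (fun t x => Ψ t x * (B t x - ε * U t x)) X τ +
        ((c.r₂ * c.μ₂ : ℝ) : ℂ) * pairing (fun t x => ψ₂ t x * B t x) X τ +
        (c.lam : ℂ) * pairing (fun t x => density B t x * B t x) X τ) := by
      rw [e]
      ring
    rw [hsub, norm_mul, norm_neg, Complex.norm_I, one_mul]
    refine (norm_add_le _ _).trans ((add_le_add_left norm_add₃_le _).trans ?_)
    rw [norm_mul, norm_mul, norm_mul, norm_mul, norm_mul, hεn]
    simp only [Complex.norm_real, Real.norm_eq_abs]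
    rw [← ha₁, ← ha₂]
    have hPτ : √(normSq Ψ τ) ≤ √P := Real.sqrt_le_sqrt (hP τ hτ)
    have m1 : a₁ * ‖pairing (fun t x => (ψ₁ t x - ε * Ψ t x) * B t x) X τ‖ ≤
        a₁ * (b * (2 * (|c.μ₁| * K) * T * ε ^ 2) * (K * ε)) := by
      gcongr
      refine n1.trans ?_
      gcongr
      exacts [le_rfl, hη τ hτ, hBn τ hτ]
    have m2 : a₁ * ε * ‖pairing (fun t x => Ψ t x * (B t x - ε * U t x)) X τ‖ ≤
        a₁ * ε * (b * √P * (2 * F * T * ε ^ 2)) := by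
      gcongr
      refine n2.trans ?_
      gcongr
      exacts [le_rfl, hw τ hτ]
    have m3 : a₂ * ‖pairing (fun t x => ψ₂ t x * B t x) X τ‖ ≤
        a₂ * (b * (2 * (|c.μ₂| * K) * T * ε ^ 2) * (K * ε)) := by
      gcongr
      refine n3.trans ?_
      gcongr
      exacts [le_rfl, hψ₂ τ hτ, hBn τ hτ]
    have m4 : |c.lam| * ‖pairing (fun t x => density B t x * B t x) X τ‖ ≤
        |c.lam| * (b * ((K * ε) * (K * ε)) * (K * ε)) := by
      gcongr
      refine n4.trans ?_
      gcongr
      exacts [le_rfl, hBn τ hτ]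
    refine (add_le_add (add_le_add (add_le_add m1 m2) m3) m4).trans (le_of_eq ?_)
    rw [hK']
    ring
  have e0 : pairing B X 0 = ε * pairing U X 0 := by
    rw [← pairing_const_mul_left]
    exact pairing_congr hB0 fun _ => rfl
  have iF := (sF.intervalIntegrable_pairing hX ht).const_mul (-Complex.I)
  have iU := ((hΨ.mul hT hU).intervalIntegrable_pairing hX ht).const_mul
    (ε ^ 2 * (-Complex.I * (c.r₁ * c.μ₁)))
  rw [h.pairing_B_eq hT hX hX' ht, e0, add_sub_add_left_eq_sub,
    ← mul_assoc ((ε : ℂ) ^ 2), ← intervalIntegral.integral_const_mul,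
    ← intervalIntegral.integral_sub iF iU]
  have hfin := intervalIntegral.norm_integral_le_of_norm_le_const (a := 0) (b := t)
    (f := fun τ => -Complex.I * pairing (nonlinearity c B ψ₁ ψ₂) X τ -
      (ε ^ 2 * (-Complex.I * (c.r₁ * c.μ₁))) * pairing (fun t x => Ψ t x * U t x) X τ)
    (C := K' * ε ^ 3) (by
      intro τ hτ
      rw [uIoc_of_le ht.1] at hτ
      exact hkey τ ⟨hτ.1.le, hτ.2.trans ht.2⟩)
  refine hfin.trans ?_
  rw [sub_zero, abs_of_nonneg ht.1]
  calc K' * ε ^ 3 * t ≤ K' * ε ^ 3 * T := by gcongr; exact ht.2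
    _ = _ := by ring

end IsSolution

/-! ### Free evolutions with compactly supported frequencies -/

open FourierTransform in
/-- The superposition of the plane waves `exp (-2 π i (t q(ξ) + x ξ))` with amplitudes `a ξ`. -/
def wave (a : ℝ → ℂ) (q : ℝ → ℝ) (t x : ℝ) : ℂ :=
  ∫ ξ, 𝐞 (-(t * q ξ + x * ξ)) • a ξ

open FourierTransform in
/-- The amplitude of `wave a q` at time `t`. -/
def amplitude (a : ℝ → ℂ) (q : ℝ → ℝ) (t ξ : ℝ) : ℂ := 𝐞 (-(t * q ξ)) • a ξ

open FourierTransform in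
theorem hasDerivAt_integral_fourierChar {b : ℝ → ℂ} (hb : Continuous b) (hb' : HasCompactSupport b)
    {g : ℝ → ℝ} (hg : Continuous g) (s : ℝ) :
    HasDerivAt (fun s => ∫ ξ, 𝐞 (-(s * g ξ)) • b ξ)
      (∫ ξ, 𝐞 (-(s * g ξ)) • (-(2 * Real.pi * Complex.I) * g ξ * b ξ)) s := by
  have hc : ∀ s : ℝ, Continuous fun ξ => 𝐞 (-(s * g ξ)) • b ξ := fun s => by
    simp only [Circle.smul_def]
    fun_prop
  have hc' : Continuous fun ξ => -(2 * Real.pi * Complex.I) * g ξ * b ξ := by fun_prop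
  refine (hasDerivAt_integral_of_dominated_loc_of_deriv_le (μ := volume)
    (F := fun s ξ => 𝐞 (-(s * g ξ)) • b ξ)
    (F' := fun s ξ => 𝐞 (-(s * g ξ)) • (-(2 * Real.pi * Complex.I) * g ξ * b ξ))
    (s := univ) (x₀ := s)
    (bound := fun ξ => ‖-(2 * Real.pi * Complex.I) * g ξ * b ξ‖) univ_mem
    (Eventually.of_forall fun s => (hc s).aestronglyMeasurable) ?_ ?_ ?_ ?_ ?_).2
  · exact (hc s).integrable_of_hasCompactSupport (hb'.smul_left)
  · have : Continuous fun ξ => 𝐞 (-(s * g ξ)) • (-(2 * Real.pi * Complex.I) * g ξ * b ξ) := by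
      simp only [Circle.smul_def]
      fun_prop
    exact this.aestronglyMeasurable
  · exact Eventually.of_forall fun ξ s _ => by rw [Circle.norm_smul]
  · exact (hc'.integrable_of_hasCompactSupport hb'.mul_left).norm
  · refine Eventually.of_forall fun ξ s _ => ?_
    have h1 : HasDerivAt (fun s : ℝ => -(s * g ξ)) (-(g ξ)) s := by
      have h := ((hasDerivAt_id s).mul_const (g ξ)).neg
      rw [one_mul] at h
      exact h
    have h2 := (Real.hasDerivAt_fourierChar (-(s * g ξ))).scomp s h1
    refine (h2.mul_const (b ξ)).congr_deriv ?_
    simp only [Circle.smul_def, smul_eq_mul, Complex.real_smul]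
    push_cast
    ring

section

variable {a : ℝ → ℂ} {q : ℝ → ℝ}

open FourierTransform in
theorem continuous_amplitude (ha : Continuous a) (hq : Continuous q) (t : ℝ) :
    Continuous (amplitude a q t) := by
  change Continuous fun ξ => (𝐞 (-(t * q ξ)) : ℂ) * a ξ
  fun_prop

theorem contDiff_amplitude (ha : ContDiff ℝ (⊤ : ℕ∞) a) (hq : ContDiff ℝ (⊤ : ℕ∞) q) (t : ℝ) :
    ContDiff ℝ (⊤ : ℕ∞) (amplitude a q t) := by
  have h : amplitude a q t = fun ξ =>
      Complex.exp (((2 * Real.pi * (-(t * q ξ)) : ℝ) : ℂ) * Complex.I) * a ξ := by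
    ext ξ
    rw [amplitude, Circle.smul_def, Real.fourierChar_apply]
    rfl
  rw [h]
  refine ContDiff.mul (ContDiff.cexp ?_) ha
  have hphase : ContDiff ℝ (⊤ : ℕ∞) fun ξ => 2 * Real.pi * (-(t * q ξ)) :=
    contDiff_const.mul (contDiff_const.mul hq).neg
  exact (Complex.ofRealCLM.contDiff.comp hphase).mul contDiff_const

theorem hasCompactSupport_amplitude (ha : HasCompactSupport a) (t : ℝ) :
    HasCompactSupport (amplitude a q t) := ha.smul_left

/-- The amplitude at time `t` as a Schwartz function. -/
def amplitudeSchwartz (ha : ContDiff ℝ (⊤ : ℕ∞) a) (ha' : HasCompactSupport a)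
    (hq : ContDiff ℝ (⊤ : ℕ∞) q) (t : ℝ) : 𝓢(ℝ, ℂ) :=
  (hasCompactSupport_amplitude (q := q) ha' t).toSchwartzMap (contDiff_amplitude ha hq t)

theorem norm_amplitude (t ξ : ℝ) : ‖amplitude a q t ξ‖ = ‖a ξ‖ := by
  rw [amplitude, Circle.norm_smul]

open FourierTransform in
theorem fourier_amplitudeSchwartz (ha : ContDiff ℝ (⊤ : ℕ∞) a) (ha' : HasCompactSupport a)
    (hq : ContDiff ℝ (⊤ : ℕ∞) q) (t x : ℝ) :
    𝓕 (amplitudeSchwartz ha ha' hq t) x = wave a q t x := by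
  rw [SchwartzMap.fourier_coe, Real.fourier_real_eq, wave]
  congr 1
  ext ξ
  change 𝐞 (-(ξ * x)) • (𝐞 (-(t * q ξ)) • a ξ) = _
  rw [smul_smul, ← AddChar.map_add_eq_mul]
  congr 2
  ring

open FourierTransform in
theorem hasDerivAt_wave_x (ha : Continuous a) (ha' : HasCompactSupport a) (hq : Continuous q)
    (t x : ℝ) : HasDerivAt (wave a q t)
      (wave (fun ξ => -(2 * Real.pi * Complex.I) * ξ * a ξ) q t x) x := by
  have hc := continuous_amplitude ha hq t
  have h := hasDerivAt_integral_fourierChar hc (hasCompactSupport_amplitude ha' t) continuous_id x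
  have e : ∀ b : ℝ → ℂ, ∀ y, ∫ ξ, 𝐞 (-(y * id ξ)) • amplitude b q t ξ = wave b q t y := by
    intro b y
    rw [wave]
    congr 1
    ext ξ
    rw [amplitude, smul_smul, ← AddChar.map_add_eq_mul]
    congr 2
    simp only [id_eq]
    ring
  rw [funext (e a)] at h
  refine h.congr_deriv ?_
  rw [← e]
  congr 1
  ext ξ
  simp only [amplitude, Circle.smul_def, smul_eq_mul, id]
  ring

open FourierTransform in
theorem hasDerivAt_wave_t (ha : Continuous a) (ha' : HasCompactSupport a) (hq : Continuous q)
    (t x : ℝ) : HasDerivAt (fun τ => wave a q τ x)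
      (wave (fun ξ => -(2 * Real.pi * Complex.I) * q ξ * a ξ) q t x) t := by
  have hc := continuous_amplitude ha continuous_id x
  have h := hasDerivAt_integral_fourierChar hc
    (hasCompactSupport_amplitude (q := id) ha' x) hq t
  have e : ∀ b : ℝ → ℂ, ∀ y, ∫ ξ, 𝐞 (-(y * q ξ)) • amplitude b id x ξ = wave b q y x := by
    intro b y
    rw [wave]
    congr 1
    ext ξ
    rw [amplitude, smul_smul, ← AddChar.map_add_eq_mul]
    congr 2
    simp only [id_eq]
    ring
  rw [funext (e a)] at h
  refine h.congr_deriv ?_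
  rw [← e]
  congr 1
  ext ξ
  simp only [amplitude, Circle.smul_def, smul_eq_mul]
  ring

theorem dx_wave (ha : Continuous a) (ha' : HasCompactSupport a) (hq : Continuous q) :
    dx (wave a q) = wave (fun ξ => -(2 * Real.pi * Complex.I) * ξ * a ξ) q := by
  ext t x
  exact (hasDerivAt_wave_x ha ha' hq t x).deriv

open FourierTransform in
/-- The graph `ξ ↦ (q ξ, ξ)` carries the amplitude to a measure on `ℝ²` whose Fourier transform
is the wave, as a function of `(t, x)`; this gives joint smoothness. -/
theorem contDiff_wave (ha : Continuous a) (ha' : HasCompactSupport a) (hq : Continuous q) :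
    ContDiff ℝ (⊤ : ℕ∞) (fun p : ℝ × ℝ => wave a q p.1 p.2) := by
  set L : ℝ × ℝ →L[ℝ] ℝ × ℝ →L[ℝ] ℝ :=
    (ContinuousLinearMap.mul ℝ ℝ).bilinearComp (ContinuousLinearMap.fst ℝ ℝ ℝ)
      (ContinuousLinearMap.fst ℝ ℝ ℝ) +
    (ContinuousLinearMap.mul ℝ ℝ).bilinearComp (ContinuousLinearMap.snd ℝ ℝ ℝ)
      (ContinuousLinearMap.snd ℝ ℝ ℝ) with hL
  have hgraph : Continuous fun ξ : ℝ => (q ξ, ξ) := by fun_prop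
  have hm : AEMeasurable (fun ξ : ℝ => (q ξ, ξ)) volume := hgraph.measurable.aemeasurable
  have e : (fun p : ℝ × ℝ => wave a q p.1 p.2) =
      VectorFourier.fourierIntegral Real.fourierChar
        (Measure.map (fun ξ : ℝ => (q ξ, ξ)) volume) L.toLinearMap₁₂ (fun v => a v.2) := by
    ext p
    rw [VectorFourier.fourierIntegral, integral_map hm]
    · rw [wave]
      congr 1
      ext ξ
      have hLp : L.toLinearMap₁₂ (q ξ, ξ) p = p.1 * q ξ + p.2 * ξ := by
        change L (q ξ, ξ) p = _
        simp [hL, mul_comm]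
      rw [hLp]
    · apply Continuous.aestronglyMeasurable
      have hLp : Continuous fun v => L v p := by fun_prop
      change Continuous fun v : ℝ × ℝ => (𝐞 (-(L v p)) : ℂ) * a v.2
      fun_prop
  rw [e]
  apply VectorFourier.contDiff_fourierIntegral
  intro n _
  rw [integrable_map_measure (by fun_prop) hm]
  apply Continuous.integrable_of_hasCompactSupport
  · simp only [Function.comp_def]
    fun_prop
  · exact ha'.norm.mul_left

theorem integral_norm_sq_wave (ha : ContDiff ℝ (⊤ : ℕ∞) a) (ha' : HasCompactSupport a)
    (hq : ContDiff ℝ (⊤ : ℕ∞) q) (t : ℝ) : ∫ x, ‖wave a q t x‖ ^ 2 = ∫ ξ, ‖a ξ‖ ^ 2 := by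
  have h := SchwartzMap.integral_norm_sq_fourier (amplitudeSchwartz ha ha' hq t)
  simp only [fourier_amplitudeSchwartz] at h
  rw [h]
  congr 1
  ext ξ
  rw [← norm_amplitude (a := a) (q := q) t ξ]
  rfl

theorem memLp_wave (ha : ContDiff ℝ (⊤ : ℕ∞) a) (ha' : HasCompactSupport a)
    (hq : ContDiff ℝ (⊤ : ℕ∞) q) (t : ℝ) : MemLp (wave a q t) 2 volume := by
  have h := (FourierTransform.fourier (amplitudeSchwartz ha ha' hq t)).memLp 2 volume
  rwa [show (FourierTransform.fourier (amplitudeSchwartz ha ha' hq t) : ℝ → ℂ) = wave a q t from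
    funext fun x => fourier_amplitudeSchwartz ha ha' hq t x] at h

theorem exists_iteratedDeriv_wave (ha : ContDiff ℝ (⊤ : ℕ∞) a) (ha' : HasCompactSupport a)
    (hq : ContDiff ℝ (⊤ : ℕ∞) q) (n : ℕ) :
    ∃ b : ℝ → ℂ, ContDiff ℝ (⊤ : ℕ∞) b ∧ HasCompactSupport b ∧
      ∀ t, iteratedDeriv n (wave a q t) = wave b q t := by
  induction n generalizing a with
  | zero => exact ⟨a, ha, ha', fun t => iteratedDeriv_zero⟩
  | succ n ih =>
    obtain ⟨b, hb, hb', h⟩ := ih (a := fun ξ => -(2 * Real.pi * Complex.I) * ξ * a ξ)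
      ((contDiff_const.mul Complex.ofRealCLM.contDiff).mul ha) ha'.mul_left
    refine ⟨b, hb, hb', fun t => ?_⟩
    rw [iteratedDeriv_succ', ← h t]
    congr 1
    exact congrFun (dx_wave ha.continuous ha' hq.continuous) t

theorem sobolevSmooth_wave (ha : ContDiff ℝ (⊤ : ℕ∞) a) (ha' : HasCompactSupport a)
    (hq : ContDiff ℝ (⊤ : ℕ∞) q) (T : ℝ) : SobolevSmooth T (wave a q) where
  smooth := (contDiff_wave ha.continuous ha' hq.continuous).contDiffOn
  bound n := by
    obtain ⟨b, hb, hb', h⟩ := exists_iteratedDeriv_wave ha ha' hq n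
    refine ⟨(√(∫ ξ, ‖b ξ‖ ^ 2)).toNNReal, fun t _ => ?_⟩
    have hm := memLp_wave hb hb' hq t
    have hI := integral_norm_sq_eq hm
    rw [integral_norm_sq_wave hb hb' hq] at hI
    rw [h, ← ENNReal.ofReal_toReal hm.2.ne, hI, Real.sqrt_sq ENNReal.toReal_nonneg]
    exact le_rfl

open Convolution in
/-- Parseval's identity for a product of three waves: the frequencies add up to zero. -/
theorem pairing_mul_wave {a₁ a₂ a₃ : ℝ → ℂ} {q₁ q₂ q₃ : ℝ → ℝ}
    (h₁ : ContDiff ℝ (⊤ : ℕ∞) a₁) (h₁' : HasCompactSupport a₁) (hq₁ : ContDiff ℝ (⊤ : ℕ∞) q₁)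
    (h₂ : ContDiff ℝ (⊤ : ℕ∞) a₂) (h₂' : HasCompactSupport a₂) (hq₂ : ContDiff ℝ (⊤ : ℕ∞) q₂)
    (h₃ : ContDiff ℝ (⊤ : ℕ∞) a₃) (h₃' : HasCompactSupport a₃) (hq₃ : ContDiff ℝ (⊤ : ℕ∞) q₃)
    (t : ℝ) :
    pairing (fun t x => wave a₁ q₁ t x * wave a₂ q₂ t x) (wave a₃ q₃) t =
      ∫ ζ, ∫ η, amplitude a₂ q₂ t η * amplitude a₁ q₁ t (ζ - η) * amplitude a₃ q₃ t (-ζ) := by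
  set A₁ := amplitudeSchwartz h₁ h₁' hq₁ t
  set A₂ := amplitudeSchwartz h₂ h₂' hq₂ t
  set A₃ := amplitudeSchwartz h₃ h₃' hq₃ t
  set G := SchwartzMap.convolution (ContinuousLinearMap.mul ℂ ℂ) A₂ A₁ with hG
  have e1 : ∀ x, FourierTransform.fourier G x = wave a₁ q₁ t x * wave a₂ q₂ t x := by
    intro x
    rw [hG, SchwartzMap.fourier_convolution_apply,
      Real.fourier_mul_convolution_eq A₂.integrable A₁.integrable, ← SchwartzMap.fourier_coe,
      ← SchwartzMap.fourier_coe, fourier_amplitudeSchwartz, fourier_amplitudeSchwartz, mul_comm]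
  have e2 : pairing (fun t x => wave a₁ q₁ t x * wave a₂ q₂ t x) (wave a₃ q₃) t =
      ∫ x, FourierTransform.fourier G x * FourierTransform.fourier A₃ x := by
    simp only [pairing, e1]
    congr 1
    ext x
    rw [fourier_amplitudeSchwartz]
  rw [e2, SchwartzMap.integral_fourier_mul_eq]
  congr 1
  ext ζ
  have e3 : FourierTransform.fourier (FourierTransform.fourier A₃) ζ =
      amplitude a₃ q₃ t (-ζ) := by
    have hinv : FourierTransformInv.fourierInv (FourierTransform.fourier A₃) = A₃ := by simp
    rw [SchwartzMap.fourierInv_apply_eq] at hinv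
    rw [show amplitude a₃ q₃ t (-ζ) = A₃ (-ζ) from rfl]
    conv_rhs => rw [← hinv]
    simp
  rw [e3, SchwartzMap.convolution_apply, convolution, ← integral_mul_const]
  rfl

end

/-! ### Schwartz functions as elements of Sobolev spaces -/

/-- The weight `(1 + |ξ|²)^{s/2}` of `H^s`. -/
def weight (s ξ : ℝ) : ℝ := (1 + ‖ξ‖ ^ 2) ^ (s / 2)

theorem weight_nonneg (s ξ : ℝ) : 0 ≤ weight s ξ := by
  unfold weight
  positivity

theorem hasTemperateGrowth_weight (s : ℝ) :
    (fun ξ : ℝ => ((weight s ξ : ℝ) : ℂ)).HasTemperateGrowth := by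
  unfold weight
  fun_prop

/-- The Schwartz function `g` as an element of `H^s`. -/
def ofSchwartz (s : ℝ) (g : 𝓢(ℝ, ℂ)) : Sobolev s :=
  ⟨SchwartzMap.toTemperedDistributionCLM ℝ ℂ volume g, g.memSobolev⟩

theorem toDistribution_ofSchwartz (s : ℝ) (g : 𝓢(ℝ, ℂ)) :
    Sobolev.toDistribution (ofSchwartz s g) =
      SchwartzMap.toTemperedDistributionCLM ℝ ℂ volume g := rfl

theorem isGivenBy_ofSchwartz (s : ℝ) (g : 𝓢(ℝ, ℂ)) :
    IsGivenBy (Sobolev.toDistribution (ofSchwartz s g)) g := by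
  intro φ
  constructor
  · exact integrable_mul_of_memLp (φ.memLp 2 volume) (g.memLp 2 volume)
  · rw [toDistribution_ofSchwartz]
    exact SchwartzMap.toTemperedDistributionCLM_apply_apply volume g φ

theorem norm_toLp_eq (g : 𝓢(ℝ, ℂ)) : ‖g.toLp 2‖ = √(∫ x, ‖g x‖ ^ 2) := by
  rw [integral_norm_sq_eq (g.memLp 2 volume), Real.sqrt_sq ENNReal.toReal_nonneg,
    SchwartzMap.norm_toLp]

/-- The `L²` norm after multiplication by a weight, for a function supported where the weight is
bounded by `W`. -/
theorem norm_toLp_smulLeft_weight_le (s : ℝ) (A : 𝓢(ℝ, ℂ)) {W : ℝ} (hW : 0 ≤ W)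
    (h : ∀ ξ, A ξ ≠ 0 → weight s ξ ≤ W) :
    ‖(SchwartzMap.smulLeftCLM ℂ (fun ξ : ℝ => ((weight s ξ : ℝ) : ℂ)) A).toLp 2‖ ≤
      W * √(∫ ξ, ‖A ξ‖ ^ 2) := by
  rw [norm_toLp_eq, ← Real.sqrt_sq hW, ← Real.sqrt_mul (by positivity)]
  apply Real.sqrt_le_sqrt
  rw [← integral_const_mul]
  apply integral_mono (integrable_norm_sq (SchwartzMap.memLp _ 2 volume))
    ((integrable_norm_sq (A.memLp 2 volume)).const_mul _)
  intro ξ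
  simp only [SchwartzMap.smulLeftCLM_apply_apply (hasTemperateGrowth_weight s)]
  by_cases hA : A ξ = 0
  · simp [hA]
  · rw [norm_smul, Complex.norm_real, Real.norm_of_nonneg (weight_nonneg s ξ), mul_pow]
    gcongr
    exacts [weight_nonneg s ξ, h ξ hA]

open FourierTransform in
theorem norm_ofSchwartz_fourier_le (s : ℝ) (A : 𝓢(ℝ, ℂ)) {W : ℝ} (hW : 0 ≤ W)
    (h : ∀ ξ, A ξ ≠ 0 → weight s ξ ≤ W) :
    ‖ofSchwartz s (𝓕 A)‖ ≤ W * √(∫ ξ, ‖A ξ‖ ^ 2) := by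
  set m := SchwartzMap.smulLeftCLM ℂ (fun ξ : ℝ => ((weight s ξ : ℝ) : ℂ)) (𝓕 (𝓕 A)) with hm
  have hb : Sobolev.bessel (ofSchwartz s (𝓕 A)) = (𝓕⁻ m).toLp 2 := by
    apply Sobolev.lp_toDistribution_injective
    rw [Sobolev.bessel_spec, toDistribution_ofSchwartz, Lp.toTemperedDistributionCLM_apply,
      Lp.toTemperedDistribution_toLp_eq]
    have e : TemperedDistribution.besselPotential ℝ ℂ s =
        TemperedDistribution.fourierMultiplierCLM ℂ (fun ξ : ℝ => ((weight s ξ : ℝ) : ℂ)) := rfl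
    rw [e, TemperedDistribution.fourierMultiplierCLM_toTemperedDistributionCLM_eq
      (hasTemperateGrowth_weight s), SchwartzMap.fourierMultiplierCLM_apply]
  have hAA : ∀ ξ, 𝓕 (𝓕 A) ξ = A (-ξ) := by
    intro ξ
    have hinv : 𝓕⁻ (𝓕 A) = A := by simp
    rw [SchwartzMap.fourierInv_apply_eq] at hinv
    conv_rhs => rw [← hinv]
    simp
  have hn : ‖(𝓕⁻ m).toLp 2‖ = ‖m.toLp 2‖ := by
    rw [← SchwartzMap.norm_fourier_toL2_eq]
    simp
  rw [Sobolev.norm_def, hb, hn]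
  refine (norm_toLp_smulLeft_weight_le s (𝓕 (𝓕 A)) hW fun ξ hξ => ?_).trans (le_of_eq ?_)
  · rw [hAA] at hξ
    have := h (-ξ) hξ
    rwa [weight, norm_neg] at this
  · simp only [hAA]
    rw [integral_neg_eq_self (fun ξ => ‖A ξ‖ ^ 2)]

open FourierTransform in
/-- Duality of `H^s` and `H^{-s}`. -/
theorem norm_toDistribution_apply_le (s : ℝ) (u : Sobolev s) (A : 𝓢(ℝ, ℂ)) {W : ℝ} (hW : 0 ≤ W)
    (h : ∀ ξ, A ξ ≠ 0 → weight (-s) ξ ≤ W) :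
    ‖Sobolev.toDistribution u (𝓕 A)‖ ≤ ‖u‖ * (W * √(∫ ξ, ‖A ξ‖ ^ 2)) := by
  set m := SchwartzMap.smulLeftCLM ℂ (fun ξ : ℝ => ((weight (-s) ξ : ℝ) : ℂ)) A with hm
  have hu : Sobolev.toDistribution u = TemperedDistribution.besselPotential ℝ ℂ (-s)
      (Lp.toTemperedDistributionCLM ℂ (volume : Measure ℝ) 2 (Sobolev.bessel u)) := by
    rw [Sobolev.bessel_spec]
    simp
  have happ : Sobolev.toDistribution u (𝓕 A) = ∫ x, (𝓕 m) x * Sobolev.bessel u x := by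
    rw [hu, TemperedDistribution.besselPotential,
      TemperedDistribution.fourierMultiplierCLM_apply_apply, fourierInv_fourier_eq,
      Lp.toTemperedDistributionCLM_apply, Lp.toTemperedDistribution_apply]
    rfl
  have hbn : √(∫ x, ‖Sobolev.bessel u x‖ ^ 2) = ‖u‖ := by
    rw [integral_norm_sq_eq (Lp.memLp _), Real.sqrt_sq ENNReal.toReal_nonneg, Sobolev.norm_def,
      Lp.norm_def]
  have hmn : √(∫ x, ‖(𝓕 m) x‖ ^ 2) = ‖m.toLp 2‖ := by
    rw [← norm_toLp_eq, SchwartzMap.norm_fourier_toL2_eq]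
  rw [happ]
  refine (norm_integral_mul_le ((𝓕 m).memLp 2 volume) (Lp.memLp _)).trans ?_
  rw [hbn, hmn, mul_comm]
  gcongr
  exact norm_toLp_smulLeft_weight_le (-s) A hW h

theorem mem_realSobolev_of_isGivenBy {s : ℝ} {f : Sobolev s} {r : ℝ → ℝ}
    (h : IsGivenBy (Sobolev.toDistribution f) (fun x => (r x : ℂ))) : f ∈ realSobolev s := by
  intro φ hφ
  rw [(h φ).2]
  have e : ∀ x, φ x * (r x : ℂ) = (((φ x).re * r x : ℝ) : ℂ) := by
    intro x
    rw [Complex.ofReal_mul, ← Complex.re_add_im (φ x), hφ x]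
    simp
  simp only [e]
  rw [integral_complex_ofReal, Complex.ofReal_im]

/-- The real-valued Schwartz function `g` as an element of the real space `H^s`. -/
def ofRealSchwartz (s : ℝ) (g : 𝓢(ℝ, ℝ)) : realSobolev s :=
  ⟨ofSchwartz s (g.postcompCLM Complex.ofRealCLM), mem_realSobolev_of_isGivenBy (r := g)
    (isGivenBy_ofSchwartz s _)⟩

theorem isGivenBy_ofRealSchwartz (s : ℝ) (g : 𝓢(ℝ, ℝ)) :
    IsGivenBy (Sobolev.toDistribution (ofRealSchwartz s g : Sobolev s))
      (fun x => (g x : ℂ)) :=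
  isGivenBy_ofSchwartz s _

theorem ofSchwartz_smul (s ε : ℝ) (g : 𝓢(ℝ, ℂ)) : ofSchwartz s (ε • g) = ε • ofSchwartz s g := by
  apply Sobolev.toDistribution_injective
  have h : ε • ofSchwartz s g = (ε : ℂ) • ofSchwartz s g := rfl
  rw [h, map_smul]
  exact map_smul (SchwartzMap.toTemperedDistributionCLM ℝ ℂ volume) (ε : ℂ) g

theorem ofRealSchwartz_smul (s ε : ℝ) (g : 𝓢(ℝ, ℝ)) :
    ofRealSchwartz s (ε • g) = ε • ofRealSchwartz s g := by
  apply Subtype.ext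
  change ofSchwartz s ((ε • g).postcompCLM Complex.ofRealCLM) =
    ε • ofSchwartz s (g.postcompCLM Complex.ofRealCLM)
  rw [← ofSchwartz_smul, map_smul]

/-- Taylor's formula of order two with a uniform remainder. -/
theorem exists_taylor_two_bound {E F : Type*} [NormedAddCommGroup E] [NormedSpace ℝ E]
    [NormedAddCommGroup F] [NormedSpace ℝ F] {S : E → F} (h : ContDiffAt ℝ 2 S 0) :
    ∃ C : ℝ, 0 ≤ C ∧ ∃ r : ℝ, 0 < r ∧ ∀ v, ‖v‖ < r →
      ‖S v - S 0 - fderiv ℝ S 0 v‖ ≤ C * ‖v‖ ^ 2 := by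
  obtain ⟨K, s, hs, hK⟩ := (h.fderiv_right (m := 1) (by norm_num)).exists_lipschitzOnWith
  have hd : ∀ᶠ x in 𝓝 (0 : E), DifferentiableAt ℝ S x :=
    (h.eventually (by simp)).mono fun x hx => hx.differentiableAt (by simp)
  obtain ⟨r, hr, hrs⟩ := Metric.mem_nhds_iff.1 (Filter.inter_mem hs hd)
  refine ⟨K, K.2, r, hr, fun v hv => ?_⟩
  have hsub : Metric.closedBall (0 : E) ‖v‖ ⊆ Metric.ball 0 r := fun x hx => by
    rw [mem_closedBall_zero_iff] at hx
    rw [mem_ball_zero_iff]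
    exact hx.trans_lt hv
  have k := (convex_closedBall (0 : E) ‖v‖).norm_image_sub_le_of_norm_fderiv_le'
    (𝕜 := ℝ) (f := S) (φ := fderiv ℝ S 0) (C := K * ‖v‖) (x := 0) (y := v)
    (fun x hx => (hrs (hsub hx)).2)
    (fun x hx => by
      have k1 := hK.norm_sub_le (hrs (hsub hx)).1 (hrs (Metric.mem_ball_self hr)).1
      rw [sub_zero] at k1
      rw [mem_closedBall_zero_iff] at hx
      refine k1.trans ?_
      gcongr)
    (Metric.mem_closedBall_self (norm_nonneg v)) (by simp)
  rw [sub_zero] at k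
  refine k.trans (le_of_eq ?_)
  ring

/-! ### Twice differentiable solution maps bound the quadratic interaction -/

theorem const_mul_wave (c : ℂ) (a : ℝ → ℂ) (q : ℝ → ℝ) (t x : ℝ) :
    c * wave a q t x = wave (fun ξ => c * a ξ) q t x := by
  rw [wave, ← integral_const_mul, wave]
  congr 1
  ext ξ
  simp only [Circle.smul_def, smul_eq_mul]
  ring

theorem amplitude_zero (a : ℝ → ℂ) (q : ℝ → ℝ) : amplitude a q 0 = a := by
  ext ξ
  simp [amplitude]

open FourierTransform in
/-- Even real amplitudes give real functions. -/
theorem conj_wave_zero {a : ℝ → ℂ} (heven : ∀ ξ, a (-ξ) = a ξ)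
    (hreal : ∀ ξ, (starRingEnd ℂ) (a ξ) = a ξ) (q : ℝ → ℝ) (x : ℝ) :
    (starRingEnd ℂ) (wave a q 0 x) = wave a q 0 x := by
  rw [wave, ← integral_conj, ← integral_neg_eq_self]
  congr 1
  ext ξ
  simp only [Circle.smul_def, smul_eq_mul, map_mul, hreal, heven, zero_mul, zero_add,
    ← Circle.coe_inv_eq_conj, ← AddChar.map_neg_eq_inv]
  congr 3
  ring

/-- Frequency-time symbol of the free Schrödinger group with dispersion `ω`. -/
def schroedingerSymbol (ω ξ : ℝ) : ℝ := 2 * Real.pi * ω * ξ ^ 2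

/-- Frequency-time symbol of the transport group with speed `v`. -/
def transportSymbol (v ξ : ℝ) : ℝ := -v * ξ

theorem contDiff_schroedingerSymbol (ω : ℝ) : ContDiff ℝ (⊤ : ℕ∞) (schroedingerSymbol ω) := by
  unfold schroedingerSymbol
  fun_prop

theorem contDiff_transportSymbol (v : ℝ) : ContDiff ℝ (⊤ : ℕ∞) (transportSymbol v) := by
  unfold transportSymbol
  fun_prop

theorem hasTimeDeriv_wave_schroedinger {a : ℝ → ℂ} (ha : Continuous a) (ha' : HasCompactSupport a)
    (ω T : ℝ) : HasTimeDeriv T (wave a (schroedingerSymbol ω)) (fun t x =>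
      Complex.I * ω * dx (dx (wave a (schroedingerSymbol ω))) t x) := by
  intro t _ x
  have hq := (contDiff_schroedingerSymbol ω).continuous
  refine (hasDerivAt_wave_t ha ha' hq t x).congr_deriv ?_
  beta_reduce
  rw [dx_wave ha ha' hq, dx_wave (a := fun ξ => -(2 * Real.pi * Complex.I) * ξ * a ξ)
    (by fun_prop) ha'.mul_left hq, const_mul_wave]
  congr 1
  ext ξ
  rw [schroedingerSymbol]
  push_cast
  linear_combination (-(4 * Real.pi ^ 2 * ω * ξ ^ 2 * a ξ * Complex.I)) * Complex.I_sq

theorem hasTimeDeriv_wave_transport {a : ℝ → ℂ} (ha : Continuous a) (ha' : HasCompactSupport a)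
    (v T : ℝ) : HasTimeDeriv T (wave a (transportSymbol v)) (fun t x =>
      -(v : ℂ) * dx (wave a (transportSymbol v)) t x) := by
  intro t _ x
  have hq := (contDiff_transportSymbol v).continuous
  refine (hasDerivAt_wave_t ha ha' hq t x).congr_deriv ?_
  beta_reduce
  rw [dx_wave ha ha' hq, const_mul_wave]
  congr 1
  ext ξ
  rw [transportSymbol]
  push_cast
  ring

/-- The coefficient of `ε²` in an expansion inherits the bound of a quadratic remainder. -/
theorem norm_le_of_quadratic_remainder {p₀ p₁ Q : ℂ} {M K : ℝ}
    (h : ∀ᶠ ε : ℝ in 𝓝[>] 0, ‖p₀ + ε * p₁ + ε ^ 2 * Q‖ ≤ M * ε ^ 2 + K * ε ^ 3) : ‖Q‖ ≤ M := by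
  have hpos : ∀ᶠ ε : ℝ in 𝓝[>] 0, 0 < ε := eventually_mem_nhdsWithin
  have hlim : ∀ f : ℝ → ℝ, Continuous f → Tendsto f (𝓝[>] 0) (𝓝 (f 0)) := fun f hf =>
    (hf.tendsto 0).mono_left nhdsWithin_le_nhds
  have hε : ∀ {ε : ℝ}, 0 < ε → ‖(ε : ℂ)‖ = ε := fun {ε} h0 => by
    rw [Complex.norm_real, Real.norm_of_nonneg h0.le]
  have h0 : p₀ = 0 := by
    rw [← norm_le_zero_iff]
    have := ge_of_tendsto (b := ‖p₀‖)
      (hlim (fun ε => ε * ‖p₁‖ + ε ^ 2 * ‖Q‖ + (M * ε ^ 2 + K * ε ^ 3)) (by fun_prop)) (by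
        filter_upwards [h, hpos] with ε h1 h2
        have k := norm_sub_le (p₀ + ε * p₁ + ε ^ 2 * Q) (ε * p₁ + ε ^ 2 * Q)
        have k2 := norm_add_le ((ε : ℂ) * p₁) (ε ^ 2 * Q)
        rw [show p₀ + ε * p₁ + ε ^ 2 * Q - (ε * p₁ + ε ^ 2 * Q) = p₀ by ring] at k
        rw [norm_mul, norm_mul, norm_pow, hε h2] at k2
        linarith)
    simpa using this
  subst h0
  have h1 : p₁ = 0 := by
    rw [← norm_le_zero_iff]
    have := ge_of_tendsto (b := ‖p₁‖) (hlim (fun ε => ε * ‖Q‖ + (M * ε + K * ε ^ 2))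
      (by fun_prop)) (by
        filter_upwards [h, hpos] with ε h1 h2
        have k := norm_sub_le (0 + ε * p₁ + ε ^ 2 * Q) (ε ^ 2 * Q)
        rw [show 0 + ε * p₁ + ε ^ 2 * Q - ε ^ 2 * Q = ε * p₁ by ring, norm_mul, norm_mul,
          norm_pow, hε h2] at k
        have k3 : ε * ‖p₁‖ ≤ ε * (ε * ‖Q‖ + (M * ε + K * ε ^ 2)) := by linarith
        exact le_of_mul_le_mul_left k3 h2)
    simpa using this
  subst h1
  have := ge_of_tendsto (b := ‖Q‖) (hlim (fun ε => M + K * ε) (by fun_prop)) (by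
    filter_upwards [h, hpos] with ε h1 h2
    rw [mul_zero, add_zero, zero_add, norm_mul, norm_pow, hε h2] at h1
    have k3 : ε ^ 2 * ‖Q‖ ≤ ε ^ 2 * (M + K * ε) := by linarith
    exact le_of_mul_le_mul_left k3 (by positivity))
  simpa using this

/-- A solution map `S`, abstractly: `data φ ψ` is the initial datum with Schrödinger component `φ`
and with `ψ` as its only nonzero transported component; for small `ε` the Schrödinger component of
`S (ε • data φ ψ)` is the one of a smooth solution. -/
structure IsSolutionMap (c : Coeffs) (T k ℓ : ℝ) {X Y : Type*} [NormedAddCommGroup X]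
    [NormedSpace ℝ X] [NormedAddCommGroup Y] [NormedSpace ℝ Y]
    (S : X → C(Icc (0 : ℝ) T, Sobolev k × Y)) (data : 𝓢(ℝ, ℂ) → 𝓢(ℝ, ℝ) → X) : Prop where
  norm_data_le : ∀ φ ψ, ‖data φ ψ‖ ≤ ‖ofSchwartz k φ‖ + ‖ofRealSchwartz ℓ ψ‖
  solution : ∀ φ ψ, ∀ᶠ ε : ℝ in 𝓝[>] 0, ∃ B ψ₁ ψ₂, IsSolution c T B ψ₁ ψ₂ ∧
    (∀ x, B 0 x = ε * φ x) ∧ (∀ x, ψ₁ 0 x = ε * ψ x) ∧ (∀ x, ψ₂ 0 x = 0) ∧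
    ∀ t : Icc (0 : ℝ) T, IsGivenBy (Sobolev.toDistribution (S (ε • data φ ψ) t).1) (B t)

/-- Test functionals on the range of a twice differentiable map bound the coefficient of `ε²`. -/
theorem norm_le_of_quadratic_expansion {X F : Type*} [NormedAddCommGroup X] [NormedSpace ℝ X]
    [NormedAddCommGroup F] [NormedSpace ℝ F] {S : X → F} {S' : X →L[ℝ] F} {C r : ℝ} (hr : 0 < r)
    (H : ∀ v, ‖v‖ < r → ‖S v - S 0 - S' v‖ ≤ C * ‖v‖ ^ 2) {ev : F →ₗ[ℝ] ℂ} {N : ℝ} (hN : 0 ≤ N)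
    (hev : ∀ f, ‖ev f‖ ≤ ‖f‖ * N) {u : X} {p Q : ℂ} {K : ℝ}
    (hexp : ∀ᶠ ε : ℝ in 𝓝[>] 0, ‖ev (S (ε • u)) - (ε * p + ε ^ 2 * Q)‖ ≤ K * ε ^ 3) :
    ‖Q‖ ≤ C * ‖u‖ ^ 2 * N := by
  apply norm_le_of_quadratic_remainder (p₀ := -ev (S 0)) (p₁ := p - ev (S' u)) (K := K)
  have hsmall : ∀ᶠ ε : ℝ in 𝓝[>] 0, ‖ε • u‖ < r := by
    have : Tendsto (fun ε : ℝ => ‖ε • u‖) (𝓝[>] 0) (𝓝 ‖(0 : ℝ) • u‖) :=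
      ((by fun_prop : Continuous fun ε : ℝ => ‖ε • u‖).tendsto 0).mono_left nhdsWithin_le_nhds
    rw [zero_smul, norm_zero] at this
    exact this.eventually_lt_const hr
  filter_upwards [hexp, hsmall, eventually_mem_nhdsWithin] with ε k1 hεr hε
  have hε' : 0 < ε := hε
  have k4 := hev (S (ε • u) - S 0 - S' (ε • u))
  rw [map_sub, map_sub, map_smul, map_smul, Complex.real_smul] at k4
  have k5 := H (ε • u) hεr
  rw [map_smul, norm_smul, Real.norm_of_nonneg hε'.le] at k5
  have k6 : ‖ev (S (ε • u)) - ev (S 0) - ε * ev (S' u)‖ ≤ C * ‖u‖ ^ 2 * N * ε ^ 2 := by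
    refine k4.trans ((mul_le_mul_of_nonneg_right k5 hN).trans (le_of_eq ?_))
    ring
  have k7 := norm_sub_le (ev (S (ε • u)) - ev (S 0) - ε * ev (S' u))
    (ev (S (ε • u)) - (ε * p + ε ^ 2 * Q))
  rw [show ev (S (ε • u)) - ev (S 0) - ε * ev (S' u) -
    (ev (S (ε • u)) - (ε * p + ε ^ 2 * Q)) =
    -ev (S 0) + ε * (p - ev (S' u)) + ε ^ 2 * Q by ring] at k7
  exact k7.trans (add_le_add k6 k1)

/-- Evaluation at time `t`, with the first component tested against `g`. -/
def testAt (k : ℝ) {T : ℝ} (Y : Type*) [NormedAddCommGroup Y] [NormedSpace ℝ Y]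
    (t : Icc (0 : ℝ) T) (g : 𝓢(ℝ, ℂ)) : C(Icc (0 : ℝ) T, Sobolev k × Y) →ₗ[ℝ] ℂ where
  toFun f := Sobolev.toDistribution (f t).1 g
  map_add' f₁ f₂ := by
    rw [ContinuousMap.add_apply, Prod.fst_add, map_add]
    rfl
  map_smul' ε f := by
    have e : ((ε • f) t).1 = (ε : ℂ) • (f t).1 := rfl
    rw [e, map_smul]
    rfl

theorem testAt_apply (k : ℝ) {T : ℝ} (Y : Type*) [NormedAddCommGroup Y] [NormedSpace ℝ Y]
    (t : Icc (0 : ℝ) T) (g : 𝓢(ℝ, ℂ)) (f : C(Icc (0 : ℝ) T, Sobolev k × Y)) :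
    testAt k Y t g f = Sobolev.toDistribution (f t).1 g := rfl

section

variable {a : ℝ → ℂ} {q : ℝ → ℝ}

open FourierTransform in
theorem apply_fourier_amplitudeSchwartz (ha : ContDiff ℝ (⊤ : ℕ∞) a) (ha' : HasCompactSupport a)
    (hq : ContDiff ℝ (⊤ : ℕ∞) q) (t : ℝ) {u : 𝓢'(ℝ, ℂ)} {f : ℝ → ℝ → ℂ} (hu : IsGivenBy u (f t)) :
    u (𝓕 (amplitudeSchwartz ha ha' hq t)) = pairing f (wave a q) t := by
  rw [pairing_comm, (hu _).2, pairing]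
  simp only [fourier_amplitudeSchwartz]

open FourierTransform in
theorem norm_testAt_amplitudeSchwartz_le (k : ℝ) {T : ℝ} (Y : Type*) [NormedAddCommGroup Y]
    [NormedSpace ℝ Y] (ha : ContDiff ℝ (⊤ : ℕ∞) a) (ha' : HasCompactSupport a)
    (hq : ContDiff ℝ (⊤ : ℕ∞) q) (t : Icc (0 : ℝ) T) {W : ℝ} (hW : 0 ≤ W)
    (hw : ∀ ξ, a ξ ≠ 0 → weight (-k) ξ ≤ W) (f : C(Icc (0 : ℝ) T, Sobolev k × Y)) :
    ‖testAt k Y t (𝓕 (amplitudeSchwartz ha ha' hq t)) f‖ ≤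
      ‖f‖ * (W * √(∫ ξ, ‖a ξ‖ ^ 2)) := by
  have e : ∀ ξ, ‖amplitudeSchwartz ha ha' hq t ξ‖ = ‖a ξ‖ := fun ξ => norm_amplitude _ ξ
  have k1 := norm_toDistribution_apply_le k (f t).1 (amplitudeSchwartz ha ha' hq t) hW
    fun ξ hξ => hw ξ (by
      rw [← norm_ne_zero_iff, e] at hξ
      exact norm_ne_zero_iff.1 hξ)
  simp only [e] at k1
  rw [testAt_apply]
  refine k1.trans ?_
  gcongr
  exact (norm_fst_le _).trans (f.norm_coe_le_norm _)

open FourierTransform in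
theorem exists_schwartz_wave_zero (s : ℝ) (ha : ContDiff ℝ (⊤ : ℕ∞) a) (ha' : HasCompactSupport a)
    (hq : ContDiff ℝ (⊤ : ℕ∞) q) {W : ℝ} (hW : 0 ≤ W) (hw : ∀ ξ, a ξ ≠ 0 → weight s ξ ≤ W) :
    ∃ φ : 𝓢(ℝ, ℂ), (∀ x, φ x = wave a q 0 x) ∧
      ‖ofSchwartz s φ‖ ≤ W * √(∫ ξ, ‖a ξ‖ ^ 2) := by
  refine ⟨𝓕 (amplitudeSchwartz ha ha' hq 0), fourier_amplitudeSchwartz ha ha' hq 0, ?_⟩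
  have e : ∀ ξ, amplitudeSchwartz ha ha' hq 0 ξ = a ξ := fun ξ => congrFun (amplitude_zero a _) ξ
  have := norm_ofSchwartz_fourier_le s (amplitudeSchwartz ha ha' hq 0) hW
    fun ξ hξ => hw ξ (by rwa [e] at hξ)
  simpa only [e] using this

theorem exists_realSchwartz_wave_zero (s : ℝ) (ha : ContDiff ℝ (⊤ : ℕ∞) a)
    (ha' : HasCompactSupport a) (hq : ContDiff ℝ (⊤ : ℕ∞) q) {W : ℝ} (hW : 0 ≤ W)
    (hw : ∀ ξ, a ξ ≠ 0 → weight s ξ ≤ W) (heven : ∀ ξ, a (-ξ) = a ξ)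
    (hreal : ∀ ξ, (starRingEnd ℂ) (a ξ) = a ξ) :
    ∃ ψ : 𝓢(ℝ, ℝ), (∀ x, ((ψ x : ℝ) : ℂ) = wave a q 0 x) ∧
      ‖ofRealSchwartz s ψ‖ ≤ W * √(∫ ξ, ‖a ξ‖ ^ 2) := by
  obtain ⟨φ, hφ, hn⟩ := exists_schwartz_wave_zero s ha ha' hq hW hw
  have e : ∀ x, ((φ.postcompCLM Complex.reCLM x : ℝ) : ℂ) = wave a q 0 x := fun x => by
    have : φ.postcompCLM Complex.reCLM x = (φ x).re := rfl
    rw [this, hφ, Complex.conj_eq_iff_re.1 (conj_wave_zero heven hreal _ x)]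
  refine ⟨φ.postcompCLM Complex.reCLM, e, ?_⟩
  have e' : (φ.postcompCLM Complex.reCLM).postcompCLM Complex.ofRealCLM = φ := by
    ext x
    exact (e x).trans (hφ x).symm
  change ‖ofSchwartz s ((φ.postcompCLM Complex.reCLM).postcompCLM Complex.ofRealCLM)‖ ≤ _
  rwa [e']

end

/-- The interaction of free waves, tested against a third wave, is bounded by `C` times the square
of the size of the data and the size of the test function. The amplitudes have compact supports,
where the weights of the Sobolev norms are at most `W₁`, `W₂`, `W₃`. -/
def InteractionBound (c : Coeffs) (T k ℓ C : ℝ) : Prop :=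
  ∀ (a₁ a₂ a₃ : ℝ → ℂ) (W₁ W₂ W₃ : ℝ),
    ContDiff ℝ (⊤ : ℕ∞) a₁ → HasCompactSupport a₁ → ContDiff ℝ (⊤ : ℕ∞) a₂ →
    HasCompactSupport a₂ → ContDiff ℝ (⊤ : ℕ∞) a₃ → HasCompactSupport a₃ →
    (∀ ξ, a₁ (-ξ) = a₁ ξ) → (∀ ξ, (starRingEnd ℂ) (a₁ ξ) = a₁ ξ) →
    0 ≤ W₁ → 0 ≤ W₂ → 0 ≤ W₃ → (∀ ξ, a₁ ξ ≠ 0 → weight ℓ ξ ≤ W₁) →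
    (∀ ξ, a₂ ξ ≠ 0 → weight k ξ ≤ W₂) → (∀ ξ, a₃ ξ ≠ 0 → weight (-k) ξ ≤ W₃) →
    ∀ t ∈ Icc 0 T, |c.r₁ * c.μ₁| * ‖∫ τ in 0..t, pairing (fun t x =>
      wave a₁ (transportSymbol c.v₁) t x * wave a₂ (schroedingerSymbol c.ω) t x)
      (wave a₃ (schroedingerSymbol (-c.ω))) τ‖ ≤
      C * (W₂ * √(∫ ξ, ‖a₂ ξ‖ ^ 2) + W₁ * √(∫ ξ, ‖a₁ ξ‖ ^ 2)) ^ 2 *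
        (W₃ * √(∫ ξ, ‖a₃ ξ‖ ^ 2))

/-- If the solution map is twice differentiable at the origin, its second derivative, tested
against `wave a₃`, bounds the interaction of the free waves. -/
theorem exists_interaction_bound {c : Coeffs} {T k ℓ : ℝ} (hT : 0 < T) {X Y : Type*}
    [NormedAddCommGroup X] [NormedSpace ℝ X] [NormedAddCommGroup Y] [NormedSpace ℝ Y]
    {S : X → C(Icc (0 : ℝ) T, Sobolev k × Y)} {data : 𝓢(ℝ, ℂ) → 𝓢(ℝ, ℝ) → X}
    (hS : IsSolutionMap c T k ℓ S data) (hC2 : ContDiffAt ℝ 2 S 0) :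
    ∃ C : ℝ, 0 ≤ C ∧ InteractionBound c T k ℓ C := by
  obtain ⟨C, hC, r, hr, H⟩ := exists_taylor_two_bound hC2
  refine ⟨C, hC, ?_⟩
  intro a₁ a₂ a₃ W₁ W₂ W₃ h₁ h₁' h₂ h₂' h₃ h₃' heven hreal hW₁ hW₂ hW₃ hw₁ hw₂ hw₃ t ht
  have q₁ := contDiff_transportSymbol c.v₁
  have q₂ := contDiff_schroedingerSymbol c.ω
  have q₃ := contDiff_schroedingerSymbol (-c.ω)
  have hV' : HasTimeDeriv T (wave a₃ (schroedingerSymbol (-c.ω)))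
      (fun t x => -(Complex.I * c.ω) * dx (dx (wave a₃ (schroedingerSymbol (-c.ω)))) t x) :=
    (hasTimeDeriv_wave_schroedinger h₃.continuous h₃' (-c.ω) T).congr fun t _ x => by
      push_cast
      ring
  obtain ⟨K, hK, ε₁, hε₁, hexp⟩ := IsSolution.exists_expansion c hT
    (sobolevSmooth_wave h₂ h₂' q₂ T) (sobolevSmooth_wave h₁ h₁' q₁ T)
    (sobolevSmooth_wave h₃ h₃' q₃ T)
    (hasTimeDeriv_wave_schroedinger h₂.continuous h₂' c.ω T)
    (hasTimeDeriv_wave_transport h₁.continuous h₁' c.v₁ T) hV'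
  obtain ⟨φ, eφ, hnφ⟩ := exists_schwartz_wave_zero k h₂ h₂' q₂ hW₂ hw₂
  obtain ⟨ψ, eψ, hnψ⟩ := exists_realSchwartz_wave_zero ℓ h₁ h₁' q₁ hW₁ hw₁ heven hreal
  have hu := (hS.norm_data_le φ ψ).trans (add_le_add hnφ hnψ)
  have hQ := norm_le_of_quadratic_expansion (u := data φ ψ) hr H
    (ev := testAt k Y ⟨t, ht⟩ (FourierTransform.fourier (amplitudeSchwartz h₃ h₃' q₃ t)))
    (N := W₃ * √(∫ ξ, ‖a₃ ξ‖ ^ 2)) (by positivity)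
    (norm_testAt_amplitudeSchwartz_le k Y h₃ h₃' q₃ ⟨t, ht⟩ hW₃ hw₃) (K := K)
    (p := pairing (wave a₂ (schroedingerSymbol c.ω)) (wave a₃ (schroedingerSymbol (-c.ω))) 0)
    (Q := -Complex.I * (c.r₁ * c.μ₁) * ∫ τ in 0..t, pairing (fun t x =>
        wave a₁ (transportSymbol c.v₁) t x * wave a₂ (schroedingerSymbol c.ω) t x)
        (wave a₃ (schroedingerSymbol (-c.ω))) τ) (by
    filter_upwards [hS.solution φ ψ, Ioc_mem_nhdsGT hε₁] with ε hsol hε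
    obtain ⟨B, ψ₁, ψ₂, hB, hB0, hψ₁0, hψ₂0, hgiven⟩ := hsol
    have k1 := hexp ε hε.1 hε.2 B ψ₁ ψ₂ hB (fun x => by rw [hB0, eφ])
      (fun x => by rw [hψ₁0, eψ]) hψ₂0 t ht
    rwa [testAt_apply, apply_fourier_amplitudeSchwartz h₃ h₃' q₃ t (hgiven ⟨t, ht⟩)])
  rw [norm_mul, norm_mul, norm_neg, Complex.norm_I, one_mul, ← Complex.ofReal_mul,
    Complex.norm_real, Real.norm_eq_abs] at hQ
  refine hQ.trans ?_
  gcongr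

/-! ### A resonant interaction -/

theorem weight_le {r N ξ : ℝ} (hN : 1 ≤ N) (h1 : N / 8 ≤ |ξ|) (h2 : |ξ| ≤ 2 * N) :
    weight r ξ ≤ (64 : ℝ) ^ (|r| / 2) * N ^ r := by
  have hN0 : 0 < N := by linarith
  have hsq : N ^ r = (N ^ 2) ^ (r / 2) := by
    rw [← Real.rpow_natCast, ← Real.rpow_mul hN0.le]
    congr 1
    push_cast
    ring
  have hlow : N ^ 2 / 64 ≤ 1 + ‖ξ‖ ^ 2 := by
    rw [Real.norm_eq_abs]
    nlinarith
  have hup : 1 + ‖ξ‖ ^ 2 ≤ 64 * N ^ 2 := by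
    rw [Real.norm_eq_abs]
    nlinarith [abs_nonneg ξ]
  rw [hsq, weight]
  rcases le_total 0 r with hr | hr
  · rw [abs_of_nonneg hr, ← Real.mul_rpow (by norm_num) (by positivity)]
    exact Real.rpow_le_rpow (by positivity) hup (by linarith)
  · rw [abs_of_nonpos hr]
    refine (Real.rpow_le_rpow_of_nonpos (by positivity) hlow (by linarith)).trans (le_of_eq ?_)
    rw [Real.div_rpow (by positivity) (by norm_num), neg_div, Real.rpow_neg (by norm_num)]
    ring

/-- The frequencies of a high-high interaction `η + (ζ - η) = ζ` between a Schrödinger wave at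
`η ≈ -N/2` and a transported wave at `ζ - η ≈ N`, in windows of width `μ` and on a time interval
`[0, t]` so short that the phase does not turn. The window centres are chosen so that the
resonance function `(ζ - η) (2 π ω (ζ + η) + v)` vanishes there, which is possible for `ω ≠ 0`. -/
theorem exists_resonant_frequencies (ω v : ℝ) {T : ℝ} (hT : 0 < T) :
    ∃ c₀ : ℝ, 0 < c₀ ∧ ∃ N₀ : ℝ, 1 ≤ N₀ ∧ ∀ N, N₀ ≤ N → ∃ μ t η₀ ζ₀ : ℝ,
      0 < μ ∧ 0 < t ∧ t ≤ T ∧ 100 * μ ≤ N ∧ ζ₀ - η₀ = N ∧ N / 4 ≤ |η₀| ∧ |η₀| ≤ N ∧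
      N / 4 ≤ |ζ₀| ∧ |ζ₀| ≤ N ∧ c₀ ≤ t * √(μ * N) ∧
      ∀ η ζ τ, |η - η₀| ≤ 2 * μ → |ζ - ζ₀| ≤ 2 * μ → τ ∈ Icc 0 t →
        |2 * Real.pi * τ * ((ζ - η) * (2 * Real.pi * ω * (ζ + η) + v))| ≤ 1 := by
  have hπ := Real.pi_pos
  have hdiff : ∀ {N μ η₀ ζ₀ η ζ : ℝ}, 0 < μ → 100 * μ ≤ N → ζ₀ - η₀ = N → |η - η₀| ≤ 2 * μ →
      |ζ - ζ₀| ≤ 2 * μ → |ζ - η| ≤ 2 * N := by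
    intro N μ η₀ ζ₀ η ζ hμ h100 hN h1 h2
    rw [abs_le] at h1 h2 ⊢
    constructor <;> linarith [h1.1, h1.2, h2.1, h2.2]
  by_cases hω : ω = 0
  · subst hω
    set κ := min T (1 / (4 * Real.pi * |v| + 1)) with hκ
    have hκ0 : 0 < κ := lt_min hT (by positivity)
    have hκv : κ * (4 * Real.pi * |v| + 1) ≤ 1 := by
      rw [← le_div_iff₀ (by positivity)]
      exact min_le_right _ _
    refine ⟨κ / 10, by positivity, 1, le_rfl, fun N hN => ?_⟩
    have hN0 : 0 < N := by linarith
    have habs : |(-N / 2)| = N / 2 := by rw [neg_div, abs_neg, abs_of_pos (by linarith)]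
    have habs' : |N / 2| = N / 2 := abs_of_pos (by linarith)
    refine ⟨N / 100, κ / N, -N / 2, N / 2, by positivity, by positivity, ?_, by linarith, by ring,
      by rw [habs]; linarith, by rw [habs]; linarith, by rw [habs']; linarith,
      by rw [habs']; linarith, ?_, ?_⟩
    · rw [div_le_iff₀ hN0]
      nlinarith [min_le_left T (1 / (4 * Real.pi * |v| + 1))]
    · rw [show N / 100 * N = (N / 10) ^ 2 by ring, Real.sqrt_sq (by positivity)]
      apply le_of_eq
      field_simp
    · intro η ζ τ h1 h2 hτ
      have h3 := hdiff (by positivity) (by linarith) (by ring : N / 2 - -N / 2 = N) h1 h2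
      simp only [mul_zero, zero_mul, zero_add, abs_mul, abs_of_nonneg hτ.1, abs_two,
        abs_of_pos hπ]
      have h4 : τ * |ζ - η| ≤ κ / N * (2 * N) :=
        mul_le_mul hτ.2 h3 (abs_nonneg _) (by positivity)
      rw [show κ / N * (2 * N) = 2 * κ by field_simp] at h4
      calc 2 * Real.pi * τ * (|ζ - η| * |v|) = 2 * Real.pi * |v| * (τ * |ζ - η|) := by ring
        _ ≤ 2 * Real.pi * |v| * (2 * κ) := by gcongr
        _ ≤ 1 := by linarith
  · set σ := -v / (2 * Real.pi * ω) with hσ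
    have hσv : v = -(2 * Real.pi * ω * σ) := by
      rw [hσ]
      field_simp
    set κ := 1 / (32 * Real.pi ^ 2 * T * |ω| + 100) with hκ
    have hκ0 : 0 < κ := by positivity
    have hκ1 : κ * (32 * Real.pi ^ 2 * T * |ω| + 100) = 1 := by
      rw [hκ]
      field_simp
    have hκ100 : κ * 100 ≤ 1 := by
      have : 0 ≤ κ * (32 * Real.pi ^ 2 * T * |ω|) := by positivity
      linarith
    refine ⟨T * √κ, by positivity, 1 + 2 * |σ|, by linarith [abs_nonneg σ], fun N hN => ?_⟩
    have hN1 : 1 ≤ N := by linarith [abs_nonneg σ]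
    have hN0 : 0 < N := by linarith
    have hσN := abs_le.1 (by linarith : |σ| ≤ N / 2)
    have habs : |(σ - N) / 2| = (N - σ) / 2 := by
      rw [abs_of_nonpos (by linarith)]
      ring
    have habs' : |(σ + N) / 2| = (σ + N) / 2 := abs_of_nonneg (by linarith)
    have hμ : 100 * (κ / N) ≤ N := by
      rw [mul_div_assoc', div_le_iff₀ hN0]
      nlinarith
    refine ⟨κ / N, T, (σ - N) / 2, (σ + N) / 2, by positivity, hT, le_rfl, hμ, by ring,
      by rw [habs]; linarith, by rw [habs]; linarith, by rw [habs']; linarith,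
      by rw [habs']; linarith, ?_, ?_⟩
    · rw [div_mul_cancel₀ _ hN0.ne']
    · intro η ζ τ h1 h2 hτ
      have h3 := hdiff (by positivity) hμ (by ring : (σ + N) / 2 - (σ - N) / 2 = N) h1 h2
      have h5 : |ζ + η - σ| ≤ 4 * (κ / N) := by
        rw [show ζ + η - σ = (ζ - (σ + N) / 2) + (η - (σ - N) / 2) by ring]
        exact (abs_add_le _ _).trans (by linarith)
      rw [show 2 * Real.pi * ω * (ζ + η) + v = 2 * Real.pi * ω * (ζ + η - σ) by
        rw [hσv]
        ring]
      simp only [abs_mul, abs_of_nonneg hτ.1, abs_two, abs_of_pos hπ]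
      have h6 : τ * (|ζ - η| * |ζ + η - σ|) ≤ T * (2 * N * (4 * (κ / N))) :=
        mul_le_mul hτ.2 (mul_le_mul h3 h5 (abs_nonneg _) (by positivity)) (by positivity) hT.le
      rw [show T * (2 * N * (4 * (κ / N))) = 8 * T * κ by field_simp; ring] at h6
      calc 2 * Real.pi * τ * (|ζ - η| * (2 * Real.pi * |ω| * |ζ + η - σ|))
          = 4 * Real.pi ^ 2 * |ω| * (τ * (|ζ - η| * |ζ + η - σ|)) := by ring
        _ ≤ 4 * Real.pi ^ 2 * |ω| * (8 * T * κ) := by gcongr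
        _ ≤ 1 := by linarith

open FourierTransform Convolution in
/-- Without oscillation there is no cancellation: if the total phase stays in `[-1, 1]`, the
interaction integral is at least half of what it is at `t = 0`. -/
theorem le_norm_integral_pairing {g₁ g₂ g₃ : ℝ → ℝ} {q₁ q₂ q₃ : ℝ → ℝ}
    (h₁ : ContDiff ℝ (⊤ : ℕ∞) g₁) (h₁' : HasCompactSupport g₁) (hq₁ : ContDiff ℝ (⊤ : ℕ∞) q₁)
    (h₂ : ContDiff ℝ (⊤ : ℕ∞) g₂) (h₂' : HasCompactSupport g₂) (hq₂ : ContDiff ℝ (⊤ : ℕ∞) q₂)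
    (h₃ : ContDiff ℝ (⊤ : ℕ∞) g₃) (h₃' : HasCompactSupport g₃) (hq₃ : ContDiff ℝ (⊤ : ℕ∞) q₃)
    (hg₂ : ∀ ξ, 0 ≤ g₂ ξ) (hg₃ : ∀ ξ, 0 ≤ g₃ ξ) {δ t : ℝ} (hδ : 0 ≤ δ) (ht : 0 < t)
    (H : ∀ η ζ, g₂ η ≠ 0 → g₃ (-ζ) ≠ 0 → g₁ (ζ - η) = δ ∧ ∀ τ ∈ Icc 0 t,
      |2 * Real.pi * τ * (q₂ η + q₁ (ζ - η) + q₃ (-ζ))| ≤ 1) :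
    t * (1 / 2 * δ * (∫ η, g₂ η) * ∫ ξ, g₃ ξ) ≤
      ‖∫ τ in 0..t, pairing (fun t x => wave (fun ξ => (g₁ ξ : ℂ)) q₁ t x *
        wave (fun ξ => (g₂ ξ : ℂ)) q₂ t x) (wave (fun ξ => (g₃ ξ : ℂ)) q₃) τ‖ := by
  have c₁ : ContDiff ℝ (⊤ : ℕ∞) fun ξ => (g₁ ξ : ℂ) := Complex.ofRealCLM.contDiff.comp h₁
  have c₂ : ContDiff ℝ (⊤ : ℕ∞) fun ξ => (g₂ ξ : ℂ) := Complex.ofRealCLM.contDiff.comp h₂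
  have c₃ : ContDiff ℝ (⊤ : ℕ∞) fun ξ => (g₃ ξ : ℂ) := Complex.ofRealCLM.contDiff.comp h₃
  have c₁' : HasCompactSupport fun ξ => (g₁ ξ : ℂ) := h₁'.comp_left Complex.ofReal_zero
  have c₂' : HasCompactSupport fun ξ => (g₂ ξ : ℂ) := h₂'.comp_left Complex.ofReal_zero
  have c₃' : HasCompactSupport fun ξ => (g₃ ξ : ℂ) := h₃'.comp_left Complex.ofReal_zero
  have hpt : ∀ τ ∈ Icc 0 t, ∀ ζ η, 1 / 2 * δ * g₃ (-ζ) * g₂ η ≤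
      (amplitude (fun ξ => (g₂ ξ : ℂ)) q₂ τ η * amplitude (fun ξ => (g₁ ξ : ℂ)) q₁ τ (ζ - η) *
        amplitude (fun ξ => (g₃ ξ : ℂ)) q₃ τ (-ζ)).re := by
    intro τ hτ ζ η
    by_cases k2 : g₂ η = 0
    · simp [amplitude, k2]
    by_cases k3 : g₃ (-ζ) = 0
    · simp [amplitude, k3]
    obtain ⟨hδ', hph⟩ := H η ζ k2 k3
    have hph := hph τ hτ
    set p := 2 * Real.pi * τ * (q₂ η + q₁ (ζ - η) + q₃ (-ζ)) with hp
    have e : amplitude (fun ξ => (g₂ ξ : ℂ)) q₂ τ η *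
        amplitude (fun ξ => (g₁ ξ : ℂ)) q₁ τ (ζ - η) *
        amplitude (fun ξ => (g₃ ξ : ℂ)) q₃ τ (-ζ) =
        ((δ * g₃ (-ζ) * g₂ η : ℝ) : ℂ) * Complex.exp (((-p : ℝ) : ℂ) * Complex.I) := by
      simp only [amplitude, Circle.smul_def, smul_eq_mul, hδ', Real.fourierChar_apply]
      have : ((-p : ℝ) : ℂ) * Complex.I =
          ((2 * Real.pi * -(τ * q₂ η) : ℝ) : ℂ) * Complex.I +
          ((2 * Real.pi * -(τ * q₁ (ζ - η)) : ℝ) : ℂ) * Complex.I +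
          ((2 * Real.pi * -(τ * q₃ (-ζ)) : ℝ) : ℂ) * Complex.I := by
        rw [hp]
        push_cast
        ring
      rw [this, Complex.exp_add, Complex.exp_add]
      push_cast
      ring
    have hcos : 1 / 2 ≤ Real.cos (-p) := by
      rw [Real.cos_neg]
      have h1 := Real.one_sub_sq_div_two_le_cos (x := p)
      have h2 : p ^ 2 ≤ 1 := (sq_le_one_iff_abs_le_one p).2 hph
      linarith
    rw [e, Complex.re_ofReal_mul, Complex.exp_ofReal_mul_I_re]
    have : 0 ≤ δ * g₃ (-ζ) * g₂ η := mul_nonneg (mul_nonneg hδ (hg₃ _)) (hg₂ _)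
    nlinarith
  have I₂ : Integrable g₂ := h₂.continuous.integrable_of_hasCompactSupport h₂'
  have I₃ : Integrable g₃ := h₃.continuous.integrable_of_hasCompactSupport h₃'
  have hinner : ∀ τ ∈ Icc 0 t, ∀ ζ, 1 / 2 * δ * (∫ η, g₂ η) * g₃ (-ζ) ≤
      (∫ η, amplitude (fun ξ => (g₂ ξ : ℂ)) q₂ τ η *
        amplitude (fun ξ => (g₁ ξ : ℂ)) q₁ τ (ζ - η) *
        amplitude (fun ξ => (g₃ ξ : ℂ)) q₃ τ (-ζ)).re := by
    intro τ hτ ζ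
    have hint : Integrable fun η => amplitude (fun ξ => (g₂ ξ : ℂ)) q₂ τ η *
        amplitude (fun ξ => (g₁ ξ : ℂ)) q₁ τ (ζ - η) *
        amplitude (fun ξ => (g₃ ξ : ℂ)) q₃ τ (-ζ) := by
      apply Continuous.integrable_of_hasCompactSupport
      · exact ((continuous_amplitude c₂.continuous hq₂.continuous τ).mul
          ((continuous_amplitude c₁.continuous hq₁.continuous τ).comp
            (continuous_const.sub continuous_id))).mul continuous_const
      · exact ((hasCompactSupport_amplitude c₂' τ).mul_right).mul_right
    have := integral_mono (I₂.const_mul (1 / 2 * δ * g₃ (-ζ))) hint.re fun η => hpt τ hτ ζ η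
    rw [integral_const_mul, integral_re hint] at this
    refine le_trans (le_of_eq ?_) this
    ring
  have hpair : ∀ τ ∈ Icc 0 t, 1 / 2 * δ * (∫ η, g₂ η) * (∫ ξ, g₃ ξ) ≤
      (pairing (fun t x => wave (fun ξ => (g₁ ξ : ℂ)) q₁ t x *
        wave (fun ξ => (g₂ ξ : ℂ)) q₂ t x) (wave (fun ξ => (g₃ ξ : ℂ)) q₃) τ).re := by
    intro τ hτ
    rw [pairing_mul_wave c₁ c₁' hq₁ c₂ c₂' hq₂ c₃ c₃' hq₃]
    have hint : Integrable fun ζ => ∫ η, amplitude (fun ξ => (g₂ ξ : ℂ)) q₂ τ η *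
        amplitude (fun ξ => (g₁ ξ : ℂ)) q₁ τ (ζ - η) *
        amplitude (fun ξ => (g₃ ξ : ℂ)) q₃ τ (-ζ) := by
      simp only [integral_mul_const]
      apply Continuous.integrable_of_hasCompactSupport
      · refine Continuous.mul ?_ ((continuous_amplitude c₃.continuous hq₃.continuous τ).comp
          continuous_neg)
        exact (hasCompactSupport_amplitude c₁' τ).continuous_convolution_right
          (ContinuousLinearMap.mul ℝ ℂ)
          (continuous_amplitude c₂.continuous hq₂.continuous τ).locallyIntegrable
          (continuous_amplitude c₁.continuous hq₁.continuous τ)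
      · exact HasCompactSupport.mul_left
          ((hasCompactSupport_amplitude c₃' τ).comp_homeomorph (Homeomorph.neg ℝ))
    have := integral_mono (I₃.comp_neg.const_mul (1 / 2 * δ * (∫ η, g₂ η))) hint.re
      fun ζ => hinner τ hτ ζ
    rw [integral_const_mul, integral_re hint, integral_neg_eq_self] at this
    exact this
  set P := pairing (fun t x => wave (fun ξ => (g₁ ξ : ℂ)) q₁ t x *
        wave (fun ξ => (g₂ ξ : ℂ)) q₂ t x) (wave (fun ξ => (g₃ ξ : ℂ)) q₃) with hP
  have hPint : IntervalIntegrable P volume 0 t :=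
    SobolevSmooth.intervalIntegrable_pairing
      ((sobolevSmooth_wave c₁ c₁' hq₁ t).mul ht (sobolevSmooth_wave c₂ c₂' hq₂ t))
      (sobolevSmooth_wave c₃ c₃' hq₃ t) ⟨ht.le, le_rfl⟩
  refine le_trans ?_ (Complex.re_le_norm _)
  have k := intervalIntegral.integral_mono_on ht.le
    (f := fun _ => 1 / 2 * δ * (∫ η, g₂ η) * (∫ ξ, g₃ ξ)) (g := fun τ => (P τ).re) (by simp)
    ⟨hPint.1.re, hPint.2.re⟩ hpair
  rw [intervalIntegral.integral_const, smul_eq_mul, sub_zero] at k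
  refine k.trans (le_of_eq ?_)
  exact (Complex.reCLM.intervalIntegral_comp_comm hPint)

/-! ### Windows in frequency space -/

/-- A smooth bump function, equal to `1` on `[-1, 1]` and supported in `[-2, 2]`. -/
def bump : ContDiffBump (0 : ℝ) := ⟨1, 2, one_pos, one_lt_two⟩

theorem bump_eq_one {x : ℝ} (h : |x| ≤ 1) : bump x = 1 :=
  bump.one_of_mem_closedBall (by simpa [bump] using h)

theorem bump_eq_zero {x : ℝ} (h : 2 ≤ |x|) : bump x = 0 :=
  bump.zero_of_le_dist (by simpa [bump] using h)

/-- The bump function of width `m` centred at `x₀`. -/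
def window (x₀ m ξ : ℝ) : ℝ := bump ((ξ - x₀) / m)

section

variable {x₀ m : ℝ}

theorem window_nonneg (x₀ m ξ : ℝ) : 0 ≤ window x₀ m ξ := bump.nonneg

theorem contDiff_window (x₀ m : ℝ) : ContDiff ℝ (⊤ : ℕ∞) (window x₀ m) := by
  unfold window
  exact bump.contDiff.comp ((contDiff_id.sub contDiff_const).div_const m)

theorem window_eq_one (hm : 0 < m) {ξ : ℝ} (h : |ξ - x₀| ≤ m) : window x₀ m ξ = 1 := by
  apply bump_eq_one
  rwa [abs_div, abs_of_pos hm, div_le_one hm]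

theorem window_eq_zero (hm : 0 < m) {ξ : ℝ} (h : 2 * m ≤ |ξ - x₀|) : window x₀ m ξ = 0 := by
  apply bump_eq_zero
  rwa [abs_div, abs_of_pos hm, le_div_iff₀ hm]

theorem abs_sub_le_of_window_ne_zero (hm : 0 < m) {ξ : ℝ} (h : window x₀ m ξ ≠ 0) :
    |ξ - x₀| ≤ 2 * m := by
  by_contra! k
  exact h (window_eq_zero hm k.le)

theorem hasCompactSupport_window (x₀ : ℝ) (hm : 0 < m) : HasCompactSupport (window x₀ m) :=
  HasCompactSupport.intro (isCompact_closedBall x₀ (2 * m)) fun ξ hξ => by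
    apply window_eq_zero hm
    rw [Metric.mem_closedBall, Real.dist_eq, not_le] at hξ
    exact hξ.le

theorem integral_comp_window (f : ℝ → ℝ) (x₀ : ℝ) (hm : 0 < m) :
    ∫ ξ, f (window x₀ m ξ) = m * ∫ ξ, f (bump ξ) := by
  unfold window
  rw [integral_sub_right_eq_self (fun ξ => f (bump (ξ / m))) x₀,
    Measure.integral_comp_div (fun ξ => f (bump ξ)), abs_of_pos hm, smul_eq_mul]

theorem integrable_window_sq (x₀ : ℝ) (hm : 0 < m) : Integrable fun ξ => window x₀ m ξ ^ 2 := by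
  have hc := (contDiff_window x₀ m).continuous
  simp only [sq]
  exact (hc.mul hc).integrable_of_hasCompactSupport (hasCompactSupport_window x₀ hm).mul_left

theorem sqrt_integral_window (r x₀ : ℝ) (hm : 0 < m) (hr : 0 ≤ r) :
    √(∫ ξ, ‖((r * window x₀ m ξ : ℝ) : ℂ)‖ ^ 2) = r * √(m * ∫ ξ, bump ξ ^ 2) := by
  simp only [Complex.norm_real, Real.norm_eq_abs, sq_abs, mul_pow]
  rw [integral_const_mul, integral_comp_window (fun x => x ^ 2) x₀ hm,
    Real.sqrt_mul (by positivity), Real.sqrt_sq hr]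

/-- The transported datum is real, so its amplitude is even, with windows at `N` and at `-N`. -/
theorem sqrt_integral_two_windows_le (r N : ℝ) (hm : 0 < m) (hr : 0 ≤ r) :
    √(∫ ξ, ‖((r * (window N m ξ + window N m (-ξ)) : ℝ) : ℂ)‖ ^ 2) ≤
      r * (2 * √(m * ∫ ξ, bump ξ ^ 2)) := by
  have hJ : 0 ≤ ∫ ξ, bump ξ ^ 2 := integral_nonneg fun ξ => by positivity
  have i1 := integrable_window_sq N hm
  have key : ∫ ξ, ‖((r * (window N m ξ + window N m (-ξ)) : ℝ) : ℂ)‖ ^ 2 ≤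
      (2 * r) ^ 2 * (m * ∫ ξ, bump ξ ^ 2) := by
    have e : ∫ ξ, 2 * r ^ 2 * (window N m ξ ^ 2 + window N m (-ξ) ^ 2) =
        (2 * r) ^ 2 * (m * ∫ ξ, bump ξ ^ 2) := by
      rw [integral_const_mul, integral_add i1 i1.comp_neg,
        integral_neg_eq_self (fun ξ => window N m ξ ^ 2),
        integral_comp_window (fun x => x ^ 2) N hm]
      ring
    rw [← e]
    apply integral_mono_of_nonneg (Eventually.of_forall fun ξ => by positivity)
      ((i1.add i1.comp_neg).const_mul _)
    refine Eventually.of_forall fun ξ => ?_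
    simp only [Complex.norm_real, Real.norm_eq_abs, sq_abs, mul_pow, Pi.add_apply]
    nlinarith [sq_nonneg (r * (window N m ξ - window N m (-ξ)))]
  refine (Real.sqrt_le_sqrt key).trans (le_of_eq ?_)
  rw [Real.sqrt_mul (by positivity), Real.sqrt_sq (by positivity)]
  ring

end

theorem integral_bump_sq_pos : 0 < ∫ ξ, bump ξ ^ 2 := by
  have hcont : Continuous fun ξ => bump ξ ^ 2 := bump.continuous.pow 2
  refine hcont.integral_pos_of_hasCompactSupport_nonneg_nonzero ?_
    (fun ξ => by positivity) (x := 0) ?_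
  · simp only [sq]
    exact bump.hasCompactSupport.mul_left
  · rw [bump_eq_one (by simp)]
    norm_num

/-! ### Unboundedness of the interaction for `ℓ < -1/2` -/

/-- The constant in the estimate of the interaction of waves with the amplitudes `window`. -/
theorem mul_sqrt_le_of_normalized {A I J C t μ W₁ W₂ W₃ α δ : ℝ} (hJ : 0 < J) (hμ : 0 < μ)
    (hW₁ : 0 < W₁) (hW₂ : 0 < W₂) (hα : α = 1 / (W₂ * √(μ * J)))
    (hδ : δ = 1 / (4 * W₁ * √(μ * J)))
    (h : A * (t * (1 / 2 * δ * (α * (μ * I)) * (μ * I))) ≤ C * 2 ^ 2 * (W₃ * (1 * √(μ * J)))) :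
    A * I ^ 2 * (t * √μ) ≤ 32 * C * J * √J * (W₁ * W₂ * W₃) := by
  have hs : √(μ * J) = √μ * √J := Real.sqrt_mul hμ.le J
  obtain ⟨a, ha0, ha⟩ : ∃ a, 0 < a ∧ √μ = a := ⟨_, Real.sqrt_pos.2 hμ, rfl⟩
  obtain ⟨b, hb0, hb⟩ : ∃ b, 0 < b ∧ √J = b := ⟨_, Real.sqrt_pos.2 hJ, rfl⟩
  have ea : μ = a ^ 2 := by rw [← ha, Real.sq_sqrt hμ.le]
  have eb : J = b ^ 2 := by rw [← hb, Real.sq_sqrt hJ.le]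
  rw [hs, ha, hb] at hα hδ h
  rw [ha, hb, eb]
  rw [ea] at h
  have hδα : δ * α * (4 * (W₁ * W₂) * (a * b) ^ 2) = 1 := by
    rw [hα, hδ]
    field_simp
  have h6 := mul_le_mul_of_nonneg_right h
    (by positivity : 0 ≤ 2 * (4 * (W₁ * W₂) * (a * b) ^ 2))
  have e6 : A * (t * (1 / 2 * δ * (α * (a ^ 2 * I)) * (a ^ 2 * I))) *
      (2 * (4 * (W₁ * W₂) * (a * b) ^ 2)) =
      A * I ^ 2 * (t * a) * (δ * α * (4 * (W₁ * W₂) * (a * b) ^ 2)) * a ^ 3 := by ring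
  have e7 : C * 2 ^ 2 * (W₃ * (1 * (a * b))) * (2 * (4 * (W₁ * W₂) * (a * b) ^ 2)) =
      32 * C * b ^ 2 * b * (W₁ * W₂ * W₃) * a ^ 3 := by ring
  rw [e6, e7, hδα, mul_one] at h6
  exact le_of_mul_le_mul_right h6 (by positivity)

/-- The estimate `exists_interaction_bound`, tested on waves with amplitudes `window`. -/
theorem InteractionBound.mul_sqrt_le {c : Coeffs} {T k ℓ C : ℝ} (H : InteractionBound c T k ℓ C)
    (hC : 0 ≤ C) {N μ t η₀ ζ₀ W₁ W₂ W₃ : ℝ} (hμ : 0 < μ) (ht : 0 < t) (htT : t ≤ T)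
    (hμN : 100 * μ ≤ N) (hdiff : ζ₀ - η₀ = N)
    (hphase : ∀ η ζ τ, |η - η₀| ≤ 2 * μ → |ζ - ζ₀| ≤ 2 * μ → τ ∈ Icc 0 t →
      |2 * Real.pi * τ * ((ζ - η) * (2 * Real.pi * c.ω * (ζ + η) + c.v₁))| ≤ 1)
    (hW₁ : 0 < W₁) (hW₂ : 0 < W₂) (hW₃ : 0 < W₃)
    (w₁ : ∀ ξ, |ξ - N| ≤ 2 * (4 * μ) → weight ℓ ξ ≤ W₁)
    (w₂ : ∀ ξ, |ξ - η₀| ≤ 2 * μ → weight k ξ ≤ W₂)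
    (w₃ : ∀ ξ, |ξ - -ζ₀| ≤ 2 * μ → weight (-k) ξ ≤ W₃) :
    |c.r₁ * c.μ₁| * (∫ ξ, bump ξ) ^ 2 * (t * √μ) ≤
      32 * C * (∫ ξ, bump ξ ^ 2) * √(∫ ξ, bump ξ ^ 2) * (W₁ * W₂ * W₃) := by
  have hJ0 := integral_bump_sq_pos
  obtain ⟨J, hJ⟩ : ∃ J, J = ∫ ξ, bump ξ ^ 2 := ⟨_, rfl⟩
  obtain ⟨I, hI⟩ : ∃ I, I = ∫ ξ, bump ξ := ⟨_, rfl⟩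
  rw [← hJ] at hJ0
  -- both data are normalized to have size at most `1`
  obtain ⟨α, hα⟩ : ∃ α, α = 1 / (W₂ * √(μ * J)) := ⟨_, rfl⟩
  obtain ⟨δ, hδ⟩ : ∃ δ, δ = 1 / (4 * W₁ * √(μ * J)) := ⟨_, rfl⟩
  have hα0 : 0 < α := by rw [hα]; positivity
  have hδ0 : 0 < δ := by rw [hδ]; positivity
  have h4μ : 0 < 4 * μ := by positivity
  obtain ⟨g₁, hg₁⟩ : ∃ g : ℝ → ℝ, g = fun ξ =>
    δ * (window N (4 * μ) ξ + window N (4 * μ) (-ξ)) := ⟨_, rfl⟩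
  obtain ⟨g₂, hg₂⟩ : ∃ g : ℝ → ℝ, g = fun ξ => α * window η₀ μ ξ := ⟨_, rfl⟩
  obtain ⟨g₃, hg₃⟩ : ∃ g : ℝ → ℝ, g = fun ξ => 1 * window (-ζ₀) μ ξ := ⟨_, rfl⟩
  have d₁ : ContDiff ℝ (⊤ : ℕ∞) g₁ := hg₁ ▸ contDiff_const.mul
    ((contDiff_window _ _).add ((contDiff_window _ _).comp contDiff_neg))
  have d₂ : ContDiff ℝ (⊤ : ℕ∞) g₂ := hg₂ ▸ contDiff_const.mul (contDiff_window _ _)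
  have d₃ : ContDiff ℝ (⊤ : ℕ∞) g₃ := hg₃ ▸ contDiff_const.mul (contDiff_window _ _)
  have s₁ : HasCompactSupport g₁ := hg₁ ▸ HasCompactSupport.mul_left
    ((hasCompactSupport_window N h4μ).add
      ((hasCompactSupport_window N h4μ).comp_homeomorph (Homeomorph.neg ℝ)))
  have s₂ : HasCompactSupport g₂ := hg₂ ▸ (hasCompactSupport_window _ hμ).mul_left
  have s₃ : HasCompactSupport g₃ := hg₃ ▸ (hasCompactSupport_window _ hμ).mul_left
  have upper := H (fun ξ => (g₁ ξ : ℂ)) (fun ξ => (g₂ ξ : ℂ)) (fun ξ => (g₃ ξ : ℂ)) W₁ W₂ W₃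
    (Complex.ofRealCLM.contDiff.comp d₁) (s₁.comp_left Complex.ofReal_zero)
    (Complex.ofRealCLM.contDiff.comp d₂) (s₂.comp_left Complex.ofReal_zero)
    (Complex.ofRealCLM.contDiff.comp d₃) (s₃.comp_left Complex.ofReal_zero)
    (fun ξ => by simp only [hg₁, neg_neg, add_comm]) (fun ξ => Complex.conj_ofReal _)
    hW₁.le hW₂.le hW₃.le
    (fun ξ hξ => by
      have hξ' : window N (4 * μ) ξ ≠ 0 ∨ window N (4 * μ) (-ξ) ≠ 0 := by
        by_contra! h
        simp [hg₁, h.1, h.2] at hξ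
      rcases hξ' with h | h
      · exact w₁ ξ (abs_sub_le_of_window_ne_zero h4μ h)
      · have := w₁ (-ξ) (abs_sub_le_of_window_ne_zero h4μ h)
        rwa [weight, norm_neg] at this)
    (fun ξ hξ => w₂ ξ (abs_sub_le_of_window_ne_zero hμ fun h => hξ (by simp [hg₂, h])))
    (fun ξ hξ => w₃ ξ (abs_sub_le_of_window_ne_zero hμ fun h => hξ (by simp [hg₃, h])))
    t ⟨ht.le, htT⟩
  have lower := le_norm_integral_pairing d₁ s₁ (contDiff_transportSymbol c.v₁)
    d₂ s₂ (contDiff_schroedingerSymbol c.ω) d₃ s₃ (contDiff_schroedingerSymbol (-c.ω))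
    (fun ξ => by rw [hg₂]; exact mul_nonneg hα0.le (window_nonneg _ _ _))
    (fun ξ => by rw [hg₃]; exact mul_nonneg zero_le_one (window_nonneg _ _ _)) hδ0.le ht
    (fun η ζ h2 h3 => by
      rw [hg₂] at h2
      rw [hg₃] at h3
      have k2 := abs_sub_le_of_window_ne_zero hμ (right_ne_zero_of_mul h2)
      have k3 := abs_sub_le_of_window_ne_zero hμ (right_ne_zero_of_mul h3)
      rw [show -ζ - -ζ₀ = -(ζ - ζ₀) by ring, abs_neg] at k3
      have l2 := abs_le.1 k2
      have l3 := abs_le.1 k3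
      constructor
      · have e1 : window N (4 * μ) (ζ - η) = 1 :=
          window_eq_one h4μ (abs_le.2 ⟨by linarith, by linarith⟩)
        have e2 : window N (4 * μ) (-(ζ - η)) = 0 := by
          apply window_eq_zero h4μ
          rw [abs_of_nonpos (by linarith)]
          linarith
        simp only [hg₁, e1, e2, add_zero, mul_one]
      · intro τ hτ
        have := hphase η ζ τ k2 k3 hτ
        rw [← abs_neg] at this
        refine le_of_eq_of_le (congrArg _ ?_) this
        simp only [schroedingerSymbol, transportSymbol]
        ring)
  have e₁ := sqrt_integral_two_windows_le δ N h4μ hδ0.le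
  have e₂ := sqrt_integral_window α η₀ hμ hα0.le
  have e₃ := sqrt_integral_window 1 (-ζ₀) hμ zero_le_one
  have i₂ : ∫ ξ, g₂ ξ = α * (μ * I) := by
    rw [hg₂, integral_const_mul, integral_comp_window (fun x => x) η₀ hμ, hI]
  have i₃ : ∫ ξ, g₃ ξ = μ * I := by
    rw [hg₃, integral_const_mul, integral_comp_window (fun x => x) (-ζ₀) hμ, one_mul, hI]
  rw [i₂, i₃] at lower
  simp only [hg₁, hg₂, hg₃] at upper lower
  rw [← hJ] at e₁ e₂ e₃
  rw [show 4 * μ * J = 2 ^ 2 * (μ * J) by ring, Real.sqrt_mul (by norm_num),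
    Real.sqrt_sq (by norm_num)] at e₁
  rw [e₂, e₃] at upper
  have hsize : W₂ * (α * √(μ * J)) + W₁ * √(∫ ξ, ‖((δ * (window N (4 * μ) ξ +
      window N (4 * μ) (-ξ)) : ℝ) : ℂ)‖ ^ 2) ≤ 2 := by
    have h0 : 0 < √(μ * J) := by positivity
    have h1 : W₂ * (α * √(μ * J)) = 1 := by
      rw [hα]
      field_simp
    have h2 : W₁ * (δ * (2 * (2 * √(μ * J)))) = 1 := by
      rw [hδ]
      field_simp
      norm_num
    have h3 := mul_le_mul_of_nonneg_left e₁ hW₁.le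
    linarith
  rw [← hJ, ← hI]
  refine mul_sqrt_le_of_normalized hJ0 hμ hW₁ hW₂ hα hδ
    ((mul_le_mul_of_nonneg_left lower (abs_nonneg _)).trans (upper.trans ?_))
  gcongr

/-- The quadratic interaction with a transported wave of regularity `ℓ < -1/2` is unbounded, so no
solution map is twice differentiable at the origin. -/
theorem IsSolutionMap.not_contDiffAt {c : Coeffs} {T k ℓ : ℝ} (hT : 0 < T) {X Y : Type*}
    [NormedAddCommGroup X] [NormedSpace ℝ X] [NormedAddCommGroup Y] [NormedSpace ℝ Y]
    {S : X → C(Icc (0 : ℝ) T, Sobolev k × Y)} {data : 𝓢(ℝ, ℂ) → 𝓢(ℝ, ℝ) → X}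
    (hS : IsSolutionMap c T k ℓ S data) (hc : c.r₁ * c.μ₁ ≠ 0) (hℓ : ℓ < -1 / 2) :
    ¬ ContDiffAt ℝ 2 S 0 := by
  intro hC2
  obtain ⟨C, hC, H⟩ := exists_interaction_bound hT hS hC2
  obtain ⟨c₀, hc₀, N₀, hN₀, freq⟩ := exists_resonant_frequencies c.ω c.v₁ hT
  obtain ⟨K, hK⟩ : ∃ K : ℝ → ℝ, ∀ r, K r = (64 : ℝ) ^ (|r| / 2) := ⟨_, fun _ => rfl⟩
  have hK0 : ∀ r, 0 < K r := fun r => by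
    rw [hK]
    positivity
  have hI0 : 0 < ∫ ξ, bump ξ := bump.integral_pos
  obtain ⟨A, hA⟩ : ∃ A, A = |c.r₁ * c.μ₁| * (∫ ξ, bump ξ) ^ 2 := ⟨_, rfl⟩
  have hA0 : 0 < A := hA ▸ mul_pos (abs_pos.2 hc) (by positivity)
  obtain ⟨D, hD⟩ : ∃ D, D = 32 * C * (∫ ξ, bump ξ ^ 2) * √(∫ ξ, bump ξ ^ 2) *
    (K ℓ * K k * K (-k)) := ⟨_, rfl⟩
  have main : ∀ N, N₀ ≤ N → A * c₀ ≤ D * N ^ (ℓ + 1 / 2) := by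
    intro N hN
    have hN1 : 1 ≤ N := hN₀.trans hN
    have hNpos : 0 < N := by linarith
    obtain ⟨μ, t, η₀, ζ₀, hμ, ht, htT, hμN, hdiff, hη1, hη2, hζ1, hζ2, hct, hphase⟩ := freq N hN
    have hW : ∀ r, 0 < K r * N ^ r := fun r => mul_pos (hK0 r) (Real.rpow_pos_of_pos hNpos r)
    have near : ∀ {r y : ℝ}, ∀ m, m ≤ N / 8 → N / 4 ≤ |y| → |y| ≤ N → ∀ ξ, |ξ - y| ≤ m →
        weight r ξ ≤ K r * N ^ r := by
      intro r y m hm h1 h2 ξ hξ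
      have h3 := abs_sub_abs_le_abs_sub ξ y
      have h4 := abs_sub_abs_le_abs_sub y ξ
      rw [abs_sub_comm] at h4
      rw [hK]
      exact weight_le hN1 (by linarith) (by linarith)
    have hNabs : |N| = N := abs_of_pos hNpos
    have key := H.mul_sqrt_le hC hμ ht htT hμN hdiff hphase (hW ℓ) (hW k) (hW (-k))
      (near (2 * (4 * μ)) (by linarith) (by rw [hNabs]; linarith) hNabs.le)
      (near (2 * μ) (by linarith) hη1 hη2)
      (near (2 * μ) (by linarith) (by rwa [abs_neg]) (by rwa [abs_neg]))
    have hWWW : K ℓ * N ^ ℓ * (K k * N ^ k) * (K (-k) * N ^ (-k)) =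
        K ℓ * K k * K (-k) * N ^ ℓ := by
      have : N ^ k * N ^ (-k) = 1 := by
        rw [← Real.rpow_add hNpos, add_neg_cancel, Real.rpow_zero]
      linear_combination (K ℓ * K k * K (-k) * N ^ ℓ) * this
    rw [hWWW, ← hA] at key
    have key' : A * (t * √μ) ≤ D * N ^ ℓ := key.trans (le_of_eq (by rw [hD]; ring))
    have hsN : N ^ (ℓ + 1 / 2) = N ^ ℓ * √N := by
      rw [Real.rpow_add hNpos, Real.sqrt_eq_rpow]
    calc A * c₀ ≤ A * (t * √(μ * N)) := by gcongr
      _ = A * (t * √μ) * √N := by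
        rw [Real.sqrt_mul hμ.le]
        ring
      _ ≤ D * N ^ ℓ * √N := by gcongr
      _ = D * N ^ (ℓ + 1 / 2) := by rw [hsN, mul_assoc]
  have hlim : Tendsto (fun N : ℝ => D * N ^ (ℓ + 1 / 2)) atTop (𝓝 (D * 0)) := by
    have := tendsto_rpow_neg_atTop (y := -(ℓ + 1 / 2)) (by linarith)
    rw [neg_neg] at this
    exact this.const_mul D
  rw [mul_zero] at hlim
  have := ge_of_tendsto hlim ((eventually_ge_atTop N₀).mono main)
  exact absurd this (not_le.2 (by positivity))

/-! ### The Zakharov–Rubenchik system -/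

/-- The same system with `ψ₁` and `ψ₂` exchanged. -/
def Coeffs.swap (c : Coeffs) : Coeffs where
  ω := c.ω
  lam := c.lam
  r₁ := c.r₂
  v₁ := c.v₂
  μ₁ := c.μ₂
  r₂ := c.r₁
  v₂ := c.v₁
  μ₂ := c.μ₁

theorem IsSolution.swap {c : Coeffs} {T : ℝ} {B ψ₁ ψ₂ : ℝ → ℝ → ℂ} (h : IsSolution c T B ψ₁ ψ₂) :
    IsSolution c.swap T B ψ₂ ψ₁ where
  smooth_B := h.smooth_B
  smooth₁ := h.smooth₂
  smooth₂ := h.smooth₁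
  real₁ := h.real₂
  real₂ := h.real₁
  eq_B := h.eq_B.congr fun t _ x => by
    simp only [schroedingerRHS, nonlinearity, fullPotential, potential, Coeffs.swap]
    ring
  eq₁ := h.eq₂
  eq₂ := h.eq₁

theorem sobolevSmooth_ofReal {T : ℝ} {f : ℝ → ℝ → ℝ}
    (hf : ContDiffOn ℝ (⊤ : ℕ∞) (fun p : ℝ × ℝ => f p.1 p.2) (Icc 0 T ×ˢ univ))
    (hb : ∀ n : ℕ, ∃ M : ℝ≥0, ∀ t ∈ Icc 0 T, eLpNorm (iteratedDeriv n (f t)) 2 volume ≤ M) :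
    SobolevSmooth T (fun t x => (f t x : ℂ)) where
  smooth := Complex.ofRealCLM.contDiff.comp_contDiffOn hf
  bound n := by
    obtain ⟨M, hM⟩ := hb n
    refine ⟨M, fun t ht => le_of_eq_of_le ?_ (hM t ht)⟩
    have hft : ContDiff ℝ (⊤ : ℕ∞) (f t) := by
      rw [← contDiffOn_univ]
      exact hf.comp (contDiff_const.prodMk contDiff_id).contDiffOn fun x _ => ⟨ht, mem_univ x⟩
    apply eLpNorm_congr_norm_ae
    refine Eventually.of_forall fun x => ?_
    rw [← norm_iteratedFDeriv_eq_norm_iteratedDeriv, ← norm_iteratedFDeriv_eq_norm_iteratedDeriv]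
    exact Complex.ofRealLI.norm_iteratedFDeriv_comp_left (hft.contDiffAt) (mod_cast le_top)

theorem hasDerivAt_of_contDiffOn_strip {E : Type*} [NormedAddCommGroup E] [NormedSpace ℝ E]
    {T : ℝ} {f : ℝ → ℝ → E}
    (hf : ContDiffOn ℝ (⊤ : ℕ∞) (fun p : ℝ × ℝ => f p.1 p.2) (Icc 0 T ×ˢ univ)) {t : ℝ}
    (ht : t ∈ Ioo 0 T) (x : ℝ) :
    HasDerivAt (fun τ => f τ x) (derivWithin (fun τ => f τ x) (Icc 0 T) t) t := by
  have h : ContDiffOn ℝ (⊤ : ℕ∞) (fun τ => f τ x) (Icc 0 T) :=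
    hf.comp (contDiff_id.prodMk contDiff_const).contDiffOn fun τ hτ => ⟨hτ, mem_univ x⟩
  exact ((h.differentiableOn (by simp) t (Ioo_subset_Icc_self ht)).hasDerivWithinAt).hasDerivAt
    (Icc_mem_nhds ht.1 ht.2)

theorem dx_ofReal {f : ℝ → ℝ → ℝ} {t x : ℝ} (hf : DifferentiableAt ℝ (f t) x) :
    dx (fun t x => (f t x : ℂ)) t x = deriv (f t) x :=
  hf.hasDerivAt.ofReal_comp.deriv

theorem density_eq (B : ℝ → ℝ → ℂ) :
    density B = fun t x => ((‖B t x‖ ^ 2 : ℝ) : ℂ) := by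
  ext t x
  rw [density, Complex.mul_conj, Complex.normSq_eq_norm_sq]

/-- The coefficients of the Zakharov–Rubenchik system in the form used here. -/
def zrCoeffs (c : ZRConstants) : Coeffs where
  ω := c.omega
  lam := c.γ * c.q
  r₁ := -(2 * √c.β * c.θ)
  v₁ := (√c.β - c.ν) / c.θ
  μ₁ := c.γ / (2 * c.θ) * (-1 + c.ν / (2 * √c.β))
  r₂ := 2 * √c.β * c.θ
  v₂ := -(c.ν + √c.β) / c.θ
  μ₂ := c.γ / (2 * c.θ) * (-1 - c.ν / (2 * √c.β))

section

variable {c : ZRConstants}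

theorem zrCoeffs_r₁_mul_μ₁ (hθ : c.θ ≠ 0) (hβ : 0 < c.β) :
    (zrCoeffs c).r₁ * (zrCoeffs c).μ₁ = c.γ * (√c.β - c.ν / 2) := by
  have h : √c.β ≠ 0 := (Real.sqrt_pos.2 hβ).ne'
  simp only [zrCoeffs]
  field_simp
  ring

theorem zrCoeffs_r₂_mul_μ₂ (hθ : c.θ ≠ 0) (hβ : 0 < c.β) :
    (zrCoeffs c).r₂ * (zrCoeffs c).μ₂ = -(c.γ * (√c.β + c.ν / 2)) := by
  have h : √c.β ≠ 0 := (Real.sqrt_pos.2 hβ).ne'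
  simp only [zrCoeffs]
  field_simp
  ring

theorem isSolution_of_isSmoothZRSolution (hθ : c.θ ≠ 0) (hβ : 0 < c.β) {T : ℝ}
    {B : ℝ → ℝ → ℂ} {ψ₁ ψ₂ : ℝ → ℝ → ℝ} (h : IsSmoothZRSolution c T B ψ₁ ψ₂) :
    IsSolution (zrCoeffs c) T B (fun t x => (ψ₁ t x : ℂ)) (fun t x => (ψ₂ t x : ℂ)) := by
  have sB : SobolevSmooth T B := ⟨h.smooth_B, h.sobolev_B⟩
  have dB : ∀ t ∈ Ioo 0 T, ∀ x,
      dx (density B) t x = ((deriv (fun y => ‖B t y‖ ^ 2) x : ℝ) : ℂ) := fun t ht x => by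
    rw [density_eq]
    exact dx_ofReal (((sB.contDiff (Ioo_subset_Icc_self ht)).norm_sq ℝ).differentiable
      (by simp) x)
  have dψ : ∀ {ψ : ℝ → ℝ → ℝ},
      ContDiffOn ℝ (⊤ : ℕ∞) (fun p : ℝ × ℝ => ψ p.1 p.2) (Icc 0 T ×ˢ univ) →
      ∀ t ∈ Ioo 0 T, ∀ x, dx (fun t x => (ψ t x : ℂ)) t x = ((deriv (ψ t) x : ℝ) : ℂ) :=
    fun {ψ} hψ t ht x => by
      have : ContDiffOn ℝ (⊤ : ℕ∞) (ψ t) univ :=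
        hψ.comp (contDiff_const.prodMk contDiff_id).contDiffOn
          fun x _ => ⟨Ioo_subset_Icc_self ht, mem_univ x⟩
      exact dx_ofReal ((contDiffOn_univ.1 this).differentiable (by simp) x)
  refine ⟨sB, sobolevSmooth_ofReal h.smooth_ψ₁ h.sobolev_ψ₁,
    sobolevSmooth_ofReal h.smooth_ψ₂ h.sobolev_ψ₂, fun t _ x => Complex.conj_ofReal _,
    fun t _ x => Complex.conj_ofReal _, ?_, ?_, ?_⟩
  · intro t ht x
    refine (hasDerivAt_of_contDiffOn_strip h.smooth_B ht x).congr_deriv ?_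
    have e := h.eq_B t (Ioo_subset_Icc_self ht) x
    have e2 : iteratedDeriv 2 (B t) x = dx (dx B) t x := by
      rw [iteratedDeriv_succ, iteratedDeriv_one]
      rfl
    rw [e2] at e
    simp only [schroedingerRHS, nonlinearity, fullPotential, potential, zrCoeffs_r₁_mul_μ₁ hθ hβ,
      zrCoeffs_r₂_mul_μ₂ hθ hβ, density_eq]
    simp only [zrCoeffs]
    push_cast at e ⊢
    linear_combination (-Complex.I) * e +
      (derivWithin (fun τ => B τ x) (Icc 0 T) t) * Complex.I_sq
  · intro t ht x
    refine (hasDerivAt_of_contDiffOn_strip h.smooth_ψ₁ ht x).ofReal_comp.congr_deriv ?_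
    rw [transportRHS, dB t ht, dψ h.smooth_ψ₁ t ht]
    have e := h.eq_ψ₁ t (Ioo_subset_Icc_self ht) x
    norm_cast
    simp only [zrCoeffs]
    generalize c.ν / (2 * √c.β) = κ at e ⊢
    field_simp
    linear_combination 2 * e
  · intro t ht x
    refine (hasDerivAt_of_contDiffOn_strip h.smooth_ψ₂ ht x).ofReal_comp.congr_deriv ?_
    rw [transportRHS, dB t ht, dψ h.smooth_ψ₂ t ht]
    have e := h.eq_ψ₂ t (Ioo_subset_Icc_self ht) x
    norm_cast
    simp only [zrCoeffs]
    generalize c.ν / (2 * √c.β) = κ at e ⊢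
    field_simp
    linear_combination 2 * e

/-- The point of the phase space given by Schwartz functions. -/
def schwartzData (k l s : ℝ) (φ : 𝓢(ℝ, ℂ)) (χ₁ χ₂ : 𝓢(ℝ, ℝ)) : ZRSpace k l s :=
  (ofSchwartz k φ, ofRealSchwartz l χ₁, ofRealSchwartz s χ₂)

theorem isGivenBy_schwartzData (k l s : ℝ) (φ : 𝓢(ℝ, ℂ)) (χ₁ χ₂ : 𝓢(ℝ, ℝ)) :
    (schwartzData k l s φ χ₁ χ₂).IsGivenBy φ χ₁ χ₂ :=
  ⟨isGivenBy_ofSchwartz k φ, isGivenBy_ofRealSchwartz l χ₁, isGivenBy_ofRealSchwartz s χ₂⟩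

theorem schwartzData_smul (k l s ε : ℝ) (φ : 𝓢(ℝ, ℂ)) (χ₁ χ₂ : 𝓢(ℝ, ℝ)) :
    schwartzData k l s (ε • φ) (ε • χ₁) (ε • χ₂) = ε • schwartzData k l s φ χ₁ χ₂ := by
  rw [schwartzData, ofSchwartz_smul, ofRealSchwartz_smul, ofRealSchwartz_smul]
  rfl

theorem ofRealSchwartz_zero (s : ℝ) : ofRealSchwartz s 0 = 0 := by
  have h := ofRealSchwartz_smul s 0 0
  rwa [zero_smul, zero_smul] at h

theorem eventually_exists_isSolution (hθ : c.θ ≠ 0) (hβ : 0 < c.β) {k l s T : ℝ}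
    {S : ZRSpace k l s → C(Icc (0 : ℝ) T, ZRSpace k l s)} (hS : IsZRDataToSolutionMap c S)
    (φ : 𝓢(ℝ, ℂ)) (χ₁ χ₂ : 𝓢(ℝ, ℝ)) : ∀ᶠ ε : ℝ in 𝓝[>] 0, ∃ B ψ₁ ψ₂,
      IsSolution (zrCoeffs c) T B ψ₁ ψ₂ ∧ (∀ x, B 0 x = ε * φ x) ∧
      (∀ x, ψ₁ 0 x = ε * χ₁ x) ∧ (∀ x, ψ₂ 0 x = ε * χ₂ x) ∧ ∀ t : Icc (0 : ℝ) T,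
        IsGivenBy (Sobolev.toDistribution (S (ε • schwartzData k l s φ χ₁ χ₂) t).1) (B t) := by
  have hlim : Tendsto (fun ε : ℝ => ε • schwartzData k l s φ χ₁ χ₂) (𝓝[>] 0) (𝓝 0) := by
    have : Tendsto (fun ε : ℝ => ε • schwartzData k l s φ χ₁ χ₂) (𝓝 0)
      (𝓝 ((0 : ℝ) • schwartzData k l s φ χ₁ χ₂)) := tendsto_id.smul_const _
    rw [zero_smul] at this
    exact this.mono_left nhdsWithin_le_nhds
  filter_upwards [hlim.eventually hS] with ε hε
  obtain ⟨B, ψ₁, ψ₂, hsol, hB, h₁, h₂, hgiven⟩ := hε (ε • φ) (ε • χ₁) (ε • χ₂) (by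
    rw [← schwartzData_smul]
    exact isGivenBy_schwartzData k l s _ _ _)
  refine ⟨B, _, _, isSolution_of_isSmoothZRSolution hθ hβ hsol, fun x => ?_, fun x => ?_,
    fun x => ?_, fun t => (hgiven t).1⟩
  · rw [hB]
    rfl
  · rw [h₁]
    exact Complex.ofReal_mul _ _
  · rw [h₂]
    exact Complex.ofReal_mul _ _

theorem isSolutionMap₁ (hθ : c.θ ≠ 0) (hβ : 0 < c.β) {k l s T : ℝ}
    {S : ZRSpace k l s → C(Icc (0 : ℝ) T, ZRSpace k l s)} (hS : IsZRDataToSolutionMap c S) :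
    IsSolutionMap (zrCoeffs c) T k l S (fun φ χ => schwartzData k l s φ χ 0) where
  norm_data_le φ χ := by
    rw [schwartzData, ofRealSchwartz_zero, Prod.norm_def, Prod.norm_def, norm_zero]
    refine max_le (le_add_of_nonneg_right (norm_nonneg _)) (max_le
      (le_add_of_nonneg_left (norm_nonneg _)) (by positivity))
  solution φ χ := (eventually_exists_isSolution hθ hβ hS φ χ 0).mono
    fun ε ⟨B, ψ₁, ψ₂, h, hB, h₁, h₂, hg⟩ => ⟨B, ψ₁, ψ₂, h, hB, h₁, fun x => by simp [h₂], hg⟩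

theorem isSolutionMap₂ (hθ : c.θ ≠ 0) (hβ : 0 < c.β) {k l s T : ℝ}
    {S : ZRSpace k l s → C(Icc (0 : ℝ) T, ZRSpace k l s)} (hS : IsZRDataToSolutionMap c S) :
    IsSolutionMap (zrCoeffs c).swap T k s S (fun φ χ => schwartzData k l s φ 0 χ) where
  norm_data_le φ χ := by
    rw [schwartzData, ofRealSchwartz_zero, Prod.norm_def, Prod.norm_def, norm_zero]
    refine max_le (le_add_of_nonneg_right (norm_nonneg _)) (max_le (by positivity)
      (le_add_of_nonneg_left (norm_nonneg _)))
  solution φ χ := (eventually_exists_isSolution hθ hβ hS φ 0 χ).mono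
    fun ε ⟨B, ψ₁, ψ₂, h, hB, h₁, h₂, hg⟩ =>
      ⟨B, ψ₂, ψ₁, h.swap, hB, h₂, fun x => by simp [h₁], hg⟩

end

end ZakharovRubenchik

end

theorem theorem1p4 (c : ZRConstants) (hθ : c.θ ≠ 0) (hβ : 0 < c.β) (hβν : c.β - c.ν ^ 2 ≠ 0)
    (hγ : c.γ ≠ 0) (k l s T : ℝ)
    (hls : (l < -1 / 2 ∧ c.ν ≠ 2 * √c.β) ∨ (s < -1 / 2 ∧ c.ν ≠ -(2 * √c.β))) (hT : 0 < T)
    (S : ZRSpace k l s → C(Icc (0 : ℝ) T, ZRSpace k l s))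
    (hS : IsZRDataToSolutionMap c S) :
    ¬ ContDiffAt ℝ 2 S 0 := by
  rcases hls with ⟨hl, hν⟩ | ⟨hs, hν⟩
  · refine (ZakharovRubenchik.isSolutionMap₁ hθ hβ hS).not_contDiffAt hT ?_ hl
    rw [ZakharovRubenchik.zrCoeffs_r₁_mul_μ₁ hθ hβ]
    exact mul_ne_zero hγ fun h => hν (by linarith)
  · refine (ZakharovRubenchik.isSolutionMap₂ hθ hβ hS).not_contDiffAt hT ?_ hs
    change (ZakharovRubenchik.zrCoeffs c).r₂ * (ZakharovRubenchik.zrCoeffs c).μ₂ ≠ 0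
    rw [ZakharovRubenchik.zrCoeffs_r₂_mul_μ₂ hθ hβ, neg_ne_zero]
    exact mul_ne_zero hγ fun h => hν (by linarith)
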